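/- Let $\Omega\subset\mathbb R^d$ be a bounded open set (for example a bounded Lipschitz domain with $d\in\{1,2,3\}$), let $T>0$, $0<\alpha<1$, $r\ge 1$, let $p\ge 0$ be an integer, $0<\sigma\le p+1$, and $K\ge 0$. Write $\langle\cdot,\cdot\rangle$ and $\|\cdot\|$ for the inner product and norm of $L^2(\Omega)$, $H_0^1(\Omega)$ for the closure of $C_c^\infty(\Omega)$ in $H^1(\Omega)$, and $\omega_\beta(t)=t^{\beta-1}/\Gamma(\beta)$. For functions of $t$ on $(0,T]$ with values in $L^2(\Omega)$ let $${}^C\!D_t^\alpha v(t)=\int_0^t\omega_{1-\alpha}(t-s)\,v'(s)\,ds,\qquad \partial_t^\alpha v(t)=\frac{d}{dt}\int_0^t\omega_{1-\alpha}(t-s)\,v(s)\,ds$$ be the Caputo and the Riemann--Liouville derivative of order $\alpha$. Let $u_0\in L^2(\Omega)$, $f(t)\in L^2(\Omega)$, and let $u(t)\in H_0^1(\Omega)$, $0<t\le T$, solve the subdiffusion problem ${}^C\!D_t^\alpha u-\Delta u=f$, $u(0)=u_0$, that is, $u(t)\to u_0$ in $L^2(\Omega)$ as $t\downarrow0$,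 and for almost every $t\in(0,T]$ $$\langle {}^C\!D_t^\alpha u(t),v\rangle+\langle\nabla u(t),\nabla v\rangle=\langle f(t),v\rangle\quad\text{for all } v\in H_0^1(\Omega).$$ Assume that $u$ is $p+1$ times differentiable on $(0,T]$ as a function with values in $H_0^1(\Omega)$, and that $$\|u^{(\ell)}(t)\|_{H^1(\Omega)}\le K(1+t^{\sigma-\ell}),\qquad 0<t\le T,\ 0\le\ell\le p+1 .$$ For $N\ge1$ let $t_n=(n/N)^rT$ for $0\le n\le N$ and $I_n=(t_{n-1},t_n]$ for $1\le n\le N$. For $S\subset\mathbb R$ let $\mathcal P_p(S)$ denote the polynomials in $t\in S$ of degree at most $p$ with coefficients in $H_0^1(\Omega)$. Let $U$ be the semi-discrete time-stepping discontinuous Galerkin solution of degree $p$: $U|_{I_n}\in\mathcal P_p(I_n)$ for $1\le n\le N$, and for all $1\le n\le N$ and all $X\in\mathcal P_p(I_n)$ $$\int_{I_n}\big[\langle\partial_t^\alpha U,X\rangle+\langle\nabla U,\nabla X\rangle\big]\,dt=\int_{I_n}\langle f+\omega_{1-\alpha}(t)u_0,X\rangle\,dt .$$ Then there is a constant $C>0$,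 depending only on $\Omega,T,\alpha,\sigma,r,p,K$ (in particular not on $N$ or $n$), such that for all $1\le n\le N$ $$\int_0^{t_n}\|U(t)-u(t)\|^2\,dt\le C\,\mathcal E(n,N,\sigma,\alpha,r,p),$$ where $$\mathcal E(n,N,\sigma,\alpha,r,p)=\begin{cases}N^{-r(1+2\sigma-\alpha)-\alpha}, & 1\le r<\frac{2p+2-\alpha}{1+2\sigma-\alpha},\\[2pt] N^{-2p-2}(1+\ln n), & r=\frac{2p+2-\alpha}{1+2\sigma-\alpha},\\[2pt] N^{-2p-2}\,t_n^{\,1+2\sigma-\alpha-\frac{2p+2-\alpha}{r}}, & r>\frac{2p+2-\alpha}{1+2\sigma-\alpha}.\end{cases}$$ -/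

import Mathlib

open MeasureTheory Set Filter Topology
open scoped ContDiff

noncomputable section

namespace Subdiffusion

/-! ### Spaces in the space variable -/

/-- `L²(Ω)`. -/
abbrev L2 {d : ℕ} (Ω : Set (EuclideanSpace ℝ (Fin d))) : Type :=
  Lp ℝ 2 (volume.restrict Ω)

/-- `L²(Ω; ℝᵈ)`. -/
abbrev L2Vec {d : ℕ} (Ω : Set (EuclideanSpace ℝ (Fin d))) : Type :=
  Lp (EuclideanSpace ℝ (Fin d)) 2 (volume.restrict Ω)

/-- Pairs `(v, g)` of a scalar and a vector field, with the norm `(‖v‖² + ‖g‖²)^(1/2)`. On the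
pairs `(v, ∇v)` this is the norm of `H¹(Ω)`. -/
abbrev GraphSpace {d : ℕ} (Ω : Set (EuclideanSpace ℝ (Fin d))) : Type :=
  WithLp 2 (L2 Ω × L2Vec Ω)

/-- The pairs `(φ, ∇φ)` with `φ ∈ C_c^∞(Ω)`. -/
def testPairs {d : ℕ} (Ω : Set (EuclideanSpace ℝ (Fin d))) : Set (GraphSpace Ω) :=
  {x | ∃ φ : EuclideanSpace ℝ (Fin d) → ℝ,
    ContDiff ℝ ∞ φ ∧ HasCompactSupport φ ∧ tsupport φ ⊆ Ω ∧
      x.fst =ᵐ[volume.restrict Ω] φ ∧ x.snd =ᵐ[volume.restrict Ω] gradient φ}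

/-- `H¹₀(Ω)`: the closure of `C_c^∞(Ω)` in the norm of `H¹(Ω)`. A function `v ∈ H¹₀(Ω)` is
represented by the pair `(v, ∇v)`. -/
abbrev H10 {d : ℕ} (Ω : Set (EuclideanSpace ℝ (Fin d))) : Submodule ℝ (GraphSpace Ω) :=
  (Submodule.span ℝ (testPairs Ω)).topologicalClosure

/-- A function of `H¹₀(Ω)` as an element of `L²(Ω)`. -/
def toL2 {d : ℕ} {Ω : Set (EuclideanSpace ℝ (Fin d))} (v : H10 Ω) : L2 Ω :=
  (v : GraphSpace Ω).fst

/-- The weak gradient of a function of `H¹₀(Ω)`. -/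
def grad {d : ℕ} {Ω : Set (EuclideanSpace ℝ (Fin d))} (v : H10 Ω) : L2Vec Ω :=
  (v : GraphSpace Ω).snd

/-! ### Fractional calculus -/

/-- The kernel `ω_β(t) = t^(β-1) / Γ(β)`. -/
def omega (β t : ℝ) : ℝ := t ^ (β - 1) / Real.Gamma β

/-- The Riemann–Liouville fractional integral of order `β > 0`, started at `0`. -/
def rlIntegral {F : Type*} [NormedAddCommGroup F] [NormedSpace ℝ F]
    (β : ℝ) (v : ℝ → F) (t : ℝ) : F :=
  ∫ s in (0 : ℝ)..t, omega β (t - s) • v s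

/-- The Riemann–Liouville fractional derivative `∂_t^α` of order `0 < α < 1`, started at `0`. -/
def rlDeriv {F : Type*} [NormedAddCommGroup F] [NormedSpace ℝ F]
    (α : ℝ) (v : ℝ → F) (t : ℝ) : F :=
  deriv (rlIntegral (1 - α) v) t

/-- The Caputo fractional derivative of order `0 < α < 1`, started at `0`. -/
def caputoDeriv {F : Type*} [NormedAddCommGroup F] [NormedSpace ℝ F]
    (α : ℝ) (v : ℝ → F) (t : ℝ) : F :=
  (Real.Gamma (1 - α))⁻¹ • ∫ s in (0 : ℝ)..t, (t - s) ^ (-α) • deriv v s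

/-! ### The subdiffusion problem -/

/-- `u` solves `D^α u - Δ u = f` in `Ω × (0, T]` (Caputo derivative in time, Laplacian in weak
form), `u = 0` on `∂Ω`, and `u(0) = u₀`, where the initial value is attained in `L²(Ω)`. -/
structure IsSolution {d : ℕ} (Ω : Set (EuclideanSpace ℝ (Fin d))) (T α : ℝ)
    (u₀ : L2 Ω) (f : ℝ → L2 Ω) (u : ℝ → H10 Ω) : Prop where
  initial : Tendsto (fun t => toL2 (u t)) (𝓝[>] 0) (𝓝 u₀)
  equation : ∀ᵐ t ∂(volume.restrict (Ioc 0 T)), ∀ v : H10 Ω,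
    inner ℝ (caputoDeriv α (fun s => toL2 (u s)) t) (toL2 v) + inner ℝ (grad (u t)) (grad v)
      = inner ℝ (f t) (toL2 v)

/-- `u` is `p + 1` times differentiable in time on `(0, T]` (one-sided at `T`), with
`‖u^(ℓ)(t)‖_{H¹} ≤ K (1 + t^(σ-ℓ))` for `0 ≤ ℓ ≤ p + 1`. -/
structure HasRegularity {d : ℕ} {Ω : Set (EuclideanSpace ℝ (Fin d))} (T σ : ℝ) (p : ℕ) (K : ℝ)
    (u : ℝ → H10 Ω) : Prop where
  differentiable : ∀ l : ℕ, l ≤ p →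
    DifferentiableOn ℝ (iteratedDerivWithin l u (Ioc 0 T)) (Ioc 0 T)
  bound : ∀ l : ℕ, l ≤ p + 1 → ∀ t ∈ Ioc 0 T,
    ‖iteratedDerivWithin l u (Ioc 0 T) t‖ ≤ K * (1 + t ^ (σ - l))

/-! ### The discontinuous Galerkin method -/

/-- The grid point `t_n = (n/N)^r T`. -/
def gridPoint (T r : ℝ) (N n : ℕ) : ℝ := ((n : ℝ) / N) ^ r * T

/-- The interval `I_n = (t_(n-1), t_n]`, for `n ≥ 1`. -/
def gridInterval (T r : ℝ) (N n : ℕ) : Set ℝ :=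
  Ioc (gridPoint T r N (n - 1)) (gridPoint T r N n)

/-- `v` coincides on `S` with a polynomial in time of degree at most `p` with coefficients
in `F`. -/
def IsPolyOn {F : Type*} [NormedAddCommGroup F] [NormedSpace ℝ F]
    (p : ℕ) (S : Set ℝ) (v : ℝ → F) : Prop :=
  ∃ c : Fin (p + 1) → F, ∀ t ∈ S, v t = ∑ j : Fin (p + 1), t ^ (j : ℕ) • c j

/-- `U` is the semi-discrete DG solution of degree `p` on the mesh `t_n = (n/N)^r T`. -/
structure IsDGSolution {d : ℕ} (Ω : Set (EuclideanSpace ℝ (Fin d))) (T α r : ℝ) (p N : ℕ)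
    (u₀ : L2 Ω) (f : ℝ → L2 Ω) (U : ℝ → H10 Ω) : Prop where
  poly : ∀ n : ℕ, 1 ≤ n → n ≤ N → IsPolyOn p (gridInterval T r N n) U
  equation : ∀ n : ℕ, 1 ≤ n → n ≤ N → ∀ X : ℝ → H10 Ω, IsPolyOn p (gridInterval T r N n) X →
    ∫ t in gridInterval T r N n,
        (inner ℝ (rlDeriv α (fun s => toL2 (U s)) t) (toL2 (X t)) + inner ℝ (grad (U t)) (grad (X t)))
      = ∫ t in gridInterval T r N n, inner ℝ (f t + omega (1 - α) t • u₀) (toL2 (X t))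

/-- The bound `𝓔(n, N, σ, α, r, p)`. -/
def errorBound (T : ℝ) (n N : ℕ) (σ α r : ℝ) (p : ℕ) : ℝ :=
  if r < (2 * p + 2 - α) / (1 + 2 * σ - α) then
    (N : ℝ) ^ (-r * (1 + 2 * σ - α) - α)
  else if r = (2 * p + 2 - α) / (1 + 2 * σ - α) then
    (N : ℝ) ^ (-2 * (p : ℝ) - 2) * (1 + Real.log n)
  else
    (N : ℝ) ^ (-2 * (p : ℝ) - 2) *
      gridPoint T r N n ^ (1 + 2 * σ - α - (2 * p + 2 - α) / r)

end Subdiffusion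

end

/-!
The argument takes place in an abstract Hilbert space and uses no smoothing property in space.

Write `B(v, w) = ∫₀^S ⟨∂ₜ^α v, w⟩` for the form `rlForm` of the fractional derivative, with
`S = t_n`. Since the kernel `ω_(1-α)` is a superposition of exponentials, `B` is a superposition in
`l > 0`, with weight `l^(α-1)`, of the forms `⟨P_l v, w⟩` with `P_l = ∂ₜ (l + ∂ₜ)⁻¹`
(`integral_rlDeriv_inner`). The operators `P_l` are contractions and satisfy
`‖P_l v‖² ≤ ⟨P_l v, v⟩`, because the Volterra operator is accretive. Hence the seminorm
`fracSq v = ∫ l^(α-1) ‖P_l v‖² dl`, which measures smoothness of order `α/2`, is controlled by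
`B(v, v)`; and as `l ⟨P_l v, w⟩` is the integral over `(0, l)` of `⟨P_q v, (P_q)* w⟩`, Hardy's
inequality gives the sector condition `|B(v, w)|² ≤ C fracSq(v) fracSq(w reversed in time)`
(`abs_integral_rlDeriv_inner_le`). No Fourier transform is needed.

Let `Π` be the `L²` projection in time onto the piecewise polynomials, `θ = U - Π u` and
`η = u - Π u`. With the discrete dual solution `X`, for which `B(W, X) = ∫ ⟨W, θ⟩` for all
piecewise polynomials `W`, Galerkin orthogonality gives `‖θ‖² ≤ B(η, X)`: the elliptic part
vanishes on `η` and has a sign on `θ`, since `X` is obtained from `θ` by a positive operator that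
acts in time only. Let `Y` be the exact dual solution, a fractional integral of `θ` backwards in
time. Then `B(η, Y) = ∫ ⟨η, θ⟩ = 0`, so `‖θ‖² ≤ B(η, X - Y)`. By quasi-optimality `X - Y` is as
small as the error of approximation of `Y` by step functions, which is `O(k^(α/2))` for the largest
step size `k` (`exists_step_fracSq_rev_le`). This gives `‖θ‖² ≤ C k^α fracSq(η)`
(`normSq_le_of_dual`, `normSq_galerkin_error_le`).

The projection `Π` is stable in the uniform norm and in variation on each mesh interval `I_j`, so
that `fracSq(η)` is bounded by the sum of `k_j^(1-α) M_j²`, where `M_j` is the error of local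
approximation by polynomials (`mesh_projection_error_le`). Taylor polynomials give
`M_j ≤ C k_j^(p+1) t_j^(σ-p-1)` (`HasSingularGrowth.exists_approx_grid`). On the graded mesh the sum
then becomes a power sum, whose exponent distinguishes the three regimes of the error bound
(`exists_sum_le_errorBound`).
-/

noncomputable section

namespace Subdiffusion

set_option linter.unusedSectionVars false

/-! ### Causal convolution on a bounded time interval -/

section Convolution

variable {H : Type*} [NormedAddCommGroup H] [InnerProductSpace ℝ H]
variable {S : ℝ} {m : Measure ℝ}

/-- Lebesgue measure on the time interval `(0, S]`. -/
abbrev timeMeasure (S : ℝ) : Measure ℝ := volume.restrict (Ioc 0 S)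

/-- The convolution of the kernel `k` with the vector measure `h dm`. -/
def cv {F : Type*} [NormedAddCommGroup F] [NormedSpace ℝ F]
    (m : Measure ℝ) (k : ℝ → ℝ) (h : ℝ → F) (t : ℝ) : F :=
  ∫ τ, k (t - τ) • h τ ∂m

theorem integrable_cv_integrand [SFinite m] {k : ℝ → ℝ} {h : ℝ → H}
    (hk : Integrable k) (hh : Integrable h m) (S : ℝ) :
    Integrable (fun p : ℝ × ℝ => k (p.1 - p.2) • h p.2) ((timeMeasure S).prod m) := by
  have h1 := Integrable.convolution_integrand (ContinuousLinearMap.lsmul ℝ ℝ).flip hh hk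
  have h2 : (timeMeasure S).prod m = (volume.prod m).restrict (Ioc 0 S ×ˢ univ) := by
    rw [← Measure.prod_restrict, Measure.restrict_univ]
  rw [h2]
  exact h1.restrict

theorem integrable_cv [SFinite m] {k : ℝ → ℝ} {h : ℝ → H}
    (hk : Integrable k) (hh : Integrable h m) (S : ℝ) :
    Integrable (cv m k h) (timeMeasure S) :=
  (integrable_cv_integrand hk hh S).integral_prod_left

theorem exists_bound_of_memLp_top {X : Type*} [MeasurableSpace X] {μ : Measure X} {v : X → H}
    (hv : MemLp v ⊤ μ) : ∃ M : ℝ, 0 ≤ M ∧ ∀ᵐ t ∂μ, ‖v t‖ ≤ M := by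
  refine ⟨(eLpNorm v ⊤ μ).toReal, ENNReal.toReal_nonneg, ?_⟩
  filter_upwards [ae_le_eLpNormEssSup (f := v) (μ := μ)] with t ht
  have := ENNReal.toReal_mono hv.2.ne (by simpa [eLpNorm_exponent_top] using ht)
  simpa using this

theorem integrable_inner_of_bounded {X : Type*} [MeasurableSpace X] {μ : Measure X} {f g : X → H}
    (hf : Integrable f μ) (hg : MemLp g ⊤ μ) : Integrable (fun x => inner ℝ (f x) (g x)) μ := by
  obtain ⟨M, hM, hb⟩ := exists_bound_of_memLp_top hg
  refine Integrable.mono' (hf.norm.mul_const M)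
    (hf.aestronglyMeasurable.inner hg.aestronglyMeasurable) ?_
  filter_upwards [hb] with x hx
  exact (norm_inner_le_norm _ _).trans (by gcongr)

theorem integrable_of_memLp_top {X : Type*} [MeasurableSpace X] {μ : Measure X}
    [IsFiniteMeasure μ] {g : X → H} (hg : MemLp g ⊤ μ) : Integrable g μ :=
  hg.integrable le_top

theorem aesm_comp_sub {k : ℝ → ℝ} (hk : AEStronglyMeasurable k volume) (t S : ℝ) :
    AEStronglyMeasurable (fun s => k (t - s)) (timeMeasure S) := by
  have : AEStronglyMeasurable (fun s => k (t - s)) volume :=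
    hk.comp_quasiMeasurePreserving (Measure.measurePreserving_sub_left volume t).quasiMeasurePreserving
  exact this.restrict

theorem integrable_comp_sub {k : ℝ → ℝ} (hk : Integrable k) (t S : ℝ) :
    Integrable (fun s => k (t - s)) (timeMeasure S) :=
  (hk.comp_sub_left t).restrict

theorem norm_cv_le {k : ℝ → ℝ} {v : ℝ → H} {M : ℝ} (hk : Integrable k) (hM : 0 ≤ M)
    (hb : ∀ᵐ t ∂(timeMeasure S), ‖v t‖ ≤ M) (t : ℝ) :
    ‖cv (timeMeasure S) k v t‖ ≤ (∫ x, |k x|) * M := by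
  have h1 : ‖cv (timeMeasure S) k v t‖ ≤ ∫ s, |k (t - s)| * M ∂(timeMeasure S) := by
    refine norm_integral_le_of_norm_le ((integrable_comp_sub hk t S).norm.mul_const M) ?_
    filter_upwards [hb] with s hs
    rw [norm_smul]
    exact mul_le_mul_of_nonneg_left hs (norm_nonneg _)
  refine h1.trans ?_
  rw [integral_mul_const]
  refine mul_le_mul_of_nonneg_right ?_ hM
  calc ∫ s in Ioc 0 S, |k (t - s)| ≤ ∫ s, |k (t - s)| :=
        setIntegral_le_integral (hk.comp_sub_left t).norm (ae_of_all _ fun _ => abs_nonneg _)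
    _ = ∫ x, |k x| := integral_sub_left_eq_self (fun x => |k x|) volume t

theorem memLp_top_cv {k : ℝ → ℝ} {v : ℝ → H} (hk : Integrable k)
    (hv : MemLp v ⊤ (timeMeasure S)) : MemLp (cv (timeMeasure S) k v) ⊤ (timeMeasure S) := by
  obtain ⟨M, hM, hb⟩ := exists_bound_of_memLp_top hv
  exact memLp_top_of_bound (integrable_cv hk (integrable_of_memLp_top hv) S).aestronglyMeasurable _
    (ae_of_all _ fun t => norm_cv_le hk hM hb t)

/-- Associativity of convolution, `k₁ * (k₂ * h dm) = (k₁ * k₂) * h dm`, at a single time. -/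
theorem cv_cv_of_integrable [CompleteSpace H] [SFinite m] {k₁ k₂ k₁₂ : ℝ → ℝ} {h : ℝ → H}
    (hk₁ : Integrable k₁) (hk₂ : Integrable k₂) (hh : Integrable h m) (hm : ∀ᵐ τ ∂m, 0 ≤ τ)
    (h₁ : ∀ x ∉ Ioc 0 S, k₁ x = 0) (h₂ : ∀ x ∉ Ioc 0 S, k₂ x = 0)
    (h₁₂ : ∀ x ≤ S, k₁₂ x = ∫ s, k₁ (x - s) * k₂ s) {t : ℝ} (ht : t ∈ Ioc 0 S)
    (hint : Integrable (fun s => |k₁ (t - s)| * cv m (fun x => |k₂ x|) (fun τ => ‖h τ‖) s)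
      (timeMeasure S)) :
    cv (timeMeasure S) k₁ (cv m k₂ h) t = cv m k₁₂ h t := by
  have hI := integrable_cv_integrand hk₂ hh S
  have hJ : Integrable (fun p : ℝ × ℝ => (k₁ (t - p.1) * k₂ (p.1 - p.2)) • h p.2)
      ((timeMeasure S).prod m) := by
    rw [integrable_prod_iff]
    · refine ⟨?_, ?_⟩
      · filter_upwards [hI.prod_right_ae] with s hs
        exact (hs.smul (k₁ (t - s))).congr (ae_of_all _ fun τ => by simp [mul_smul])
      · refine hint.congr (ae_of_all _ fun s => ?_)
        simp only [cv, smul_eq_mul, norm_smul, norm_mul, Real.norm_eq_abs, mul_assoc,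
          integral_const_mul]
    · have := ((aesm_comp_sub hk₁.aestronglyMeasurable t S).comp_fst (ν := m)).smul
        hI.aestronglyMeasurable
      refine this.congr (ae_of_all _ fun p => ?_)
      simp [mul_smul]
  calc cv (timeMeasure S) k₁ (cv m k₂ h) t
      = ∫ s, ∫ τ, (k₁ (t - s) * k₂ (s - τ)) • h τ ∂m ∂(timeMeasure S) := by
        simp only [cv, mul_smul, integral_smul]
    _ = ∫ τ, ∫ s, (k₁ (t - s) * k₂ (s - τ)) • h τ ∂(timeMeasure S) ∂m := integral_integral_swap hJ
    _ = cv m k₁₂ h t := by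
        refine integral_congr_ae ?_
        filter_upwards [hm] with τ hτ
        simp only [integral_smul_const]
        congr 1
        rw [h₁₂ _ (by linarith [ht.2]), setIntegral_eq_integral_of_forall_compl_eq_zero]
        · rw [← integral_sub_right_eq_self (fun s => k₁ (t - τ - s) * k₂ s) τ]
          refine integral_congr_ae (ae_of_all _ fun s => ?_)
          dsimp only
          congr 2
          ring
        · intro s hs
          rcases le_or_gt s 0 with h0 | h0
          · rw [h₂ (s - τ) (fun h => by linarith [h.1]), mul_zero]
          · rw [h₁ (t - s) (fun h => hs ⟨h0, by linarith [h.1, ht.2]⟩), zero_mul]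

theorem cv_cv_of_bounded [CompleteSpace H] [SFinite m] {k₁ k₂ k₁₂ : ℝ → ℝ} {h : ℝ → H} {M : ℝ}
    (hk₁ : Integrable k₁) (hk₂ : Integrable k₂) (hh : Integrable h m) (hm : ∀ᵐ τ ∂m, 0 ≤ τ)
    (h₁ : ∀ x ∉ Ioc 0 S, k₁ x = 0) (h₂ : ∀ x ∉ Ioc 0 S, k₂ x = 0)
    (h₁₂ : ∀ x ≤ S, k₁₂ x = ∫ s, k₁ (x - s) * k₂ s) (hM : ∀ x, |k₁ x| ≤ M)
    {t : ℝ} (ht : t ∈ Ioc 0 S) :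
    cv (timeMeasure S) k₁ (cv m k₂ h) t = cv m k₁₂ h t := by
  refine cv_cv_of_integrable hk₁ hk₂ hh hm h₁ h₂ h₁₂ ht ?_
  refine (integrable_cv hk₂.abs hh.norm S).bdd_mul (c := M) ?_ ?_
  · exact (aesm_comp_sub hk₁.aestronglyMeasurable t S).norm
  · exact ae_of_all _ fun s => by simpa using hM (t - s)

theorem cv_cv_ae [CompleteSpace H] [SFinite m] {k₁ k₂ k₁₂ : ℝ → ℝ} {h : ℝ → H}
    (hk₁ : Integrable k₁) (hk₂ : Integrable k₂) (hh : Integrable h m) (hm : ∀ᵐ τ ∂m, 0 ≤ τ)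
    (h₁ : ∀ x ∉ Ioc 0 S, k₁ x = 0) (h₂ : ∀ x ∉ Ioc 0 S, k₂ x = 0)
    (h₁₂ : ∀ x ≤ S, k₁₂ x = ∫ s, k₁ (x - s) * k₂ s) :
    ∀ᵐ t ∂(timeMeasure S), cv (timeMeasure S) k₁ (cv m k₂ h) t = cv m k₁₂ h t := by
  have hI := (integrable_cv_integrand hk₁.abs (integrable_cv hk₂.abs hh.norm S) S).prod_right_ae
  filter_upwards [hI, ae_restrict_mem measurableSet_Ioc] with t h3 ht
  exact cv_cv_of_integrable hk₁ hk₂ hh hm h₁ h₂ h₁₂ ht h3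

/-! ### Time reversal -/

theorem measurePreserving_reflect (S : ℝ) :
    MeasurePreserving (fun t => S - t) (timeMeasure S) (timeMeasure S) := by
  have h1 := (Measure.measurePreserving_sub_left volume S).restrict_preimage
    (measurableSet_Ioc (a := (0 : ℝ)) (b := S))
  have h2 : volume.restrict ((fun t => S - t) ⁻¹' Ioc 0 S) = timeMeasure S := by
    have : (fun t => S - t) ⁻¹' Ioc 0 S = Ico 0 S := by
      ext t
      simp only [mem_preimage, mem_Ioc, mem_Ico]
      constructor <;> rintro ⟨_, _⟩ <;> constructor <;> linarith
    rw [this]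
    exact Measure.restrict_congr_set Ico_ae_eq_Ioc
  rwa [h2] at h1

theorem integral_reflect (S : ℝ) (f : ℝ → H) :
    ∫ t, f (S - t) ∂(timeMeasure S) = ∫ t, f t ∂(timeMeasure S) :=
  (measurePreserving_reflect S).integral_comp (Homeomorph.subLeft S).measurableEmbedding f

/-- The time reversal of a function on `(0, S]`. -/
def rev {F : Type*} (S : ℝ) (w : ℝ → F) (t : ℝ) : F := w (S - t)

theorem memLp_rev {w : ℝ → H} (hw : MemLp w ⊤ (timeMeasure S)) :
    MemLp (rev S w) ⊤ (timeMeasure S) :=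
  hw.comp_measurePreserving (measurePreserving_reflect S)

/-- The adjoint in `L²(0, S)` of a causal convolution is its conjugate by time reversal. -/
theorem integral_inner_cv [CompleteSpace H] {k : ℝ → ℝ} {v w : ℝ → H} (hk : Integrable k)
    (hv : Integrable v (timeMeasure S)) (hw : MemLp w ⊤ (timeMeasure S)) :
    ∫ t, inner ℝ (cv (timeMeasure S) k v t) (w t) ∂(timeMeasure S)
      = ∫ t, inner ℝ (v t) (rev S (cv (timeMeasure S) k (rev S w)) t) ∂(timeMeasure S) := by
  have hI := integrable_cv_integrand hk hv S
  have hwp : MemLp (fun p : ℝ × ℝ => w p.1) ⊤ ((timeMeasure S).prod (timeMeasure S)) := by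
    obtain ⟨M, -, hb⟩ := exists_bound_of_memLp_top hw
    refine memLp_top_of_bound hw.aestronglyMeasurable.comp_fst M ?_
    exact Measure.quasiMeasurePreserving_fst.ae hb
  have hJ := integrable_inner_of_bounded hI hwp
  have hL : ∀ᵐ t ∂(timeMeasure S), inner ℝ (cv (timeMeasure S) k v t) (w t)
      = ∫ s, inner ℝ (k (t - s) • v s) (w t) ∂(timeMeasure S) := by
    filter_upwards [hI.prod_right_ae] with t ht
    rw [cv, real_inner_comm, ← integral_inner ht]
    simp only [real_inner_comm]
  rw [integral_congr_ae hL, integral_integral_swap hJ]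
  refine integral_congr_ae (ae_of_all _ fun s => ?_)
  have h1 : rev S (cv (timeMeasure S) k (rev S w)) s
      = ∫ t, k (t - s) • w t ∂(timeMeasure S) := by
    rw [← integral_reflect]
    simp only [rev, cv]
    congr 1; ext t; congr 2; ring
  have h2 : Integrable (fun t => k (t - s) • w t) (timeMeasure S) := by
    have := hk.comp_sub_right s
    obtain ⟨M, -, hb⟩ := exists_bound_of_memLp_top hw
    exact this.restrict.smul_bdd M hw.aestronglyMeasurable hb
  dsimp only
  rw [h1, ← integral_inner h2]
  simp only [inner_smul_left, inner_smul_right]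
  rfl

end Convolution

/-! ### The operators `∂ₜ (l + ∂ₜ)⁻¹` -/

section HighPass

variable {H : Type*} [NormedAddCommGroup H] [InnerProductSpace ℝ H]
variable {S : ℝ} {m : Measure ℝ}

theorem integrable_indicator_Ioc {f : ℝ → ℝ} (hf : Continuous f) (S : ℝ) :
    Integrable ((Ioc 0 S).indicator f) :=
  (integrable_indicator_iff measurableSet_Ioc).2
    (hf.integrableOn_Icc.mono_set Ioc_subset_Icc_self)

theorem integral_indicator_mul_indicator (f g : ℝ → ℝ) {x : ℝ} (hx : x ≤ S) :
    ∫ s, (Ioc 0 S).indicator f (x - s) * (Ioc 0 S).indicator g s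
      = ∫ s in Ioc 0 x, f (x - s) * g s := by
  rw [← integral_indicator measurableSet_Ioc]
  refine integral_congr_ae ?_
  have h0 : ∀ᵐ s : ℝ, s ≠ x := by simp [ae_iff, measure_singleton]
  filter_upwards [h0] with s hs
  by_cases h1 : s ∈ Ioc 0 x
  · rw [indicator_of_mem h1, indicator_of_mem, indicator_of_mem]
    · exact ⟨h1.1, h1.2.trans hx⟩
    · exact ⟨sub_pos.2 (lt_of_le_of_ne h1.2 hs), by linarith [h1.1]⟩
  · rw [indicator_of_notMem h1]
    by_cases h2 : 0 < s
    · rw [indicator_of_notMem (a := x - s), zero_mul]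
      exact fun h => h1 ⟨h2, by linarith [h.1]⟩
    · rw [indicator_of_notMem (a := s), mul_zero]
      exact fun h => h2 h.1

/-- The kernel `exp (-l x)`, restricted to `(0, S]`. -/
def expK (S l : ℝ) : ℝ → ℝ := (Ioc 0 S).indicator fun x => Real.exp (-(l * x))

theorem integrable_expK (S l : ℝ) : Integrable (expK S l) :=
  integrable_indicator_Ioc (by fun_prop) S

theorem expK_of_notMem {l x : ℝ} (hx : x ∉ Ioc 0 S) : expK S l x = 0 := indicator_of_notMem hx _

theorem expK_of_mem {l x : ℝ} (hx : x ∈ Ioc 0 S) : expK S l x = Real.exp (-(l * x)) :=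
  indicator_of_mem hx _

theorem expK_nonneg (l x : ℝ) : 0 ≤ expK S l x := indicator_nonneg (fun _ _ => (Real.exp_pos _).le) _

theorem abs_expK_le {l : ℝ} (hl : 0 ≤ l) (x : ℝ) : |expK S l x| ≤ 1 := by
  rw [abs_of_nonneg (expK_nonneg l x)]
  by_cases hx : x ∈ Ioc 0 S
  · rw [expK_of_mem hx, Real.exp_le_one_iff]
    nlinarith [hx.1]
  · rw [expK_of_notMem hx]
    exact zero_le_one

theorem integral_expK_mul_expK (a b : ℝ) {x : ℝ} (hx : x ≤ S) :
    (a - b) * ∫ s, expK S a (x - s) * expK S b s = expK S b x - expK S a x := by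
  rw [expK, expK, integral_indicator_mul_indicator _ _ hx]
  by_cases h0 : 0 < x
  · rw [indicator_of_mem (mem_Ioc.2 ⟨h0, hx⟩), indicator_of_mem (mem_Ioc.2 ⟨h0, hx⟩),
      ← intervalIntegral.integral_of_le h0.le, ← intervalIntegral.integral_const_mul]
    have hd : ∀ s ∈ uIcc 0 x, HasDerivAt (fun s => Real.exp (-(a * (x - s)) - b * s))
        ((a - b) * (Real.exp (-(a * (x - s))) * Real.exp (-(b * s)))) s := by
      intro s _
      have h1 : HasDerivAt (fun s => -(a * (x - s)) - b * s) (a - b) s := by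
        have := ((((hasDerivAt_id s).const_sub x).const_mul a).neg).sub
          ((hasDerivAt_id s).const_mul b)
        exact this.congr_deriv (by ring)
      convert h1.exp using 1
      rw [mul_comm, ← Real.exp_add]
      ring_nf
    rw [intervalIntegral.integral_eq_sub_of_hasDerivAt hd
      (Continuous.intervalIntegrable (by fun_prop) _ _)]
    ring_nf
  · rw [indicator_of_notMem (fun h => h0 h.1), indicator_of_notMem (fun h => h0 h.1),
      Ioc_eq_empty h0]
    simp

theorem integral_expK_mul_expK_self (a : ℝ) {x : ℝ} (hx : x ≤ S) :
    ∫ s, expK S a (x - s) * expK S a s = x * expK S a x := by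
  rw [expK, integral_indicator_mul_indicator _ _ hx]
  by_cases h0 : 0 < x
  · rw [indicator_of_mem (mem_Ioc.2 ⟨h0, hx⟩)]
    have : ∀ s, Real.exp (-(a * (x - s))) * Real.exp (-(a * s)) = Real.exp (-(a * x)) := by
      intro s
      rw [← Real.exp_add]
      ring_nf
    simp [this, h0.le]
  · rw [indicator_of_notMem (fun h => h0 h.1), Ioc_eq_empty h0]
    simp

theorem cv_congr_ae {k : ℝ → ℝ} {v w : ℝ → H} (h : v =ᵐ[m] w) (t : ℝ) :
    cv m k v t = cv m k w t :=
  integral_congr_ae (h.mono fun s hs => by simp only [hs])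

/-- `∂ₜ (l + ∂ₜ)⁻¹ v = v - l y`, where `y' + l y = v` and `y 0 = 0`. -/
def highPass (S l : ℝ) (v : ℝ → H) (t : ℝ) : H := v t - l • cv (timeMeasure S) (expK S l) v t

theorem memLp_highPass {v : ℝ → H} (l : ℝ) (hv : MemLp v ⊤ (timeMeasure S)) :
    MemLp (highPass S l v) ⊤ (timeMeasure S) :=
  hv.sub ((memLp_top_cv (integrable_expK S l) hv).const_smul l)

theorem highPass_congr_ae {v w : ℝ → H} {l : ℝ} (h : v =ᵐ[timeMeasure S] w) :
    highPass S l v =ᵐ[timeMeasure S] highPass S l w :=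
  h.mono fun t ht => by simp only [highPass, ht, cv_congr_ae h]

theorem ae_timeMeasure_nonneg (S : ℝ) : ∀ᵐ τ ∂(timeMeasure S), 0 ≤ τ :=
  (ae_restrict_mem measurableSet_Ioc).mono fun _ h => h.1.le

theorem integrable_cv_slice {k : ℝ → ℝ} {h : ℝ → H} {M : ℝ} (hkm : Measurable k)
    (hM : ∀ x, |k x| ≤ M) (hh : Integrable h m) (t : ℝ) :
    Integrable (fun τ => k (t - τ) • h τ) m :=
  hh.bdd_smul M (hkm.comp (measurable_const.sub measurable_id)).aestronglyMeasurable
    (ae_of_all _ fun _ => hM _)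

theorem measurable_expK (S l : ℝ) : Measurable (expK S l) :=
  Measurable.indicator (by fun_prop) measurableSet_Ioc

theorem integrable_expK_slice {l : ℝ} {h : ℝ → H} (hl : 0 ≤ l) (hh : Integrable h m) (t : ℝ) :
    Integrable (fun τ => expK S l (t - τ) • h τ) m :=
  integrable_cv_slice (measurable_expK S l)
    (abs_expK_le hl) hh t

variable [CompleteSpace H]

/-- If `v` is the primitive of the vector measure `h dm`, then `∂ₜ (l + ∂ₜ)⁻¹ v` is the
convolution of `h dm` with the exponential kernel. -/
theorem highPass_eq_cv [SFinite m] {h v : ℝ → H} {l : ℝ} (hl : 0 ≤ l) (hh : Integrable h m)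
    (hm : ∀ᵐ τ ∂m, 0 ≤ τ) (hv : ∀ᵐ t ∂(timeMeasure S), v t = cv m (expK S 0) h t) :
    ∀ᵐ t ∂(timeMeasure S), highPass S l v t = cv m (expK S l) h t := by
  filter_upwards [hv, ae_restrict_mem measurableSet_Ioc] with t h1 ht
  have h2 := cv_cv_of_bounded (k₁₂ := fun x => ∫ s, expK S l (x - s) * expK S 0 s)
    (integrable_expK S l) (integrable_expK S 0) hh hm (fun x => expK_of_notMem)
    (fun x => expK_of_notMem) (fun x _ => rfl) (abs_expK_le hl) ht
  rw [highPass, cv_congr_ae hv, h2, h1, cv, cv, cv, ← integral_smul, ← integral_sub]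
  · refine integral_congr_ae (hm.mono fun τ hτ => ?_)
    have := integral_expK_mul_expK (S := S) l 0 (x := t - τ) (by linarith [ht.2])
    rw [sub_zero] at this
    simp only [smul_smul, this, sub_smul]
    abel
  · exact integrable_expK_slice le_rfl hh t
  · rw [← integrable_congr (f := fun τ => (expK S 0 (t - τ) - expK S l (t - τ)) • h τ)]
    · simp only [sub_smul]
      exact (integrable_expK_slice le_rfl hh t).sub (integrable_expK_slice hl hh t)
    · refine hm.mono fun τ hτ => ?_
      have := integral_expK_mul_expK (S := S) l 0 (x := t - τ) (by linarith [ht.2])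
      rw [sub_zero] at this
      simp only [smul_smul, this]

theorem highPass_highPass_eq_cv [SFinite m] {h v : ℝ → H} {l : ℝ} (hl : 0 ≤ l)
    (hh : Integrable h m) (hm : ∀ᵐ τ ∂m, 0 ≤ τ)
    (hv : ∀ᵐ t ∂(timeMeasure S), v t = cv m (expK S 0) h t) :
    ∀ᵐ t ∂(timeMeasure S), highPass S l (highPass S l v) t
      = cv m (fun x => (1 - l * x) * expK S l x) h t := by
  have h0 := highPass_eq_cv hl hh hm hv
  filter_upwards [h0, ae_restrict_mem measurableSet_Ioc] with t h1 ht
  have h2 := cv_cv_of_bounded (k₁₂ := fun x => x * expK S l x)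
    (integrable_expK S l) (integrable_expK S l) hh hm (fun x => expK_of_notMem)
    (fun x => expK_of_notMem) (fun x hx => (integral_expK_mul_expK_self l hx).symm)
    (abs_expK_le hl) ht
  rw [highPass, cv_congr_ae h0, h2, h1, cv, cv, cv, ← integral_smul, ← integral_sub]
  · congr 1; ext τ; module
  · exact integrable_expK_slice hl hh t
  · refine Integrable.smul l (integrable_cv_slice (M := S) (k := fun x => x * expK S l x) ?_ ?_ hh t)
    · exact measurable_id.mul (measurable_expK S l)
    · intro x
      by_cases hx : x ∈ Ioc 0 S
      · rw [abs_mul, abs_of_pos hx.1]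
        calc x * |expK S l x| ≤ x * 1 := by gcongr; exacts [hx.1.le, abs_expK_le hl x]
          _ ≤ S := by linarith [hx.2]
      · rw [expK_of_notMem hx, mul_zero, abs_zero]
        exact ht.1.le.trans ht.2

/-- `y = (l + ∂ₜ)⁻¹ v` is the primitive of `∂ₜ (l + ∂ₜ)⁻¹ v`. -/
theorem cv_expK_eq_cv_highPass {v : ℝ → H} {l : ℝ} (hl : 0 ≤ l)
    (hv : MemLp v ⊤ (timeMeasure S)) {t : ℝ} (ht : t ∈ Ioc 0 S) :
    cv (timeMeasure S) (expK S l) v t = cv (timeMeasure S) (expK S 0) (highPass S l v) t := by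
  have hvi := integrable_of_memLp_top hv
  have hyi := integrable_of_memLp_top (memLp_top_cv (integrable_expK S l) hv)
  have h2 := cv_cv_of_bounded (k₁₂ := fun x => ∫ s, expK S 0 (x - s) * expK S l s)
    (integrable_expK S 0) (integrable_expK S l) hvi (ae_timeMeasure_nonneg S)
    (fun x => expK_of_notMem) (fun x => expK_of_notMem) (fun x _ => rfl) (abs_expK_le le_rfl) ht
  have h3 : cv (timeMeasure S) (expK S 0) (highPass S l v) t
      = cv (timeMeasure S) (expK S 0) v t
        - l • cv (timeMeasure S) (expK S 0) (cv (timeMeasure S) (expK S l) v) t := by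
    simp only [cv, highPass, smul_sub]
    rw [integral_sub, ← integral_smul]
    · simp only [smul_comm l]
    · exact integrable_expK_slice le_rfl hvi t
    · exact integrable_expK_slice le_rfl (hyi.smul l) t
  have key : ∀ᵐ τ ∂(timeMeasure S), l • (∫ s, expK S 0 (t - τ - s) * expK S l s) • v τ
      = (expK S 0 (t - τ) - expK S l (t - τ)) • v τ := by
    refine (ae_timeMeasure_nonneg S).mono fun τ hτ => ?_
    have := integral_expK_mul_expK (S := S) 0 l (x := t - τ) (by linarith [ht.2])
    rw [smul_smul]
    congr 1
    linarith
  rw [h3, h2, cv, cv, cv, ← integral_smul, integral_congr_ae key, ← integral_sub]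
  · congr 1; ext τ; module
  · exact integrable_expK_slice le_rfl hvi t
  · simp only [sub_smul]
    exact (integrable_expK_slice le_rfl hvi t).sub (integrable_expK_slice hl hvi t)

/-- The Volterra operator is accretive: `∫ ⟨∫₀ᵗ f, f t⟩ dt = ‖∫ f‖² / 2`. -/
theorem integral_inner_primitive_nonneg {f : ℝ → H} (hf : MemLp f ⊤ (timeMeasure S)) :
    0 ≤ ∫ t, inner ℝ (cv (timeMeasure S) (expK S 0) f t) (f t) ∂(timeMeasure S) := by
  have hfi := integrable_of_memLp_top hf
  have hc := memLp_top_cv (integrable_expK S 0) hf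
  have hc' := memLp_rev (memLp_top_cv (integrable_expK S 0) (memLp_rev hf))
  have h1 := integral_inner_cv (integrable_expK S 0) hfi hf
  have h2 : ∀ᵐ t ∂(timeMeasure S), cv (timeMeasure S) (expK S 0) f t
      + rev S (cv (timeMeasure S) (expK S 0) (rev S f)) t = ∫ s, f s ∂(timeMeasure S) := by
    filter_upwards [ae_restrict_mem measurableSet_Ioc] with t ht
    have h3 : rev S (cv (timeMeasure S) (expK S 0) (rev S f)) t
        = ∫ s, expK S 0 (s - t) • f s ∂(timeMeasure S) := by
      rw [← integral_reflect]
      simp only [rev, cv]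
      congr 1; ext s; congr 2; ring
    have h4 : Integrable (fun s => expK S 0 (s - t) • f s) (timeMeasure S) :=
      hfi.bdd_smul 1 ((measurable_expK S 0).comp (measurable_id.sub measurable_const)).aestronglyMeasurable
        (ae_of_all _ fun τ => abs_expK_le le_rfl _)
    rw [h3, cv, ← integral_add (integrable_expK_slice le_rfl hfi t) h4]
    refine integral_congr_ae ?_
    have h0 : ∀ᵐ s ∂(timeMeasure S), s ≠ t :=
      ae_restrict_of_ae (by simp [ae_iff, measure_singleton])
    filter_upwards [h0, ae_restrict_mem measurableSet_Ioc] with s hs hs'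
    rcases lt_or_gt_of_ne hs with h | h
    · rw [expK_of_mem ⟨by linarith, by linarith [ht.2, hs'.1]⟩, expK_of_notMem (x := s - t)
        (fun h' => by linarith [h'.1])]
      simp
    · rw [expK_of_mem (x := s - t) ⟨by linarith, by linarith [ht.1, hs'.2]⟩, expK_of_notMem
        (fun h' => by linarith [h'.1])]
      simp
  have h5 : ∫ t, inner ℝ (cv (timeMeasure S) (expK S 0) f t) (f t) ∂(timeMeasure S)
      + ∫ t, inner ℝ (f t) (rev S (cv (timeMeasure S) (expK S 0) (rev S f)) t) ∂(timeMeasure S)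
      = inner ℝ (∫ s, f s ∂(timeMeasure S)) (∫ s, f s ∂(timeMeasure S)) := by
    rw [← integral_add]
    · rw [← integral_inner hfi]
      refine integral_congr_ae (h2.mono fun t ht => ?_)
      dsimp only
      rw [real_inner_comm, ← inner_add_right, ht, real_inner_comm]
    · simpa only [real_inner_comm] using integrable_inner_of_bounded hfi hc
    · exact integrable_inner_of_bounded hfi hc'
  have h6 := real_inner_self_nonneg (x := ∫ s, f s ∂(timeMeasure S))
  linarith

/-- The square of the norm of `L²(0, S)`. -/
def normSq (S : ℝ) (v : ℝ → H) : ℝ := ∫ t, ‖v t‖ ^ 2 ∂(timeMeasure S)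

theorem normSq_nonneg (v : ℝ → H) : 0 ≤ normSq S v := integral_nonneg fun _ => by positivity

theorem integrable_normSq {v : ℝ → H} (hv : MemLp v ⊤ (timeMeasure S)) :
    Integrable (fun t => ‖v t‖ ^ 2) (timeMeasure S) := by
  simpa only [real_inner_self_eq_norm_sq] using
    integrable_inner_of_bounded (integrable_of_memLp_top hv) hv

theorem integral_inner_highPass {v : ℝ → H} {l : ℝ} (hl : 0 ≤ l)
    (hv : MemLp v ⊤ (timeMeasure S)) :
    0 ≤ ∫ t, inner ℝ (cv (timeMeasure S) (expK S l) v t) (highPass S l v t) ∂(timeMeasure S) := by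
  refine (integral_inner_primitive_nonneg (memLp_highPass l hv)).trans_eq
    (integral_congr_ae ?_)
  filter_upwards [ae_restrict_mem measurableSet_Ioc] with t ht
  rw [cv_expK_eq_cv_highPass hl hv ht]

theorem normSq_highPass_le_inner {v : ℝ → H} {l : ℝ} (hl : 0 ≤ l)
    (hv : MemLp v ⊤ (timeMeasure S)) :
    normSq S (highPass S l v) ≤ ∫ t, inner ℝ (highPass S l v t) (v t) ∂(timeMeasure S) := by
  have hP := memLp_highPass l hv
  have hc := memLp_top_cv (integrable_expK S l) hv
  have h1 : ∫ t, inner ℝ (highPass S l v t) (v t) ∂(timeMeasure S) = normSq S (highPass S l v)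
      + l * ∫ t, inner ℝ (cv (timeMeasure S) (expK S l) v t) (highPass S l v t)
        ∂(timeMeasure S) := by
    rw [normSq, ← integral_const_mul, ← integral_add (integrable_normSq hP)
      ((integrable_inner_of_bounded (integrable_of_memLp_top hc) hP).const_mul l)]
    congr 1; ext t
    have : v t = highPass S l v t + l • cv (timeMeasure S) (expK S l) v t := by simp [highPass]
    conv_lhs => rw [this]
    rw [inner_add_right, inner_smul_right, real_inner_self_eq_norm_sq, real_inner_comm]
  nlinarith [integral_inner_highPass hl hv]

theorem normSq_highPass_add_le {v : ℝ → H} {l : ℝ} (hl : 0 ≤ l)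
    (hv : MemLp v ⊤ (timeMeasure S)) :
    normSq S (highPass S l v) + l ^ 2 * normSq S (cv (timeMeasure S) (expK S l) v)
      ≤ normSq S v := by
  have hP := memLp_highPass l hv
  have hc := memLp_top_cv (integrable_expK S l) hv
  have h1 : normSq S v = normSq S (highPass S l v)
      + 2 * l * (∫ t, inner ℝ (cv (timeMeasure S) (expK S l) v t) (highPass S l v t)
        ∂(timeMeasure S)) + l ^ 2 * normSq S (cv (timeMeasure S) (expK S l) v) := by
    have hi := (integrable_inner_of_bounded (integrable_of_memLp_top hc) hP).const_mul (2 * l)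
    rw [normSq, normSq, normSq, ← integral_const_mul, ← integral_const_mul,
      ← integral_add (integrable_normSq hP) hi,
      ← integral_add (f := fun t => ‖highPass S l v t‖ ^ 2
        + 2 * l * inner ℝ (cv (timeMeasure S) (expK S l) v t) (highPass S l v t))
        ((integrable_normSq hP).add hi) ((integrable_normSq hc).const_mul _)]
    congr 1; ext t
    have : v t = highPass S l v t + l • cv (timeMeasure S) (expK S l) v t := by simp [highPass]
    conv_lhs => rw [this]
    rw [norm_add_sq_real, inner_smul_right, norm_smul, mul_pow, Real.norm_eq_abs, sq_abs,
      real_inner_comm]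
    ring
  nlinarith [integral_inner_highPass hl hv]

theorem normSq_highPass_le {v : ℝ → H} {l : ℝ} (hl : 0 ≤ l)
    (hv : MemLp v ⊤ (timeMeasure S)) : normSq S (highPass S l v) ≤ normSq S v := by
  have := normSq_highPass_add_le hl hv
  have := mul_nonneg (sq_nonneg l) (normSq_nonneg (S := S) (cv (timeMeasure S) (expK S l) v))
  linarith

theorem sq_mul_normSq_cv_le {v : ℝ → H} {l : ℝ} (hl : 0 ≤ l)
    (hv : MemLp v ⊤ (timeMeasure S)) :
    l ^ 2 * normSq S (cv (timeMeasure S) (expK S l) v) ≤ normSq S v := by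
  have := normSq_highPass_add_le hl hv
  have := normSq_nonneg (S := S) (highPass S l v)
  linarith

end HighPass

/-! ### The fractional kernels -/

section Kernels

variable {S : ℝ}

/-- The kernel `ω_b`, restricted to `(0, S]`. -/
def omK (S b : ℝ) : ℝ → ℝ := (Ioc 0 S).indicator (omega b)

theorem omK_of_notMem {b x : ℝ} (hx : x ∉ Ioc 0 S) : omK S b x = 0 := indicator_of_notMem hx _

theorem omK_of_mem {b x : ℝ} (hx : x ∈ Ioc 0 S) : omK S b x = omega b x := indicator_of_mem hx _

theorem omega_nonneg {b x : ℝ} (hb : 0 < b) (hx : 0 ≤ x) : 0 ≤ omega b x :=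
  div_nonneg (Real.rpow_nonneg hx _) (Real.Gamma_pos_of_pos hb).le

theorem omK_nonneg {b : ℝ} (hb : 0 < b) (x : ℝ) : 0 ≤ omK S b x :=
  indicator_nonneg (fun _ hx => omega_nonneg hb hx.1.le) _

theorem integrable_omK {b : ℝ} (hb : 0 < b) (S : ℝ) : Integrable (omK S b) := by
  refine (integrable_indicator_iff measurableSet_Ioc).2 ?_
  rcases le_or_gt S 0 with h | h
  · simp [Ioc_eq_empty h.not_gt]
  · exact ((intervalIntegrable_iff_integrableOn_Ioc_of_le h.le).1
      (intervalIntegral.intervalIntegrable_rpow' (by linarith))).div_const _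

theorem integrableOn_rpow_mul_exp {a r : ℝ} (ha : 0 < a) (hr : 0 < r) :
    IntegrableOn (fun t : ℝ => t ^ (a - 1) * Real.exp (-(r * t))) (Ioi 0) := by
  by_contra h
  have h1 := Real.integral_rpow_mul_exp_neg_mul_Ioi ha hr
  rw [integral_undef h] at h1
  have : 0 < (1 / r) ^ a * Real.Gamma a :=
    mul_pos (Real.rpow_pos_of_pos (by positivity) _) (Real.Gamma_pos_of_pos ha)
  linarith

/-- The kernel `ω_(1-α)` is a superposition of exponentials. -/
theorem integral_rpow_mul_expK {α : ℝ} (hα0 : 0 < α) (hα1 : α < 1) (x : ℝ) :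
    IntegrableOn (fun l : ℝ => l ^ (α - 1) * expK S l x) (Ioi 0) ∧
    ∫ l in Ioi 0, l ^ (α - 1) * expK S l x
      = Real.Gamma α * Real.Gamma (1 - α) * omK S (1 - α) x := by
  by_cases hx : x ∈ Ioc 0 S
  · have h1 : ∀ l : ℝ, l ^ (α - 1) * expK S l x = l ^ (α - 1) * Real.exp (-(x * l)) := by
      intro l
      rw [expK_of_mem hx, mul_comm l x]
    simp only [h1]
    refine ⟨integrableOn_rpow_mul_exp hα0 hx.1, ?_⟩
    rw [Real.integral_rpow_mul_exp_neg_mul_Ioi hα0 hx.1, omK_of_mem hx, omega]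
    have h2 : Real.Gamma (1 - α) ≠ 0 := (Real.Gamma_pos_of_pos (by linarith)).ne'
    have h3 : (1 / x) ^ α = x ^ (1 - α - 1) := by
      rw [one_div, Real.inv_rpow hx.1.le, ← Real.rpow_neg hx.1.le]
      congr 1; ring
    rw [h3]
    field_simp
  · simp [expK_of_notMem hx, omK_of_notMem hx]

theorem integral_beta {α x : ℝ} (hα0 : 0 < α) (hα1 : α < 1) (hx : 0 < x) :
    ∫ s in Ioc 0 x, (x - s) ^ (α - 1) * s ^ (1 - α - 1)
      = Real.Gamma α * Real.Gamma (1 - α) := by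
  have h1 := Complex.betaIntegral_scaled (1 - α : ℝ) (α : ℝ) hx
  have h2 := Complex.Gamma_mul_Gamma_eq_betaIntegral (s := ((1 - α : ℝ) : ℂ)) (t := (α : ℂ))
    (by rw [Complex.ofReal_re]; linarith) (by rw [Complex.ofReal_re]; linarith)
  rw [← Complex.ofReal_add, sub_add_cancel, Complex.Gamma_ofReal, Complex.Gamma_ofReal,
    Complex.Gamma_ofReal, Real.Gamma_one, Complex.ofReal_one, one_mul] at h2
  rw [← h2, ← Complex.ofReal_add, sub_add_cancel, Complex.ofReal_one, sub_self,
    Complex.cpow_zero, one_mul, intervalIntegral.integral_of_le hx.le] at h1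
  have h3 : ∀ s ∈ Ioc 0 x, ((s : ℂ) ^ (((1 - α : ℝ) : ℂ) - 1) * ((x : ℂ) - s) ^ ((α : ℂ) - 1))
      = (((x - s) ^ (α - 1) * s ^ (1 - α - 1) : ℝ) : ℂ) := by
    intro s hs
    rw [Complex.ofReal_mul, Complex.ofReal_cpow (sub_nonneg.2 hs.2), Complex.ofReal_cpow hs.1.le]
    push_cast
    ring
  rw [setIntegral_congr_fun measurableSet_Ioc h3, integral_complex_ofReal, ← Complex.ofReal_mul] at h1
  rw [mul_comm (Real.Gamma α)]
  exact_mod_cast h1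

/-- `ω_α * ω_(1-α) = 1`. -/
theorem integral_omK_mul_omK {α x : ℝ} (hα0 : 0 < α) (hα1 : α < 1) (hx : x ≤ S) :
    ∫ s, omK S α (x - s) * omK S (1 - α) s = expK S 0 x := by
  rw [omK, omK, integral_indicator_mul_indicator _ _ hx]
  by_cases h0 : 0 < x
  · rw [expK_of_mem ⟨h0, hx⟩, zero_mul, neg_zero, Real.exp_zero]
    have h1 := integral_beta hα0 hα1 h0
    have h2 : Real.Gamma (1 - α) ≠ 0 := (Real.Gamma_pos_of_pos (by linarith)).ne'
    have h3 : Real.Gamma α ≠ 0 := (Real.Gamma_pos_of_pos hα0).ne'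
    simp only [omega, div_mul_div_comm, integral_div]
    rw [h1]
    field_simp
  · rw [expK_of_notMem fun h => h0 h.1, Ioc_eq_empty h0]
    simp

end Kernels

section Pairing

variable {H : Type*} [NormedAddCommGroup H] [InnerProductSpace ℝ H]
variable {S : ℝ} {m : Measure ℝ}

theorem memLp_top_comp_fst [SFinite m] {w : ℝ → H} (hw : MemLp w ⊤ (timeMeasure S)) :
    MemLp (fun p : ℝ × ℝ => w p.1) ⊤ ((timeMeasure S).prod m) := by
  obtain ⟨M, -, hb⟩ := exists_bound_of_memLp_top hw
  exact memLp_top_of_bound hw.aestronglyMeasurable.comp_fst M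
    (Measure.quasiMeasurePreserving_fst.ae hb)

theorem integrable_pairing_kernel [SFinite m] {k : ℝ → ℝ} {h w : ℝ → H} (hk : Integrable k)
    (hh : Integrable h m) (hw : MemLp w ⊤ (timeMeasure S)) :
    Integrable (fun p : ℝ × ℝ => k (p.1 - p.2) * inner ℝ (h p.2) (w p.1))
      ((timeMeasure S).prod m) := by
  simpa only [inner_smul_left, RCLike.conj_to_real] using
    integrable_inner_of_bounded (integrable_cv_integrand hk hh S) (memLp_top_comp_fst hw)

theorem integrable_pairing [IsFiniteMeasure m] {h w : ℝ → H}
    (hh : Integrable h m) (hw : MemLp w ⊤ (timeMeasure S)) :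
    Integrable (fun p : ℝ × ℝ => inner ℝ (h p.2) (w p.1)) ((timeMeasure S).prod m) :=
  integrable_inner_of_bounded (hh.comp_snd _) (memLp_top_comp_fst hw)

variable [CompleteSpace H]

theorem integral_cv_inner [SFinite m] {k : ℝ → ℝ} {h w : ℝ → H} (hk : Integrable k)
    (hh : Integrable h m) (hw : MemLp w ⊤ (timeMeasure S)) :
    ∫ t, inner ℝ (cv m k h t) (w t) ∂(timeMeasure S)
      = ∫ p : ℝ × ℝ, k (p.1 - p.2) * inner ℝ (h p.2) (w p.1) ∂((timeMeasure S).prod m) := by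
  rw [integral_prod _ (integrable_pairing_kernel hk hh hw)]
  refine integral_congr_ae ?_
  filter_upwards [(integrable_cv_integrand hk hh S).prod_right_ae] with t ht
  rw [cv, real_inner_comm, ← integral_inner ht]
  simp only [inner_smul_right, real_inner_comm]

theorem measurable_expK_uncurry (S : ℝ) : Measurable fun q : ℝ × ℝ => expK S q.1 q.2 := by
  have : (fun q : ℝ × ℝ => expK S q.1 q.2)
      = (univ ×ˢ Ioc 0 S).indicator fun q : ℝ × ℝ => Real.exp (-(q.1 * q.2)) := by
    ext q
    simp only [expK, indicator, mem_prod, mem_univ, true_and]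
  rw [this]
  exact Measurable.indicator (by fun_prop) (MeasurableSet.univ.prod measurableSet_Ioc)

/-- The form `∫ ⟨∂ₜ^α v, w⟩` is a superposition of the forms `⟨∂ₜ (l + ∂ₜ)⁻¹ v, w⟩`. -/
theorem integral_rlDeriv_inner [IsFiniteMeasure m] {α : ℝ} (hα0 : 0 < α) (hα1 : α < 1)
    {h w : ℝ → H} (hh : Integrable h m) (hw : MemLp w ⊤ (timeMeasure S)) :
    IntegrableOn (fun l : ℝ => l ^ (α - 1)
      * ∫ t, inner ℝ (cv m (expK S l) h t) (w t) ∂(timeMeasure S)) (Ioi 0) ∧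
    ∫ l in Ioi 0, l ^ (α - 1) * ∫ t, inner ℝ (cv m (expK S l) h t) (w t) ∂(timeMeasure S)
      = Real.Gamma α * Real.Gamma (1 - α)
        * ∫ t, inner ℝ (cv m (omK S (1 - α)) h t) (w t) ∂(timeMeasure S) := by
  set Z := (timeMeasure S).prod m with hZ
  set W : ℝ × ℝ → ℝ := fun p => inner ℝ (h p.2) (w p.1) with hW
  have hom := integrable_omK (S := S) (b := 1 - α) (by linarith)
  have hIW := integrable_pairing_kernel hom hh hw
  have hΦ : Integrable (fun q : ℝ × (ℝ × ℝ) => q.1 ^ (α - 1) * (expK S q.1 (q.2.1 - q.2.2) * W q.2))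
      ((volume.restrict (Ioi 0)).prod Z) := by
    rw [integrable_prod_iff']
    · refine ⟨ae_of_all _ fun p => ?_, ?_⟩
      · simpa only [mul_assoc] using
          (integral_rpow_mul_expK (S := S) hα0 hα1 (p.1 - p.2)).1.mul_const (W p)
      · refine (hIW.norm.const_mul (Real.Gamma α * Real.Gamma (1 - α))).congr
          (ae_of_all _ fun p => ?_)
        dsimp only
        have h1 : ∫ l in Ioi 0, ‖l ^ (α - 1) * (expK S l (p.1 - p.2) * W p)‖
            = ∫ l in Ioi 0, l ^ (α - 1) * expK S l (p.1 - p.2) * ‖W p‖ := by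
          refine setIntegral_congr_fun measurableSet_Ioi fun l hl => ?_
          rw [norm_mul, norm_mul, Real.norm_of_nonneg (Real.rpow_nonneg (le_of_lt hl) _),
            Real.norm_of_nonneg (expK_nonneg _ _), mul_assoc]
        rw [h1, integral_mul_const, (integral_rpow_mul_expK hα0 hα1 _).2, norm_mul,
          Real.norm_of_nonneg (omK_nonneg (by linarith) _)]
        ring
    · have h1 : Measurable fun q : ℝ × (ℝ × ℝ) => expK S q.1 (q.2.1 - q.2.2) :=
        (measurable_expK_uncurry S).comp
          (f := fun q : ℝ × (ℝ × ℝ) => (q.1, q.2.1 - q.2.2)) (by fun_prop)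
      have h2 : Measurable fun q : ℝ × (ℝ × ℝ) => q.1 ^ (α - 1) := by fun_prop
      exact h2.aestronglyMeasurable.mul (h1.aestronglyMeasurable.mul
        (integrable_pairing hh hw).aestronglyMeasurable.comp_snd)
  have hF : ∀ l : ℝ, l ^ (α - 1) * ∫ t, inner ℝ (cv m (expK S l) h t) (w t) ∂(timeMeasure S)
      = ∫ p, l ^ (α - 1) * (expK S l (p.1 - p.2) * W p) ∂Z := by
    intro l
    rw [integral_cv_inner (integrable_expK S l) hh hw, integral_const_mul]
  simp only [hF]
  refine ⟨hΦ.integral_prod_left, ?_⟩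
  rw [integral_integral_swap hΦ, integral_cv_inner hom hh hw, ← integral_const_mul]
  refine integral_congr_ae (ae_of_all _ fun p => ?_)
  dsimp only
  simp only [← mul_assoc]
  rw [integral_mul_const, (integral_rpow_mul_expK hα0 hα1 _).2]

theorem integral_one_sub_mul_exp (l x : ℝ) (hl : 0 ≤ l) :
    ∫ q in Ioc 0 l, (1 - q * x) * Real.exp (-(q * x)) = l * Real.exp (-(l * x)) := by
  rw [← intervalIntegral.integral_of_le hl]
  have hd : ∀ q ∈ uIcc 0 l, HasDerivAt (fun q => q * Real.exp (-(q * x)))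
      ((1 - q * x) * Real.exp (-(q * x))) q := by
    intro q _
    have h1 : HasDerivAt (fun q => -(q * x)) (-x) q := by
      exact ((hasDerivAt_id q).mul_const x).fun_neg.congr_deriv (by simp)
    exact ((hasDerivAt_id q).mul h1.exp).congr_deriv (by simp; ring)
  rw [intervalIntegral.integral_eq_sub_of_hasDerivAt hd
    (Continuous.intervalIntegrable (by fun_prop) _ _)]
  simp

theorem integrable_second_pairing [IsFiniteMeasure m] {h w : ℝ → H} {l : ℝ}
    (hh : Integrable h m) (hw : MemLp w ⊤ (timeMeasure S)) (hl : 0 ≤ l) :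
    Integrable (fun q : ℝ × (ℝ × ℝ) => (1 - q.1 * (q.2.1 - q.2.2)) * expK S q.1 (q.2.1 - q.2.2)
      * inner ℝ (h q.2.2) (w q.2.1)) ((volume.restrict (Ioc 0 l)).prod ((timeMeasure S).prod m)) := by
  have h1 : Measurable fun q : ℝ × (ℝ × ℝ) => expK S q.1 (q.2.1 - q.2.2) :=
    (measurable_expK_uncurry S).comp (f := fun q : ℝ × (ℝ × ℝ) => (q.1, q.2.1 - q.2.2)) (by fun_prop)
  have h2 : Measurable fun q : ℝ × (ℝ × ℝ) => 1 - q.1 * (q.2.1 - q.2.2) := by fun_prop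
  refine ((integrable_pairing hh hw).comp_snd _).bdd_mul (c := 1 + l * |S|)
    (h2.mul h1).aestronglyMeasurable ?_
  have h3 : ∀ᵐ q : ℝ × (ℝ × ℝ) ∂((volume.restrict (Ioc 0 l)).prod ((timeMeasure S).prod m)),
      q.1 ∈ Ioc 0 l :=
    Measure.quasiMeasurePreserving_fst.ae (ae_restrict_mem measurableSet_Ioc)
  filter_upwards [h3] with q hq
  by_cases hx : q.2.1 - q.2.2 ∈ Ioc 0 S
  · rw [norm_mul]
    have h4 : ‖1 - q.1 * (q.2.1 - q.2.2)‖ ≤ 1 + l * |S| := by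
      refine (norm_sub_le _ _).trans ?_
      rw [norm_one, Real.norm_of_nonneg (mul_nonneg hq.1.le hx.1.le)]
      have : q.2.1 - q.2.2 ≤ |S| := hx.2.trans (le_abs_self S)
      have := mul_le_mul hq.2 this hx.1.le hl
      linarith
    calc _ ≤ (1 + l * |S|) * 1 := mul_le_mul h4 (abs_expK_le hq.1.le _) (abs_nonneg _) (by positivity)
      _ = _ := mul_one _
  · rw [expK_of_notMem hx]
    simp only [mul_zero, norm_zero]
    positivity

theorem integrable_second_kernel (S q : ℝ) :
    Integrable fun x => (1 - q * x) * expK S q x := by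
  have h1 : (fun x => (1 - q * x) * expK S q x)
      = (Ioc 0 S).indicator fun x => (1 - q * x) * Real.exp (-(q * x)) := by
    ext x
    by_cases hx : x ∈ Ioc 0 S
    · rw [expK_of_mem hx, indicator_of_mem hx]
    · rw [expK_of_notMem hx, indicator_of_notMem hx, mul_zero]
  rw [h1]
  exact integrable_indicator_Ioc (by fun_prop) S

/-- With `F l = ⟨∂ₜ (l + ∂ₜ)⁻¹ v, w⟩` and `G l = ⟨(∂ₜ (l + ∂ₜ)⁻¹)² v, w⟩`, the derivative of `l F l`
is `G l`. -/
theorem mul_integral_cv_expK_eq [IsFiniteMeasure m] {h w : ℝ → H} {l : ℝ}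
    (hh : Integrable h m) (hw : MemLp w ⊤ (timeMeasure S)) (hl : 0 ≤ l) :
    l * ∫ t, inner ℝ (cv m (expK S l) h t) (w t) ∂(timeMeasure S)
      = ∫ q in Ioc 0 l, ∫ t, inner ℝ (cv m (fun x => (1 - q * x) * expK S q x) h t) (w t)
        ∂(timeMeasure S) := by
  have h1 : ∀ q, ∫ t, inner ℝ (cv m (fun x => (1 - q * x) * expK S q x) h t) (w t)
        ∂(timeMeasure S) = ∫ p : ℝ × ℝ, (1 - q * (p.1 - p.2)) * expK S q (p.1 - p.2)
      * inner ℝ (h p.2) (w p.1) ∂((timeMeasure S).prod m) := by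
    intro q
    exact integral_cv_inner (integrable_second_kernel S q) hh hw
  simp only [h1]
  rw [integral_integral_swap (integrable_second_pairing hh hw hl),
    integral_cv_inner (integrable_expK S l) hh hw, ← integral_const_mul]
  refine integral_congr_ae (ae_of_all _ fun p => ?_)
  dsimp only
  rw [integral_mul_const, ← mul_assoc]
  congr 1
  by_cases hx : p.1 - p.2 ∈ Ioc 0 S
  · simp only [expK_of_mem hx]
    exact (integral_one_sub_mul_exp l _ hl).symm
  · simp only [expK_of_notMem hx]
    simp

/-- The fractional integral inverts the fractional derivative, in weak form. -/
theorem integral_rlDeriv_inner_fracInt [IsFiniteMeasure m] {α : ℝ} (hα0 : 0 < α) (hα1 : α < 1)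
    {h v g : ℝ → H} (hh : Integrable h m) (hm : ∀ᵐ τ ∂m, 0 ≤ τ)
    (hv : ∀ᵐ t ∂(timeMeasure S), v t = cv m (expK S 0) h t) (hg : MemLp g ⊤ (timeMeasure S)) :
    ∫ t, inner ℝ (cv m (omK S (1 - α)) h t)
        (rev S (cv (timeMeasure S) (omK S α) (rev S g)) t) ∂(timeMeasure S)
      = ∫ t, inner ℝ (v t) (g t) ∂(timeMeasure S) := by
  have h1 := integrable_omK (S := S) (b := 1 - α) (by linarith)
  have h2 := integrable_omK (S := S) hα0
  rw [← integral_inner_cv h2 (integrable_cv h1 hh S) hg]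
  refine integral_congr_ae ?_
  have h3 := cv_cv_ae (S := S) h2 h1 hh hm (fun x => omK_of_notMem) (fun x => omK_of_notMem)
    (fun x hx => (integral_omK_mul_omK hα0 hα1 hx).symm)
  filter_upwards [h3, hv] with t h4 h5
  rw [h4, h5]

end Pairing

/-! ### The fractional seminorm and the sector condition -/

section Sector

open scoped ENNReal

variable {H : Type*} [NormedAddCommGroup H] [InnerProductSpace ℝ H] [CompleteSpace H]
variable {S : ℝ} {m : Measure ℝ}

/-- The square of a seminorm of order `α / 2` in time, defined by a quadratic estimate with the
operators `∂ₜ (l + ∂ₜ)⁻¹`. -/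
def fracSq (α S : ℝ) (v : ℝ → H) : ℝ≥0∞ :=
  ∫⁻ l in Ioi 0, ENNReal.ofReal (l ^ (α - 1) * normSq S (highPass S l v))

theorem fracSq_congr_ae {α : ℝ} {v w : ℝ → H} (h : v =ᵐ[timeMeasure S] w) :
    fracSq α S v = fracSq α S w := by
  refine lintegral_congr fun l => ?_
  have : normSq S (highPass S l v) = normSq S (highPass S l w) :=
    integral_congr_ae ((highPass_congr_ae (l := l) h).mono fun t ht => by simp only [ht])
  rw [this]

theorem aestronglyMeasurable_highPass {v : ℝ → H} (hv : AEStronglyMeasurable v (timeMeasure S)) :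
    AEStronglyMeasurable (fun p : ℝ × ℝ => highPass S p.1 v p.2)
      ((volume.restrict (Ioi 0)).prod (timeMeasure S)) := by
  have h1 : Measurable fun q : (ℝ × ℝ) × ℝ => expK S q.1.1 (q.1.2 - q.2) :=
    (measurable_expK_uncurry S).comp
      (f := fun q : (ℝ × ℝ) × ℝ => (q.1.1, q.1.2 - q.2)) (by fun_prop)
  have h2 : AEStronglyMeasurable (fun q : (ℝ × ℝ) × ℝ => expK S q.1.1 (q.1.2 - q.2) • v q.2)
      (((volume.restrict (Ioi 0)).prod (timeMeasure S)).prod (timeMeasure S)) :=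
    h1.aestronglyMeasurable.smul hv.comp_snd
  exact hv.comp_snd.sub (measurable_fst.aestronglyMeasurable.smul h2.integral_prod_right')

theorem aemeasurable_normSq_highPass {v : ℝ → H} (hv : AEStronglyMeasurable v (timeMeasure S)) :
    AEMeasurable (fun l => normSq S (highPass S l v)) (volume.restrict (Ioi 0)) :=
  (((aestronglyMeasurable_highPass hv).norm.pow 2).integral_prod_right').aemeasurable

theorem aemeasurable_fracSq_integrand (α : ℝ) {v : ℝ → H}
    (hv : AEStronglyMeasurable v (timeMeasure S)) :
    AEMeasurable (fun l => ENNReal.ofReal (l ^ (α - 1) * normSq S (highPass S l v)))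
      (volume.restrict (Ioi 0)) :=
  ((by fun_prop : Measurable fun l : ℝ => l ^ (α - 1)).aemeasurable.mul
    (aemeasurable_normSq_highPass hv)).ennreal_ofReal

theorem normSq_add_le {v w : ℝ → H} (hv : MemLp v ⊤ (timeMeasure S))
    (hw : MemLp w ⊤ (timeMeasure S)) :
    normSq S (fun t => v t + w t) ≤ 2 * normSq S v + 2 * normSq S w := by
  rw [normSq, normSq, normSq, ← integral_const_mul, ← integral_const_mul,
    ← integral_add ((integrable_normSq hv).const_mul 2) ((integrable_normSq hw).const_mul 2)]
  refine integral_mono (integrable_normSq (hv.add hw))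
    (((integrable_normSq hv).const_mul 2).add ((integrable_normSq hw).const_mul 2)) fun t => ?_
  have := norm_add_le (v t) (w t)
  have := norm_nonneg (v t + w t)
  dsimp only
  nlinarith [sq_nonneg (‖v t‖ - ‖w t‖)]

theorem abs_integral_inner_le {v w : ℝ → H} (hv : MemLp v ⊤ (timeMeasure S))
    (hw : MemLp w ⊤ (timeMeasure S)) :
    |∫ t, inner ℝ (v t) (w t) ∂(timeMeasure S)| ≤ √(normSq S v) * √(normSq S w) := by
  have h1 := integrable_inner_of_bounded (integrable_of_memLp_top hv) hw
  have h2 : ∀ x : ℝ, 0 ≤ normSq S w * (x * x)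
      + (2 * ∫ t, inner ℝ (v t) (w t) ∂(timeMeasure S)) * x + normSq S v := by
    intro x
    have : normSq S (fun t => v t + x • w t) = normSq S w * (x * x)
      + (2 * ∫ t, inner ℝ (v t) (w t) ∂(timeMeasure S)) * x + normSq S v := by
      rw [normSq, normSq, normSq, ← integral_const_mul, ← integral_mul_const, ← integral_mul_const,
        ← integral_add ((integrable_normSq hw).mul_const _) ((h1.const_mul 2).mul_const x),
        ← integral_add (f := fun t => ‖w t‖ ^ 2 * (x * x) + 2 * inner ℝ (v t) (w t) * x)
          (((integrable_normSq hw).mul_const _).add ((h1.const_mul 2).mul_const x))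
          (integrable_normSq hv)]
      congr 1; ext t
      rw [norm_add_sq_real, inner_smul_right, norm_smul, mul_pow, Real.norm_eq_abs, sq_abs]
      ring
    exact this ▸ normSq_nonneg _
  have h3 := discrim_le_zero h2
  rw [discrim] at h3
  rw [← Real.sqrt_mul (normSq_nonneg v)]
  exact Real.abs_le_sqrt (by nlinarith)

theorem normSq_rev (v : ℝ → H) : normSq S (rev S v) = normSq S v :=
  integral_reflect S fun t => ‖v t‖ ^ 2

theorem highPass_add {v w : ℝ → H} {l : ℝ} (hl : 0 ≤ l) (hv : MemLp v ⊤ (timeMeasure S))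
    (hw : MemLp w ⊤ (timeMeasure S)) (t : ℝ) :
    highPass S l (fun t => v t + w t) t = highPass S l v t + highPass S l w t := by
  simp only [highPass, cv, smul_add]
  rw [integral_add (integrable_expK_slice hl (integrable_of_memLp_top hv) t)
    (integrable_expK_slice hl (integrable_of_memLp_top hw) t), smul_add]
  abel

theorem fracSq_add_le {α : ℝ} {v w : ℝ → H} (hv : MemLp v ⊤ (timeMeasure S))
    (hw : MemLp w ⊤ (timeMeasure S)) :
    fracSq α S (fun t => v t + w t) ≤ 2 * fracSq α S v + 2 * fracSq α S w := by
  have h1 := aemeasurable_fracSq_integrand α hv.1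
  rw [fracSq, fracSq, fracSq, ← lintegral_const_mul'' _ h1,
    ← lintegral_const_mul'' _ (aemeasurable_fracSq_integrand α hw.1),
    ← lintegral_add_left' (h1.const_mul 2)]
  refine setLIntegral_mono_ae' measurableSet_Ioi (ae_of_all _ fun l hl => ?_)
  have hl' : 0 ≤ l := le_of_lt hl
  have h2 : normSq S (highPass S l fun t => v t + w t)
      ≤ 2 * normSq S (highPass S l v) + 2 * normSq S (highPass S l w) := by
    refine (le_of_eq ?_).trans (normSq_add_le (memLp_highPass l hv) (memLp_highPass l hw))
    simp only [normSq, highPass_add hl' hv hw]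
  have h3 : (2 : ℝ≥0∞) = ENNReal.ofReal 2 := by simp
  have hp := Real.rpow_nonneg hl' (α - 1)
  have h4 := normSq_nonneg (S := S) (highPass S l v)
  have h5 := normSq_nonneg (S := S) (highPass S l w)
  rw [h3, ← ENNReal.ofReal_mul zero_le_two, ← ENNReal.ofReal_mul zero_le_two,
    ← ENNReal.ofReal_add (by positivity) (by positivity)]
  refine ENNReal.ofReal_le_ofReal ?_
  nlinarith [mul_le_mul_of_nonneg_left h2 hp]

theorem fracSq_neg {α : ℝ} {v : ℝ → H} : fracSq α S (fun t => - v t) = fracSq α S v := by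
  have : ∀ l t, highPass S l (fun t => - v t) t = - highPass S l v t := by
    intro l t
    simp only [highPass, cv, smul_neg, integral_neg]
    abel
  simp only [fracSq, normSq, this, norm_neg]

theorem integral_highPass_inner {v w : ℝ → H} (l : ℝ) (hv : MemLp v ⊤ (timeMeasure S))
    (hw : MemLp w ⊤ (timeMeasure S)) :
    ∫ t, inner ℝ (highPass S l v t) (w t) ∂(timeMeasure S)
      = ∫ t, inner ℝ (v t) (rev S (highPass S l (rev S w)) t) ∂(timeMeasure S) := by
  have hvi := integrable_of_memLp_top hv
  have h1 := integral_inner_cv (integrable_expK S l) hvi hw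
  have hc := integrable_cv (integrable_expK S l) hvi S
  have hc' := memLp_rev (memLp_top_cv (integrable_expK S l) (memLp_rev hw))
  have e1 : ∫ t, inner ℝ (highPass S l v t) (w t) ∂(timeMeasure S)
      = ∫ t, inner ℝ (v t) (w t) ∂(timeMeasure S)
        - l * ∫ t, inner ℝ (cv (timeMeasure S) (expK S l) v t) (w t) ∂(timeMeasure S) := by
    rw [← integral_const_mul, ← integral_sub (integrable_inner_of_bounded hvi hw)
      ((integrable_inner_of_bounded hc hw).const_mul l)]
    simp only [highPass, inner_sub_left, inner_smul_left, RCLike.conj_to_real]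
  have e2 : ∫ t, inner ℝ (v t) (rev S (highPass S l (rev S w)) t) ∂(timeMeasure S)
      = ∫ t, inner ℝ (v t) (w t) ∂(timeMeasure S)
        - l * ∫ t, inner ℝ (v t) (rev S (cv (timeMeasure S) (expK S l) (rev S w)) t)
          ∂(timeMeasure S) := by
    rw [← integral_const_mul, ← integral_sub (integrable_inner_of_bounded hvi hw)
      ((integrable_inner_of_bounded hvi hc').const_mul l)]
    simp only [highPass, rev, inner_sub_right, inner_smul_right, sub_sub_cancel]
  rw [e1, e2, h1]

theorem memLp_of_ae_eq_cv [IsFiniteMeasure m] {h v : ℝ → H} (hh : Integrable h m)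
    (hv : ∀ᵐ t ∂(timeMeasure S), v t = cv m (expK S 0) h t) : MemLp v ⊤ (timeMeasure S) := by
  refine memLp_top_of_bound
    ((integrable_cv (integrable_expK S 0) hh S).aestronglyMeasurable.congr
      (hv.mono fun t ht => ht.symm)) (∫ τ, ‖h τ‖ ∂m) (hv.mono fun t ht => ?_)
  rw [ht, cv]
  refine norm_integral_le_of_norm_le hh.norm (ae_of_all _ fun τ => ?_)
  rw [norm_smul]
  exact mul_le_of_le_one_left (norm_nonneg _) (abs_expK_le le_rfl _)

variable [IsFiniteMeasure m] {α : ℝ} {h v w : ℝ → H}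

theorem integral_cv_expK_inner (hh : Integrable h m) (hm : ∀ᵐ τ ∂m, 0 ≤ τ)
    (hv : ∀ᵐ t ∂(timeMeasure S), v t = cv m (expK S 0) h t) {l : ℝ} (hl : 0 ≤ l) :
    ∫ t, inner ℝ (cv m (expK S l) h t) (w t) ∂(timeMeasure S)
      = ∫ t, inner ℝ (highPass S l v t) (w t) ∂(timeMeasure S) :=
  integral_congr_ae ((highPass_eq_cv hl hh hm hv).mono fun t ht => by simp only [ht])

/-- Coercivity: the form `γ ∫ ⟨∂ₜ^α v, v⟩`, with `γ = Γ(α) Γ(1-α)`, bounds a superposition with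
weight `l^(α-1)` of any lower bounds for `⟨∂ₜ (l + ∂ₜ)⁻¹ v, v⟩`. -/
theorem lintegral_le_ofReal_integral_rlDeriv (hα0 : 0 < α) (hα1 : α < 1) (hh : Integrable h m)
    (hm : ∀ᵐ τ ∂m, 0 ≤ τ) (hv : ∀ᵐ t ∂(timeMeasure S), v t = cv m (expK S 0) h t)
    {N : ℝ → ℝ} (hN0 : ∀ l, 0 ≤ N l)
    (hN : ∀ l, 0 ≤ l → N l ≤ ∫ t, inner ℝ (highPass S l v t) (v t) ∂(timeMeasure S)) :
    ∫⁻ l in Ioi 0, ENNReal.ofReal (l ^ (α - 1) * N l) ≤ ENNReal.ofReal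
      (Real.Gamma α * Real.Gamma (1 - α)
        * ∫ t, inner ℝ (cv m (omK S (1 - α)) h t) (v t) ∂(timeMeasure S)) := by
  obtain ⟨h1, h2⟩ := integral_rlDeriv_inner hα0 hα1 hh (memLp_of_ae_eq_cv hh hv)
  have h3 : ∀ l ∈ Ioi (0 : ℝ), l ^ (α - 1) * N l
      ≤ l ^ (α - 1) * ∫ t, inner ℝ (cv m (expK S l) h t) (v t) ∂(timeMeasure S) := by
    intro l hl
    rw [integral_cv_expK_inner hh hm hv (le_of_lt hl)]
    exact mul_le_mul_of_nonneg_left (hN l (le_of_lt hl)) (Real.rpow_nonneg (le_of_lt hl) _)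
  rw [← h2, ofReal_integral_eq_lintegral_ofReal h1]
  · exact setLIntegral_mono_ae' measurableSet_Ioi
      (ae_of_all _ fun l hl => ENNReal.ofReal_le_ofReal (h3 l hl))
  · refine (ae_restrict_mem measurableSet_Ioi).mono fun l hl => ?_
    exact (mul_nonneg (Real.rpow_nonneg (le_of_lt hl) _) (hN0 l)).trans (h3 l hl)

theorem fracSq_le_integral_rlDeriv (hα0 : 0 < α) (hα1 : α < 1) (hh : Integrable h m)
    (hm : ∀ᵐ τ ∂m, 0 ≤ τ) (hv : ∀ᵐ t ∂(timeMeasure S), v t = cv m (expK S 0) h t) :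
    fracSq α S v ≤ ENNReal.ofReal (Real.Gamma α * Real.Gamma (1 - α)
        * ∫ t, inner ℝ (cv m (omK S (1 - α)) h t) (v t) ∂(timeMeasure S)) :=
  lintegral_le_ofReal_integral_rlDeriv hα0 hα1 hh hm hv (fun _ => normSq_nonneg _)
    fun _ hl => normSq_highPass_le_inner hl (memLp_of_ae_eq_cv hh hv)

theorem fracSq_rev_le_integral_rlDeriv (hα0 : 0 < α) (hα1 : α < 1) (hh : Integrable h m)
    (hm : ∀ᵐ τ ∂m, 0 ≤ τ) (hv : ∀ᵐ t ∂(timeMeasure S), v t = cv m (expK S 0) h t) :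
    fracSq α S (rev S v) ≤ ENNReal.ofReal (Real.Gamma α * Real.Gamma (1 - α)
        * ∫ t, inner ℝ (cv m (omK S (1 - α)) h t) (v t) ∂(timeMeasure S)) := by
  have hv' := memLp_of_ae_eq_cv hh hv
  refine lintegral_le_ofReal_integral_rlDeriv hα0 hα1 hh hm hv (fun _ => normSq_nonneg _)
    fun l hl => (normSq_highPass_le_inner hl (memLp_rev hv')).trans_eq ?_
  rw [integral_highPass_inner l hv' hv', ← integral_reflect]
  simp only [rev, sub_sub_cancel, real_inner_comm]

theorem integral_rlDeriv_nonneg (hα0 : 0 < α) (hα1 : α < 1) (hh : Integrable h m)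
    (hm : ∀ᵐ τ ∂m, 0 ≤ τ) (hv : ∀ᵐ t ∂(timeMeasure S), v t = cv m (expK S 0) h t) :
    0 ≤ ∫ t, inner ℝ (cv m (omK S (1 - α)) h t) (v t) ∂(timeMeasure S) := by
  have h1 := (integral_rlDeriv_inner hα0 hα1 hh (memLp_of_ae_eq_cv hh hv)).2
  have h2 : 0 ≤ Real.Gamma α * Real.Gamma (1 - α)
        * ∫ t, inner ℝ (cv m (omK S (1 - α)) h t) (v t) ∂(timeMeasure S) := by
    rw [← h1]
    refine setIntegral_nonneg measurableSet_Ioi fun l hl => ?_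
    rw [integral_cv_expK_inner hh hm hv (le_of_lt hl)]
    exact mul_nonneg (Real.rpow_nonneg (le_of_lt hl) _) ((normSq_nonneg _).trans
      (normSq_highPass_le_inner (le_of_lt hl) (memLp_of_ae_eq_cv hh hv)))
  exact nonneg_of_mul_nonneg_right h2
    (mul_pos (Real.Gamma_pos_of_pos hα0) (Real.Gamma_pos_of_pos (by linarith)))

theorem lintegral_Ioi_rpow_sub_two (hα1 : α < 1) {q : ℝ} (hq : 0 < q) :
    ∫⁻ l in Ioi q, ENNReal.ofReal (l ^ (α - 2)) = ENNReal.ofReal (q ^ (α - 1) / (1 - α)) := by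
  rw [← ofReal_integral_eq_lintegral_ofReal (integrableOn_Ioi_rpow_of_lt (by linarith) hq),
    integral_Ioi_rpow_of_lt (by linarith) hq]
  · have : α - 2 + 1 = α - 1 := by ring
    rw [this, neg_div, ← div_neg, neg_sub]
  · exact (ae_restrict_mem measurableSet_Ioi).mono fun l hl =>
      Real.rpow_nonneg (hq.le.trans (le_of_lt hl)) _

end Sector

section SectorBound

open scoped ENNReal

variable {H : Type*} [NormedAddCommGroup H] [InnerProductSpace ℝ H] [CompleteSpace H]
variable {S : ℝ} {m : Measure ℝ} [IsFiniteMeasure m] {α : ℝ} {h v w : ℝ → H}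

/-- Hardy's inequality with weight `l^(α-1)`, in the form used for `l F(l) = ∫₀ˡ G`. -/
theorem lintegral_hardy (hα1 : α < 1) {B : ℝ → ℝ≥0∞} (hB : AEMeasurable B (volume.restrict (Ioi 0))) :
    ∫⁻ l in Ioi 0, ENNReal.ofReal (l ^ (α - 2)) * ∫⁻ q in Ioc 0 l, B q
      ≤ ENNReal.ofReal (1 - α)⁻¹ * ∫⁻ q in Ioi 0, ENNReal.ofReal (q ^ (α - 1)) * B q := by
  set K : ℝ → ℝ → ℝ≥0∞ := fun l q => ({p : ℝ × ℝ | p.2 ≤ p.1}).indicator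
    (fun p => ENNReal.ofReal (p.1 ^ (α - 2)) * B p.2) (l, q) with hK
  have hKm : AEMeasurable (Function.uncurry K)
      ((volume.restrict (Ioi 0)).prod (volume.restrict (Ioi 0))) := by
    have h1 : Measurable fun p : ℝ × ℝ => ENNReal.ofReal (p.1 ^ (α - 2)) := by fun_prop
    exact (h1.aemeasurable.mul hB.comp_snd).indicator (measurableSet_le measurable_snd measurable_fst)
  have e1 : ∫⁻ l in Ioi 0, ENNReal.ofReal (l ^ (α - 2)) * ∫⁻ q in Ioc 0 l, B q
      ≤ ∫⁻ l in Ioi 0, ∫⁻ q in Ioi 0, K l q := by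
    refine setLIntegral_mono_ae' measurableSet_Ioi (ae_of_all _ fun l _ => ?_)
    rw [← lintegral_const_mul' _ _ ENNReal.ofReal_ne_top]
    have : Ioc 0 l = Iic l ∩ Ioi 0 := by ext x; simp [and_comm]
    rw [this, ← Measure.restrict_restrict measurableSet_Iic, ← lintegral_indicator measurableSet_Iic]
    exact le_of_eq rfl
  refine e1.trans ?_
  rw [lintegral_lintegral_swap hKm, ← lintegral_const_mul' _ _ ENNReal.ofReal_ne_top]
  refine setLIntegral_mono_ae' measurableSet_Ioi (ae_of_all _ fun q hq => ?_)
  have e2 : ∫⁻ l in Ioi 0, K l q = (∫⁻ l in Ioi q, ENNReal.ofReal (l ^ (α - 2))) * B q := by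
    rw [← lintegral_mul_const _ (by fun_prop)]
    have : Ici q = Ici q ∩ Ioi 0 := by
      ext x; simp only [mem_Ici, mem_inter_iff, mem_Ioi]
      exact ⟨fun hx => ⟨hx, lt_of_lt_of_le hq hx⟩, fun hx => hx.1⟩
    rw [← Measure.restrict_congr_set (Ioi_ae_eq_Ici (a := q)).symm, this,
      ← Measure.restrict_restrict measurableSet_Ici, ← lintegral_indicator measurableSet_Ici]
    rfl
  rw [e2, lintegral_Ioi_rpow_sub_two hα1 hq, div_eq_mul_inv, mul_comm (q ^ (α - 1)),
    ENNReal.ofReal_mul (inv_nonneg.2 (by linarith)), mul_assoc]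

/-- The sector condition: the form `⟨∂ₜ^α v, w⟩` is bounded in the fractional seminorms. -/
theorem enorm_integral_rlDeriv_inner_le (hα0 : 0 < α) (hα1 : α < 1) (hh : Integrable h m)
    (hm : ∀ᵐ τ ∂m, 0 ≤ τ) (hv : ∀ᵐ t ∂(timeMeasure S), v t = cv m (expK S 0) h t)
    (hw : MemLp w ⊤ (timeMeasure S)) :
    ‖Real.Gamma α * Real.Gamma (1 - α)
        * ∫ t, inner ℝ (cv m (omK S (1 - α)) h t) (w t) ∂(timeMeasure S)‖ₑ
      ≤ ENNReal.ofReal (1 - α)⁻¹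
        * (fracSq α S v ^ (1 / 2 : ℝ) * fracSq α S (rev S w) ^ (1 / 2 : ℝ)) := by
  have hv' := memLp_of_ae_eq_cv hh hv
  have hw' := memLp_rev hw
  set a : ℝ → ℝ := fun q => normSq S (highPass S q v) with ha
  set b : ℝ → ℝ := fun q => normSq S (highPass S q (rev S w)) with hb
  have ham : AEMeasurable a (volume.restrict (Ioi 0)) := aemeasurable_normSq_highPass hv'.1
  have hbm : AEMeasurable b (volume.restrict (Ioi 0)) := aemeasurable_normSq_highPass hw'.1
  have ha0 : ∀ q, 0 ≤ a q := fun q => normSq_nonneg _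
  have hb0 : ∀ q, 0 ≤ b q := fun q => normSq_nonneg _
  set F : ℝ → ℝ := fun l => ∫ t, inner ℝ (cv m (expK S l) h t) (w t) ∂(timeMeasure S) with hF
  set G : ℝ → ℝ := fun q => ∫ t, inner ℝ (cv m (fun x => (1 - q * x) * expK S q x) h t) (w t)
    ∂(timeMeasure S) with hG
  have hGb : ∀ q, 0 ≤ q → ‖G q‖ₑ ≤ ENNReal.ofReal (√(a q) * √(b q)) := by
    intro q hq
    have e1 : G q = ∫ t, inner ℝ (highPass S q v t) (rev S (highPass S q (rev S w)) t)
        ∂(timeMeasure S) := by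
      rw [← integral_highPass_inner q (memLp_highPass q hv') hw]
      exact integral_congr_ae ((highPass_highPass_eq_cv hq hh hm hv).mono fun t ht => by
        simp only [ht])
    rw [e1, Real.enorm_eq_ofReal_abs]
    refine ENNReal.ofReal_le_ofReal ((abs_integral_inner_le (memLp_highPass q hv')
      (memLp_rev (memLp_highPass q hw'))).trans_eq ?_)
    rw [normSq_rev]
  obtain ⟨-, h2⟩ := integral_rlDeriv_inner hα0 hα1 hh hw
  rw [← h2]
  refine (enorm_integral_le_lintegral_enorm _).trans ?_
  have e1 : ∫⁻ l in Ioi 0, ‖l ^ (α - 1) * F l‖ₑ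
      ≤ ∫⁻ l in Ioi 0, ENNReal.ofReal (l ^ (α - 2))
        * ∫⁻ q in Ioc 0 l, ENNReal.ofReal (√(a q) * √(b q)) := by
    refine setLIntegral_mono_ae' measurableSet_Ioi (ae_of_all _ fun l hl => ?_)
    have hl' : 0 < l := hl
    have e2 : l ^ (α - 1) * F l = l ^ (α - 2) * (l * F l) := by
      rw [← mul_assoc, ← Real.rpow_add_one hl'.ne']
      congr 2; ring
    rw [e2, mul_integral_cv_expK_eq hh hw hl'.le, enorm_mul,
      Real.enorm_of_nonneg (Real.rpow_nonneg hl'.le _)]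
    refine mul_le_mul_right ((enorm_integral_le_lintegral_enorm _).trans ?_) _
    exact setLIntegral_mono_ae' measurableSet_Ioc (ae_of_all _ fun q hq => hGb q hq.1.le)
  refine e1.trans ((lintegral_hardy hα1 (ham.sqrt.mul hbm.sqrt).ennreal_ofReal).trans ?_)
  refine mul_le_mul_right ?_ _
  have hrp : AEMeasurable (fun q : ℝ => q ^ (α - 1)) (volume.restrict (Ioi 0)) :=
    (by fun_prop : Measurable fun l : ℝ => l ^ (α - 1)).aemeasurable
  have e3 := ENNReal.lintegral_mul_le_Lp_mul_Lq (volume.restrict (Ioi 0))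
    Real.HolderConjugate.two_two (f := fun q => ENNReal.ofReal √(q ^ (α - 1) * a q))
    (g := fun q => ENNReal.ofReal √(q ^ (α - 1) * b q))
    (hrp.mul ham).sqrt.ennreal_ofReal (hrp.mul hbm).sqrt.ennreal_ofReal
  have e4 : ∀ c : ℝ → ℝ, (∀ q, 0 ≤ c q) →
      ∫⁻ q in Ioi 0, ENNReal.ofReal √(q ^ (α - 1) * c q) ^ (2 : ℝ)
        = ∫⁻ q in Ioi 0, ENNReal.ofReal (q ^ (α - 1) * c q) := by
    intro c hc
    refine setLIntegral_congr_fun measurableSet_Ioi fun q hq => ?_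
    have : 0 ≤ q ^ (α - 1) * c q := mul_nonneg (Real.rpow_nonneg (le_of_lt hq) _) (hc q)
    rw [ENNReal.ofReal_rpow_of_nonneg (Real.sqrt_nonneg _) zero_le_two, Real.rpow_two,
      Real.sq_sqrt this]
  rw [e4 a ha0, e4 b hb0] at e3
  refine (le_of_eq ?_).trans e3
  refine setLIntegral_congr_fun measurableSet_Ioi fun q hq => ?_
  have hp : 0 ≤ q ^ (α - 1) := Real.rpow_nonneg (le_of_lt hq) _
  simp only [Pi.mul_apply]
  rw [← ENNReal.ofReal_mul hp, ← ENNReal.ofReal_mul (Real.sqrt_nonneg _), Real.sqrt_mul hp,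
    Real.sqrt_mul hp]
  congr 1
  linear_combination (-(√(a q) * √(b q))) * Real.mul_self_sqrt hp

/-- The sector condition, with real bounds for the seminorms. -/
theorem abs_integral_rlDeriv_inner_le (hα0 : 0 < α) (hα1 : α < 1) (hh : Integrable h m)
    (hm : ∀ᵐ τ ∂m, 0 ≤ τ) (hv : ∀ᵐ t ∂(timeMeasure S), v t = cv m (expK S 0) h t)
    (hw : MemLp w ⊤ (timeMeasure S)) {A B : ℝ} (hA0 : 0 ≤ A) (hB0 : 0 ≤ B)
    (hA : fracSq α S v ≤ ENNReal.ofReal A) (hB : fracSq α S (rev S w) ≤ ENNReal.ofReal B) :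
    Real.Gamma α * Real.Gamma (1 - α)
        * |∫ t, inner ℝ (cv m (omK S (1 - α)) h t) (w t) ∂(timeMeasure S)|
      ≤ (1 - α)⁻¹ * (√A * √B) := by
  have h1 := enorm_integral_rlDeriv_inner_le hα0 hα1 hh hm hv hw
  have h2 : ENNReal.ofReal (1 - α)⁻¹
        * (fracSq α S v ^ (1 / 2 : ℝ) * fracSq α S (rev S w) ^ (1 / 2 : ℝ))
      ≤ ENNReal.ofReal ((1 - α)⁻¹ * (√A * √B)) := by
    rw [ENNReal.ofReal_mul (inv_nonneg.2 (by linarith)), ENNReal.ofReal_mul (Real.sqrt_nonneg _),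
      Real.sqrt_eq_rpow, Real.sqrt_eq_rpow, ← ENNReal.ofReal_rpow_of_nonneg hA0 (by norm_num),
      ← ENNReal.ofReal_rpow_of_nonneg hB0 (by norm_num)]
    gcongr
  have h3 := h1.trans h2
  rw [Real.enorm_eq_ofReal_abs, abs_mul, abs_of_pos
    (mul_pos (Real.Gamma_pos_of_pos hα0) (Real.Gamma_pos_of_pos (by linarith)))] at h3
  refine (ENNReal.ofReal_le_ofReal_iff ?_).1 h3
  have : 0 ≤ (1 - α)⁻¹ := inv_nonneg.2 (by linarith)
  positivity

end SectorBound

/-! ### A Slobodeckij bound for the fractional seminorm -/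

section Slobodeckij

open scoped ENNReal

variable {H : Type*} [NormedAddCommGroup H] [InnerProductSpace ℝ H] [CompleteSpace H]
variable {S : ℝ} {α : ℝ} {v : ℝ → H}

theorem sq_add_integral_le {X : Type*} [MeasurableSpace X] {μ : Measure X} {k f : X → ℝ} {c a : ℝ}
    (hk : ∀ x, 0 ≤ k x) (hc : 0 ≤ c) (hki : Integrable k μ)
    (hkf : Integrable (fun x => k x * f x) μ) (hkf2 : Integrable (fun x => k x * f x ^ 2) μ)
    (h1 : c + ∫ x, k x ∂μ = 1) :
    (c * a + ∫ x, k x * f x ∂μ) ^ 2 ≤ c * a ^ 2 + ∫ x, k x * f x ^ 2 ∂μ := by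
  set X := c * a + ∫ x, k x * f x ∂μ with hX
  have h2 : 0 ≤ ∫ x, k x * (f x - X) ^ 2 ∂μ :=
    integral_nonneg fun x => mul_nonneg (hk x) (sq_nonneg _)
  have h3 : ∫ x, k x * (f x - X) ^ 2 ∂μ
      = ∫ x, k x * f x ^ 2 ∂μ - (2 * X) * ∫ x, k x * f x ∂μ + X ^ 2 * ∫ x, k x ∂μ := by
    rw [← integral_const_mul, ← integral_const_mul, ← integral_sub hkf2 (hkf.const_mul _),
      ← integral_add (f := fun x => k x * f x ^ 2 - 2 * X * (k x * f x))
        (hkf2.sub (hkf.const_mul _)) (hki.const_mul _)]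
    congr 1; ext x; ring
  have h4 : ∫ x, k x * f x ∂μ = X - c * a := by rw [hX]; ring
  have h5 : ∫ x, k x ∂μ = 1 - c := by linarith
  rw [h3, h4, h5] at h2
  nlinarith [mul_nonneg hc (sq_nonneg (a - X))]

theorem mul_integral_expK {l t : ℝ} (ht : t ∈ Ioc 0 S) :
    l * ∫ s, expK S l (t - s) ∂(timeMeasure S) = 1 - Real.exp (-(l * t)) := by
  have h1 := integral_expK_mul_expK (S := S) l 0 ht.2
  rw [sub_zero, expK_of_mem ht, expK_of_mem ht, zero_mul, neg_zero, Real.exp_zero] at h1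
  rw [← h1, ← integral_indicator measurableSet_Ioc]
  congr 2; ext s
  by_cases hs : s ∈ Ioc 0 S
  · rw [indicator_of_mem hs, expK_of_mem (l := 0) hs]
    simp
  · rw [indicator_of_notMem hs, expK_of_notMem (l := 0) hs, mul_zero]

/-- Jensen's inequality for `∂ₜ (l + ∂ₜ)⁻¹ v`, which is an average of `v t` and of the differences
`v t - v s`. -/
theorem norm_highPass_sq_le {l t : ℝ} (hl : 0 < l) (hv : MemLp v ⊤ (timeMeasure S))
    (ht : t ∈ Ioc 0 S) :
    Integrable (fun s => l * expK S l (t - s) * ‖v t - v s‖ ^ 2) (timeMeasure S) ∧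
    ‖highPass S l v t‖ ^ 2 ≤ Real.exp (-(l * t)) * ‖v t‖ ^ 2
      + ∫ s, l * expK S l (t - s) * ‖v t - v s‖ ^ 2 ∂(timeMeasure S) := by
  obtain ⟨M, hM, hb⟩ := exists_bound_of_memLp_top hv
  have hk0 : ∀ s, 0 ≤ l * expK S l (t - s) := fun s => mul_nonneg hl.le (expK_nonneg _ _)
  have hki : Integrable (fun s => l * expK S l (t - s)) (timeMeasure S) :=
    (integrable_comp_sub (integrable_expK S l) t S).const_mul l
  have hd : AEStronglyMeasurable (fun s => v t - v s) (timeMeasure S) :=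
    aestronglyMeasurable_const.sub hv.1
  have hdb : ∀ᵐ s ∂(timeMeasure S), ‖v t - v s‖ ≤ ‖v t‖ + M := hb.mono fun s hs =>
    (norm_sub_le _ _).trans (by linarith)
  have hf1 : Integrable (fun s => l * expK S l (t - s) * ‖v t - v s‖) (timeMeasure S) :=
    hki.mul_bdd (c := ‖v t‖ + M) hd.norm (hdb.mono fun s hs => by simpa using hs)
  have hf2 : Integrable (fun s => l * expK S l (t - s) * ‖v t - v s‖ ^ 2) (timeMeasure S) :=
    hki.mul_bdd (c := (‖v t‖ + M) ^ 2) (hd.norm.pow 2) (hdb.mono fun s hs => by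
      rw [norm_pow, norm_norm]; gcongr)
  have h1 : Real.exp (-(l * t)) + ∫ s, l * expK S l (t - s) ∂(timeMeasure S) = 1 := by
    rw [integral_const_mul, mul_integral_expK ht]; ring
  have h2 : highPass S l v t = Real.exp (-(l * t)) • v t
      + ∫ s, (l * expK S l (t - s)) • (v t - v s) ∂(timeMeasure S) := by
    have e1 := integrable_expK_slice (S := S) hl.le (integrable_of_memLp_top hv) t
    have e2 : ∫ s, (l * expK S l (t - s)) • (v t - v s) ∂(timeMeasure S)
        = (1 - Real.exp (-(l * t))) • v t - l • cv (timeMeasure S) (expK S l) v t := by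
      rw [← h1, add_sub_cancel_left, ← integral_smul_const, cv, ← integral_smul,
        ← integral_sub (g := fun τ => l • expK S l (t - τ) • v τ) (hki.smul_const _) (e1.smul l)]
      congr 1; ext s; module
    rw [e2, highPass]; module
  refine ⟨hf2, le_trans ?_ (sq_add_integral_le hk0 (Real.exp_pos _).le hki hf1 hf2 h1)⟩
  have h3 : ‖highPass S l v t‖ ≤ Real.exp (-(l * t)) * ‖v t‖
      + ∫ s, l * expK S l (t - s) * ‖v t - v s‖ ∂(timeMeasure S) := by
    rw [h2]
    refine (norm_add_le _ _).trans (add_le_add ?_ ?_)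
    · rw [norm_smul, Real.norm_of_nonneg (Real.exp_pos _).le]
    · refine norm_integral_le_of_norm_le hf1 (ae_of_all _ fun s => ?_)
      rw [norm_smul, Real.norm_of_nonneg (hk0 s)]
  gcongr

theorem lintegral_rpow_mul_exp {a r : ℝ} (ha : 0 < a) (hr : 0 < r) :
    ∫⁻ l in Ioi 0, ENNReal.ofReal (l ^ (a - 1) * Real.exp (-(r * l)))
      = ENNReal.ofReal (Real.Gamma a * r ^ (-a)) := by
  rw [← ofReal_integral_eq_lintegral_ofReal (integrableOn_rpow_mul_exp ha hr),
    Real.integral_rpow_mul_exp_neg_mul_Ioi ha hr, one_div, Real.inv_rpow hr.le,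
    ← Real.rpow_neg hr.le, mul_comm]
  exact (ae_restrict_mem measurableSet_Ioi).mono fun l hl =>
    mul_nonneg (Real.rpow_nonneg (le_of_lt hl) _) (Real.exp_pos _).le

theorem fracSq_le_slobodeckij (hα0 : 0 < α) (hv : MemLp v ⊤ (timeMeasure S)) :
    fracSq α S v ≤
      (∫⁻ t in Ioc 0 S, ENNReal.ofReal (Real.Gamma α * t ^ (-α) * ‖v t‖ ^ 2))
      + ∫⁻ p in (Ioc 0 S ×ˢ Ioc 0 S) ∩ {p : ℝ × ℝ | p.2 < p.1},
        ENNReal.ofReal (Real.Gamma (1 + α) * (p.1 - p.2) ^ (-(1 + α)) * ‖v p.1 - v p.2‖ ^ 2) := by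
  set Z := (timeMeasure S).prod (timeMeasure S) with hZ
  set Λ : Measure ℝ := volume.restrict (Ioi 0) with hΛ
  have hD : AEMeasurable (fun p : ℝ × ℝ => ‖v p.1 - v p.2‖ ^ 2) Z :=
    ((hv.1.comp_fst.sub hv.1.comp_snd).norm.pow 2).aemeasurable
  have hrp : Measurable fun l : ℝ => l ^ (α - 1) := by fun_prop
  have hE : Measurable fun q : ℝ × (ℝ × ℝ) => expK S q.1 (q.2.1 - q.2.2) :=
    (measurable_expK_uncurry S).comp
      (f := fun q : ℝ × (ℝ × ℝ) => (q.1, q.2.1 - q.2.2)) (by fun_prop)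
  -- The two terms of Jensen's inequality, integrated in time.
  have e1 : ∀ l ∈ Ioi (0 : ℝ), ENNReal.ofReal (l ^ (α - 1) * normSq S (highPass S l v))
      ≤ (∫⁻ t, ENNReal.ofReal (l ^ (α - 1) * Real.exp (-(t * l)) * ‖v t‖ ^ 2) ∂(timeMeasure S))
        + ∫⁻ p, ENNReal.ofReal (l ^ (1 + α - 1) * expK S l (p.1 - p.2) * ‖v p.1 - v p.2‖ ^ 2)
          ∂Z := by
    intro l hl
    have hl' : 0 < l := hl
    have hp := Real.rpow_nonneg hl'.le (α - 1)
    have hm2 : AEMeasurable (fun p : ℝ × ℝ =>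
        ENNReal.ofReal (l ^ (1 + α - 1) * expK S l (p.1 - p.2) * ‖v p.1 - v p.2‖ ^ 2)) Z :=
      ((((measurable_expK S l).comp (by fun_prop : Measurable fun p : ℝ × ℝ => p.1 - p.2)
        ).aemeasurable.const_mul (l ^ (1 + α - 1))).mul hD).ennreal_ofReal
    have hm1 : AEMeasurable (fun t => ENNReal.ofReal
        (l ^ (α - 1) * Real.exp (-(t * l)) * ‖v t‖ ^ 2)) (timeMeasure S) :=
      ((by fun_prop : Measurable fun t : ℝ => l ^ (α - 1) * Real.exp (-(t * l))).aemeasurable.mul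
        (hv.1.norm.pow 2).aemeasurable).ennreal_ofReal
    rw [hZ, lintegral_prod _ hm2, ← lintegral_add_left' hm1, normSq, ← integral_const_mul,
      ofReal_integral_eq_lintegral_ofReal
        ((integrable_normSq (memLp_highPass l hv)).const_mul _)
        (ae_of_all _ fun t => mul_nonneg hp (sq_nonneg _))]
    refine setLIntegral_mono_ae' measurableSet_Ioc (ae_of_all _ fun t ht => ?_)
    obtain ⟨i1, i2⟩ := norm_highPass_sq_le hl' hv ht
    have e3 : ∀ s, l ^ (1 + α - 1) * expK S l (t - s) * ‖v t - v s‖ ^ 2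
        = l ^ (α - 1) * (l * expK S l (t - s) * ‖v t - v s‖ ^ 2) := by
      intro s
      have : (1 : ℝ) + α - 1 = α - 1 + 1 := by ring
      rw [this, Real.rpow_add_one hl'.ne']
      ring
    simp only [e3]
    rw [← ofReal_integral_eq_lintegral_ofReal (i1.const_mul _) (ae_of_all _ fun s => mul_nonneg hp
        (mul_nonneg (mul_nonneg hl'.le (expK_nonneg _ _)) (sq_nonneg _))),
      ← ENNReal.ofReal_add (by positivity) (integral_nonneg fun s => mul_nonneg hp
        (mul_nonneg (mul_nonneg hl'.le (expK_nonneg _ _)) (sq_nonneg _))), integral_const_mul]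
    refine ENNReal.ofReal_le_ofReal ?_
    rw [mul_assoc, mul_comm t l, ← mul_add]
    exact mul_le_mul_of_nonneg_left i2 hp
  have hM1 : AEMeasurable (fun q : ℝ × ℝ => ENNReal.ofReal
      (q.1 ^ (α - 1) * Real.exp (-(q.2 * q.1)) * ‖v q.2‖ ^ 2)) (Λ.prod (timeMeasure S)) :=
    ((by fun_prop : Measurable fun q : ℝ × ℝ => q.1 ^ (α - 1) * Real.exp (-(q.2 * q.1))
      ).aemeasurable.mul (hv.1.norm.pow 2).aemeasurable.comp_snd).ennreal_ofReal
  have hM2 : AEMeasurable (fun q : ℝ × (ℝ × ℝ) => ENNReal.ofReal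
      (q.1 ^ (1 + α - 1) * expK S q.1 (q.2.1 - q.2.2) * ‖v q.2.1 - v q.2.2‖ ^ 2)) (Λ.prod Z) :=
    (((by fun_prop : Measurable fun q : ℝ × (ℝ × ℝ) => q.1 ^ (1 + α - 1)).mul hE).aemeasurable.mul
      hD.comp_snd).ennreal_ofReal
  refine (setLIntegral_mono_ae' measurableSet_Ioi (ae_of_all _ e1)).trans ?_
  rw [lintegral_add_left' hM1.lintegral_prod_right']
  refine add_le_add ?_ ?_
  · rw [lintegral_lintegral_swap hM1]
    refine setLIntegral_mono_ae' measurableSet_Ioc (ae_of_all _ fun t ht => ?_)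
    have : ∀ l : ℝ, ENNReal.ofReal (l ^ (α - 1) * Real.exp (-(t * l)) * ‖v t‖ ^ 2)
        = ENNReal.ofReal (l ^ (α - 1) * Real.exp (-(t * l))) * ENNReal.ofReal (‖v t‖ ^ 2) :=
      fun l => ENNReal.ofReal_mul' (sq_nonneg _)
    simp only [this]
    rw [lintegral_mul_const' _ _ ENNReal.ofReal_ne_top, lintegral_rpow_mul_exp hα0 ht.1,
      ← ENNReal.ofReal_mul' (sq_nonneg _)]
  · rw [lintegral_lintegral_swap hM2, hZ, Measure.prod_restrict, inter_comm,
      ← Measure.restrict_restrict (measurableSet_lt measurable_snd measurable_fst),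
      ← lintegral_indicator (measurableSet_lt measurable_snd measurable_fst)]
    refine setLIntegral_mono_ae' (measurableSet_Ioc.prod measurableSet_Ioc)
      (ae_of_all _ fun p hp => ?_)
    have : ∀ l : ℝ, ENNReal.ofReal
        (l ^ (1 + α - 1) * expK S l (p.1 - p.2) * ‖v p.1 - v p.2‖ ^ 2)
        = ENNReal.ofReal (l ^ (1 + α - 1) * expK S l (p.1 - p.2))
          * ENNReal.ofReal (‖v p.1 - v p.2‖ ^ 2) :=
      fun l => ENNReal.ofReal_mul' (sq_nonneg _)
    simp only [this]
    rw [lintegral_mul_const' _ _ ENNReal.ofReal_ne_top]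
    by_cases hx : p.2 < p.1
    · rw [indicator_of_mem (show p ∈ {p : ℝ × ℝ | p.2 < p.1} from hx)]
      have hx' : p.1 - p.2 ∈ Ioc 0 S := ⟨sub_pos.2 hx, by linarith [hp.1.2, hp.2.1]⟩
      simp only [expK_of_mem hx', mul_comm _ (p.1 - p.2)]
      rw [lintegral_rpow_mul_exp (by linarith) hx'.1, ← ENNReal.ofReal_mul' (sq_nonneg _)]
    · have hx' : p.1 - p.2 ∉ Ioc 0 S := fun h => hx (sub_pos.1 h.1)
      simp [expK_of_notMem hx']

end Slobodeckij

/-! ### The fractional seminorm of piecewise smooth functions -/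

section PiecewiseBound

open scoped ENNReal

variable {α : ℝ}

theorem lintegral_Ioi_rpow_neg (hα0 : 0 < α) {c : ℝ} (hc : 0 < c) :
    ∫⁻ x in Ioi c, ENNReal.ofReal (x ^ (-(1 + α))) = ENNReal.ofReal (c ^ (-α) / α) := by
  rw [← ofReal_integral_eq_lintegral_ofReal (integrableOn_Ioi_rpow_of_lt (by linarith) hc),
    integral_Ioi_rpow_of_lt (by linarith) hc]
  · have : -(1 + α) + 1 = -α := by ring
    rw [this, neg_div_neg_eq]
  · exact (ae_restrict_mem measurableSet_Ioi).mono fun l hl =>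
      Real.rpow_nonneg (hc.le.trans (le_of_lt hl)) _

theorem lintegral_Iic_kernel (hα0 : 0 < α) {c t : ℝ} (h : c < t) :
    ∫⁻ s in Iic c, ENNReal.ofReal ((t - s) ^ (-(1 + α))) = ENNReal.ofReal ((t - c) ^ (-α) / α) := by
  rw [← lintegral_Ioi_rpow_neg hα0 (sub_pos.2 h), Measure.restrict_congr_set Ioi_ae_eq_Ici]
  have h1 := (Measure.measurePreserving_sub_left volume t).setLIntegral_comp_preimage
    (measurableSet_Ici (a := t - c))
    (f := fun x => ENNReal.ofReal (x ^ (-(1 + α)))) (by fun_prop)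
  have h2 : (fun s => t - s) ⁻¹' Ici (t - c) = Iic c := by
    ext s; simp
  rw [← h1, h2]

theorem lintegral_Ioi_kernel (hα0 : 0 < α) {c s : ℝ} (h : s < c) :
    ∫⁻ t in Ioi c, ENNReal.ofReal ((t - s) ^ (-(1 + α))) = ENNReal.ofReal ((c - s) ^ (-α) / α) := by
  rw [← lintegral_Ioi_rpow_neg hα0 (sub_pos.2 h)]
  have h1 := (measurePreserving_sub_right volume s).setLIntegral_comp_preimage
    (measurableSet_Ioi (a := c - s))
    (f := fun x => ENNReal.ofReal (x ^ (-(1 + α)))) (by fun_prop)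
  have h2 : (fun t => t - s) ⁻¹' Ioi (c - s) = Ioi c := by
    ext s; simp
  rw [← h1, h2]

theorem lintegral_Ioc_rpow_neg (hα1 : α < 1) {c : ℝ} (hc : 0 ≤ c) :
    ∫⁻ x in Ioc 0 c, ENNReal.ofReal (x ^ (-α)) = ENNReal.ofReal (c ^ (1 - α) / (1 - α)) := by
  have hi := intervalIntegral.intervalIntegrable_rpow' (a := 0) (b := c) (r := -α) (by linarith)
  rw [← ofReal_integral_eq_lintegral_ofReal
      ((intervalIntegrable_iff_integrableOn_Ioc_of_le hc).1 hi),
    ← intervalIntegral.integral_of_le hc, integral_rpow (Or.inl (by linarith))]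
  · have : -α + 1 = 1 - α := by ring
    rw [this, Real.zero_rpow (by linarith), sub_zero]
  · exact (ae_restrict_mem measurableSet_Ioc).mono fun l hl => Real.rpow_nonneg hl.1.le _

theorem lintegral_Ioc_sub_left (hα1 : α < 1) {a c : ℝ} (hc : a ≤ c) :
    ∫⁻ t in Ioc a c, ENNReal.ofReal ((t - a) ^ (-α))
      = ENNReal.ofReal ((c - a) ^ (1 - α) / (1 - α)) := by
  rw [← lintegral_Ioc_rpow_neg hα1 (sub_nonneg.2 hc)]
  have h1 := (measurePreserving_sub_right volume a).setLIntegral_comp_preimage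
    (measurableSet_Ioc (a := 0) (b := c - a))
    (f := fun x => ENNReal.ofReal (x ^ (-α))) (by fun_prop)
  have h2 : (fun t => t - a) ⁻¹' Ioc 0 (c - a) = Ioc a c := by
    ext s; simp
  rw [← h1, h2]

theorem lintegral_Ioc_sub_right (hα1 : α < 1) {a c : ℝ} (hc : a ≤ c) :
    ∫⁻ s in Ioc a c, ENNReal.ofReal ((c - s) ^ (-α))
      = ENNReal.ofReal ((c - a) ^ (1 - α) / (1 - α)) := by
  rw [← lintegral_Ioc_rpow_neg hα1 (sub_nonneg.2 hc)]
  have h1 := (Measure.measurePreserving_sub_left volume c).setLIntegral_comp_preimage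
    (measurableSet_Ico (a := 0) (b := c - a))
    (f := fun x => ENNReal.ofReal (x ^ (-α))) (by fun_prop)
  have h2 : (fun s => c - s) ⁻¹' Ico 0 (c - a) = Ioc a c := by
    ext s
    simp only [mem_preimage, mem_Ico, mem_Ioc]
    constructor <;> rintro ⟨_, _⟩ <;> constructor <;> linarith
  rw [Measure.restrict_congr_set (Ico_ae_eq_Ioc (a := (0 : ℝ)) (b := c - a)).symm, ← h1, h2]

theorem lintegral_kernel_left (hα0 : 0 < α) (hα1 : α < 1) {a c : ℝ} (h : a ≤ c) :
    ∫⁻ t in Ioc a c, ∫⁻ s in Iic a, ENNReal.ofReal ((t - s) ^ (-(1 + α)))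
      = ENNReal.ofReal ((c - a) ^ (1 - α) / (α * (1 - α))) := by
  have e : ∀ t ∈ Ioc a c, ∫⁻ s in Iic a, ENNReal.ofReal ((t - s) ^ (-(1 + α)))
      = ENNReal.ofReal α⁻¹ * ENNReal.ofReal ((t - a) ^ (-α)) := by
    intro t ht
    rw [lintegral_Iic_kernel hα0 ht.1, ← ENNReal.ofReal_mul (by positivity), div_eq_inv_mul]
  rw [setLIntegral_congr_fun measurableSet_Ioc e, lintegral_const_mul' _ _ ENNReal.ofReal_ne_top,
    lintegral_Ioc_sub_left hα1 h, ← ENNReal.ofReal_mul (by positivity)]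
  congr 1
  have : 1 - α ≠ 0 := by linarith
  field_simp

theorem lintegral_kernel_right (hα0 : 0 < α) (hα1 : α < 1) {a c : ℝ} (h : a ≤ c) :
    ∫⁻ s in Ioc a c, ∫⁻ t in Ioi c, ENNReal.ofReal ((t - s) ^ (-(1 + α)))
      = ENNReal.ofReal ((c - a) ^ (1 - α) / (α * (1 - α))) := by
  have e : ∀ s ∈ Ioo a c, ∫⁻ t in Ioi c, ENNReal.ofReal ((t - s) ^ (-(1 + α)))
      = ENNReal.ofReal α⁻¹ * ENNReal.ofReal ((c - s) ^ (-α)) := by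
    intro s hs
    rw [lintegral_Ioi_kernel hα0 hs.2, ← ENNReal.ofReal_mul (by positivity), div_eq_inv_mul]
  rw [← Measure.restrict_congr_set (Ioo_ae_eq_Ioc (a := a) (b := c)),
    setLIntegral_congr_fun measurableSet_Ioo e, Measure.restrict_congr_set Ioo_ae_eq_Ioc,
    lintegral_const_mul' _ _ ENNReal.ofReal_ne_top,
    lintegral_Ioc_sub_right hα1 h, ← ENNReal.ofReal_mul (by positivity)]
  congr 1
  have : 1 - α ≠ 0 := by linarith
  field_simp

/-- The contribution of one interval, on which the increments of `v` are controlled by the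
integral of `b`. -/
theorem lintegral_kernel_diag (hα0 : 0 < α) (hα1 : α < 1) {a c : ℝ} {b : ℝ → ℝ≥0∞}
    (hb : Measurable b) :
    ∫⁻ p in (Ioc a c ×ˢ Ioc a c) ∩ {p : ℝ × ℝ | p.2 < p.1},
        ENNReal.ofReal ((p.1 - p.2) ^ (-(1 + α))) * ∫⁻ x in Ioc p.2 p.1, b x
      ≤ ENNReal.ofReal ((c - a) ^ (1 - α) / (α * (1 - α))) * ∫⁻ x in Ioc a c, b x := by
  set D : Set ((ℝ × ℝ) × ℝ) := {q | q.1.1 ∈ Ioc a c ∧ q.1.2 ∈ Ioc a c ∧ q.1.2 < q.2 ∧ q.2 ≤ q.1.1}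
    with hD
  have hDm : MeasurableSet D := by
    have m1 : Measurable fun q : (ℝ × ℝ) × ℝ => q.1.1 := by fun_prop
    have m2 : Measurable fun q : (ℝ × ℝ) × ℝ => q.1.2 := by fun_prop
    have m3 : Measurable fun q : (ℝ × ℝ) × ℝ => q.2 := by fun_prop
    exact (m1 measurableSet_Ioc).inter ((m2 measurableSet_Ioc).inter
      ((measurableSet_lt m2 m3).inter (measurableSet_le m3 m1)))
  set f : (ℝ × ℝ) × ℝ → ℝ≥0∞ := D.indicator
    fun q => ENNReal.ofReal ((q.1.1 - q.1.2) ^ (-(1 + α))) * b q.2 with hf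
  have hfm : Measurable f := by
    refine Measurable.indicator (Measurable.mul ?_ (hb.comp measurable_snd)) hDm
    fun_prop
  have e1 : ∫⁻ p in (Ioc a c ×ˢ Ioc a c) ∩ {p : ℝ × ℝ | p.2 < p.1},
        ENNReal.ofReal ((p.1 - p.2) ^ (-(1 + α))) * ∫⁻ x in Ioc p.2 p.1, b x
      ≤ ∫⁻ p : ℝ × ℝ, ∫⁻ x : ℝ, f (p, x) := by
    rw [← lintegral_indicator ((measurableSet_Ioc.prod measurableSet_Ioc).inter
      (measurableSet_lt measurable_snd measurable_fst))]
    refine lintegral_mono fun p => ?_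
    by_cases hp : p ∈ (Ioc a c ×ˢ Ioc a c) ∩ {p : ℝ × ℝ | p.2 < p.1}
    · rw [indicator_of_mem hp, ← lintegral_const_mul' _ _ ENNReal.ofReal_ne_top,
        ← lintegral_indicator measurableSet_Ioc]
      refine lintegral_mono fun x => ?_
      by_cases hx : x ∈ Ioc p.2 p.1
      · rw [indicator_of_mem hx, hf, indicator_of_mem]
        exact ⟨hp.1.1, hp.1.2, hx.1, hx.2⟩
      · rw [indicator_of_notMem hx]
        exact zero_le
    · rw [indicator_of_notMem hp]
      exact zero_le
  refine e1.trans ?_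
  rw [lintegral_lintegral_swap (f := fun p x => f (p, x)) hfm.aemeasurable,
    ← lintegral_const_mul _ hb, ← lintegral_indicator measurableSet_Ioc]
  refine lintegral_mono fun x => ?_
  by_cases hx : x ∈ Ioc a c
  · rw [indicator_of_mem hx, mul_comm]
    have e2 : ∫⁻ p : ℝ × ℝ, f (p, x) ≤ ∫⁻ p in Icc x c ×ˢ Iic x,
        b x * ENNReal.ofReal ((p.1 - p.2) ^ (-(1 + α))) := by
      rw [← lintegral_indicator (measurableSet_Icc.prod measurableSet_Iic)]
      refine lintegral_mono fun p => ?_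
      by_cases hp : (p, x) ∈ D
      · rw [hf, indicator_of_mem hp, indicator_of_mem, mul_comm]
        exact ⟨⟨hp.2.2.2, hp.1.2⟩, hp.2.2.1.le⟩
      · rw [hf, indicator_of_notMem hp]
        exact zero_le
    refine e2.trans ?_
    rw [lintegral_const_mul _ (by fun_prop)]
    refine mul_le_mul_right ?_ _
    rw [Measure.volume_eq_prod, ← Measure.prod_restrict, lintegral_prod _ (by fun_prop),
      Measure.restrict_congr_set (Ioc_ae_eq_Icc (a := x) (b := c)).symm,
      lintegral_kernel_left hα0 hα1 hx.2]
    refine ENNReal.ofReal_le_ofReal ?_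
    have h1 : 0 < α * (1 - α) := mul_pos hα0 (by linarith)
    exact div_le_div_of_nonneg_right (Real.rpow_le_rpow (by linarith [hx.2])
      (by linarith [hx.1]) (by linarith)) h1.le
  · rw [indicator_of_notMem hx]
    refine le_of_eq (lintegral_eq_zero_of_ae_eq_zero (ae_of_all _ fun p => ?_))
    refine indicator_of_notMem (fun hp => hx ⟨?_, ?_⟩) _
    · exact lt_trans hp.2.1.1 hp.2.2.1
    · exact hp.2.2.2.trans hp.1.2

end PiecewiseBound

section Mesh

open scoped ENNReal

/-- `0 = τ 0 < τ 1 < ... < τ n = S`. -/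
structure IsMesh (τ : ℕ → ℝ) (n : ℕ) (S : ℝ) : Prop where
  zero : τ 0 = 0
  last : τ n = S
  lt : ∀ j < n, τ j < τ (j + 1)

variable {τ : ℕ → ℝ} {n : ℕ} {S : ℝ}

theorem IsMesh.le (h : IsMesh τ n S) {i j : ℕ} (hij : i ≤ j) (hj : j ≤ n) : τ i ≤ τ j := by
  induction j, hij using Nat.le_induction with
  | base => exact le_rfl
  | succ k hk ih => exact (ih (by omega)).trans (h.lt k (by omega)).le

theorem IsMesh.nonneg (h : IsMesh τ n S) {j : ℕ} (hj : j ≤ n) : 0 ≤ τ j :=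
  h.zero.symm.le.trans (h.le (Nat.zero_le j) hj)

theorem IsMesh.le_last (h : IsMesh τ n S) {j : ℕ} (hj : j ≤ n) : τ j ≤ S :=
  (h.le hj le_rfl).trans h.last.le

theorem IsMesh.exists_mem (h : IsMesh τ n S) {t : ℝ} (ht : t ∈ Ioc 0 S) :
    ∃ j < n, t ∈ Ioc (τ j) (τ (j + 1)) := by
  have hex : ∃ k, k ≤ n ∧ t ≤ τ k := ⟨n, le_rfl, ht.2.trans h.last.ge⟩
  classical
  obtain ⟨h1, h2⟩ := Nat.find_spec hex
  rcases hk : Nat.find hex with _ | k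
  · rw [hk, h.zero] at h2
    exact absurd ht.1 h2.not_gt
  · rw [hk] at h1 h2
    refine ⟨k, by omega, ?_, h2⟩
    by_contra hlt
    exact Nat.find_min hex (m := k) (by omega) ⟨by omega, not_lt.1 hlt⟩

theorem IsMesh.subset (h : IsMesh τ n S) {j : ℕ} (hj : j < n) :
    Ioc (τ j) (τ (j + 1)) ⊆ Ioc 0 S :=
  Ioc_subset_Ioc (h.nonneg hj.le) (h.le_last hj)

theorem IsMesh.eq_of_mem (h : IsMesh τ n S) {i j : ℕ} (hi : i < n) (hj : j < n) {t : ℝ}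
    (hti : t ∈ Ioc (τ i) (τ (i + 1))) (htj : t ∈ Ioc (τ j) (τ (j + 1))) : i = j := by
  rcases lt_trichotomy i j with hij | hij | hij
  · have := h.le (show i + 1 ≤ j from hij) hj.le
    linarith [hti.2, htj.1]
  · exact hij
  · have := h.le (show j + 1 ≤ i from hij) hi.le
    linarith [htj.2, hti.1]

variable {H : Type*} [NormedAddCommGroup H] [InnerProductSpace ℝ H] [CompleteSpace H]
variable {α : ℝ} {v : ℝ → H}

/-- The constant in the bound of the fractional seminorm of piecewise smooth functions. -/
def fracConst (α : ℝ) : ℝ :=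
  Real.Gamma α / (1 - α) + 5 * Real.Gamma (1 + α) / (α * (1 - α))

theorem setLIntegral_mesh_le (h : IsMesh τ n S) (f : ℝ → ℝ≥0∞) :
    ∫⁻ t in Ioc 0 S, f t ≤ ∑ j : Fin n, ∫⁻ t in Ioc (τ j) (τ (j + 1)), f t := by
  have h1 : Ioc 0 S ⊆ ⋃ j : Fin n, Ioc (τ j) (τ (j + 1)) := by
    intro t ht
    obtain ⟨j, hj, hjt⟩ := h.exists_mem ht
    exact mem_iUnion.2 ⟨⟨j, hj⟩, hjt⟩
  refine (lintegral_mono_set h1).trans ((lintegral_iUnion_le _ _).trans ?_)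
  rw [tsum_fintype]

/-- The fractional seminorm of a function that is piecewise of bounded variation on an arbitrary
mesh: no relation between the lengths of neighbouring intervals is needed. -/
theorem fracSq_le_of_mesh (hα0 : 0 < α) (hα1 : α < 1) (h : IsMesh τ n S)
    (hv : MemLp v ⊤ (timeMeasure S)) {M : ℕ → ℝ} (hM0 : ∀ j, 0 ≤ M j) {b : ℝ → ℝ≥0∞}
    (hb : Measurable b) (h1 : ∀ j < n, ∀ t ∈ Ioc (τ j) (τ (j + 1)), ‖v t‖ ≤ M j)
    (h2 : ∀ j < n, ∀ s t, τ j < s → s < t → t ≤ τ (j + 1) →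
      ENNReal.ofReal (‖v t - v s‖ ^ 2) ≤ ENNReal.ofReal (M j) * ∫⁻ x in Ioc s t, b x)
    (h3 : ∀ j < n, ∫⁻ x in Ioc (τ j) (τ (j + 1)), b x ≤ ENNReal.ofReal (M j)) :
    fracSq α S v ≤ ENNReal.ofReal
      (fracConst α * ∑ j ∈ Finset.range n, (τ (j + 1) - τ j) ^ (1 - α) * M j ^ 2) := by
  have hG := Real.Gamma_pos_of_pos hα0
  have hG1 : 0 < Real.Gamma (1 + α) := Real.Gamma_pos_of_pos (by linarith)
  have hα1' : 0 < 1 - α := by linarith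
  have hk : ∀ j : Fin n, 0 ≤ (τ (j + 1) - τ j) ^ (1 - α) := fun j =>
    Real.rpow_nonneg (sub_nonneg.2 (h.lt j j.2).le) _
  refine (fracSq_le_slobodeckij hα0 hv).trans ?_
  -- The first term.
  have e1 : ∫⁻ t in Ioc 0 S, ENNReal.ofReal (Real.Gamma α * t ^ (-α) * ‖v t‖ ^ 2)
      ≤ ∑ j : Fin n, ENNReal.ofReal
        (Real.Gamma α / (1 - α) * ((τ (j + 1) - τ j) ^ (1 - α) * M j ^ 2)) := by
    refine (setLIntegral_mesh_le h _).trans (Finset.sum_le_sum fun j _ => ?_)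
    have e : ∀ t ∈ Ioc (τ j) (τ (j + 1)), ENNReal.ofReal (Real.Gamma α * t ^ (-α) * ‖v t‖ ^ 2)
        ≤ ENNReal.ofReal (Real.Gamma α * M j ^ 2) * ENNReal.ofReal ((t - τ j) ^ (-α)) := by
      intro t ht
      rw [← ENNReal.ofReal_mul (mul_nonneg hG.le (sq_nonneg _))]
      refine ENNReal.ofReal_le_ofReal ?_
      have i1 : t ^ (-α) ≤ (t - τ j) ^ (-α) :=
        Real.rpow_le_rpow_of_nonpos (sub_pos.2 ht.1) (by linarith [h.nonneg j.2.le]) (by linarith)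
      have i2 : ‖v t‖ ^ 2 ≤ M j ^ 2 := by
        have := h1 j j.2 t ht
        gcongr
      have i3 : 0 ≤ (t - τ j) ^ (-α) := Real.rpow_nonneg (sub_nonneg.2 ht.1.le) _
      calc Real.Gamma α * t ^ (-α) * ‖v t‖ ^ 2
          ≤ Real.Gamma α * (t - τ j) ^ (-α) * M j ^ 2 := by gcongr
        _ = _ := by ring
    refine (setLIntegral_mono_ae' measurableSet_Ioc (ae_of_all _ e)).trans ?_
    rw [lintegral_const_mul' _ _ ENNReal.ofReal_ne_top, lintegral_Ioc_sub_left hα1 (h.lt j j.2).le,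
      ← ENNReal.ofReal_mul (mul_nonneg hG.le (sq_nonneg _))]
    refine ENNReal.ofReal_le_ofReal (le_of_eq ?_)
    field_simp
  -- The double integral: pairs of times in one interval, and pairs separated by a mesh point.
  set J : ℝ × ℝ → ℝ≥0∞ := fun p =>
    ENNReal.ofReal (Real.Gamma (1 + α) * (p.1 - p.2) ^ (-(1 + α)) * ‖v p.1 - v p.2‖ ^ 2) with hJ
  set JB : ℝ × ℝ → ℝ≥0∞ := fun p =>
    ENNReal.ofReal (2 * Real.Gamma (1 + α) * (p.1 - p.2) ^ (-(1 + α)) * ‖v p.1‖ ^ 2) with hJB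
  set JC : ℝ × ℝ → ℝ≥0∞ := fun p =>
    ENNReal.ofReal (2 * Real.Gamma (1 + α) * (p.1 - p.2) ^ (-(1 + α)) * ‖v p.2‖ ^ 2) with hJC
  set A : Fin n → Set (ℝ × ℝ) := fun j =>
    (Ioc (τ j) (τ (j + 1)) ×ˢ Ioc (τ j) (τ (j + 1))) ∩ {p : ℝ × ℝ | p.2 < p.1} with hA
  set B : Fin n → Set (ℝ × ℝ) := fun j => Ioc (τ j) (τ (j + 1)) ×ˢ Ioc 0 (τ j) with hB
  set C : Fin n → Set (ℝ × ℝ) := fun j => Ioc (τ (j + 1)) S ×ˢ Ioc (τ j) (τ (j + 1)) with hC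
  set Off : Set (ℝ × ℝ) := (⋃ j, B j) ∩ ⋃ j, C j with hOff
  have hBm : ∀ j, MeasurableSet (B j) := fun j => measurableSet_Ioc.prod measurableSet_Ioc
  have hCm : ∀ j, MeasurableSet (C j) := fun j => measurableSet_Ioc.prod measurableSet_Ioc
  have hOm : MeasurableSet Off := (MeasurableSet.iUnion hBm).inter (MeasurableSet.iUnion hCm)
  have hlt : ∀ p ∈ Off, p.2 < p.1 := by
    intro p hp
    obtain ⟨j, hj⟩ := mem_iUnion.1 hp.1
    exact lt_of_le_of_lt hj.2.2 hj.1.1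
  have hOsub : Off ⊆ Ioc 0 S ×ˢ Ioc 0 S := by
    intro p hp
    obtain ⟨j, hj⟩ := mem_iUnion.1 hp.1
    obtain ⟨i, hi⟩ := mem_iUnion.1 hp.2
    exact ⟨h.subset j.2 hj.1, h.subset i.2 hi.2⟩
  have hcov : (Ioc 0 S ×ˢ Ioc 0 S) ∩ {p : ℝ × ℝ | p.2 < p.1} ⊆ (⋃ j, A j) ∪ Off := by
    intro p hp
    obtain ⟨j, hj, hjt⟩ := h.exists_mem hp.1.1
    obtain ⟨i, hi, hit⟩ := h.exists_mem hp.1.2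
    have hlt' : p.2 < p.1 := hp.2
    rcases lt_trichotomy i j with hij | hij | hij
    · have h4 := h.le (show i + 1 ≤ j from hij) hj.le
      refine Or.inr ⟨mem_iUnion.2 ⟨⟨j, hj⟩, hjt, hp.1.2.1, ?_⟩,
        mem_iUnion.2 ⟨⟨i, hi⟩, ⟨?_, hp.1.1.2⟩, hit⟩⟩
      · exact hit.2.trans h4
      · exact lt_of_le_of_lt h4 hjt.1
    · subst hij
      exact Or.inl (mem_iUnion.2 ⟨⟨i, hi⟩, ⟨hjt, hit⟩, hp.2⟩)
    · have h4 := h.le (show j + 1 ≤ i from hij) hi.le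
      linarith [hjt.2, hit.1]
  have eA : ∀ j : Fin n, ∫⁻ p in A j, J p ≤ ENNReal.ofReal
      (Real.Gamma (1 + α) / (α * (1 - α)) * ((τ (j + 1) - τ j) ^ (1 - α) * M j ^ 2)) := by
    intro j
    have hAm : MeasurableSet (A j) := (measurableSet_Ioc.prod measurableSet_Ioc).inter
      (measurableSet_lt measurable_snd measurable_fst)
    have e : ∀ p ∈ A j, J p ≤ ENNReal.ofReal (Real.Gamma (1 + α) * M j)
        * (ENNReal.ofReal ((p.1 - p.2) ^ (-(1 + α))) * ∫⁻ x in Ioc p.2 p.1, b x) := by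
      intro p hp
      have h4 := h2 j j.2 p.2 p.1 hp.1.2.1 hp.2 hp.1.1.2
      have h5 : 0 ≤ (p.1 - p.2) ^ (-(1 + α)) :=
        Real.rpow_nonneg (sub_nonneg.2 (le_of_lt hp.2)) _
      rw [hJ]
      dsimp only
      rw [ENNReal.ofReal_mul (mul_nonneg hG1.le h5), ENNReal.ofReal_mul hG1.le,
        ENNReal.ofReal_mul hG1.le]
      calc _ ≤ ENNReal.ofReal (Real.Gamma (1 + α)) * ENNReal.ofReal ((p.1 - p.2) ^ (-(1 + α)))
            * (ENNReal.ofReal (M j) * ∫⁻ x in Ioc p.2 p.1, b x) := by gcongr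
        _ = _ := by ring
    refine (setLIntegral_mono_ae' hAm (ae_of_all _ e)).trans ?_
    rw [lintegral_const_mul' _ _ ENNReal.ofReal_ne_top]
    refine (mul_le_mul_right ((lintegral_kernel_diag hα0 hα1 hb).trans
      (mul_le_mul_right (h3 j j.2) _)) _).trans ?_
    rw [← ENNReal.ofReal_mul (div_nonneg (hk j) (by positivity)),
      ← ENNReal.ofReal_mul (mul_nonneg hG1.le (hM0 _))]
    refine ENNReal.ofReal_le_ofReal (le_of_eq ?_)
    field_simp
  have hpt : ∀ p : ℝ × ℝ, p.2 < p.1 → ∀ x M : ℝ, 0 ≤ x → x ≤ M →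
      ENNReal.ofReal (2 * Real.Gamma (1 + α) * (p.1 - p.2) ^ (-(1 + α)) * x ^ 2)
        ≤ ENNReal.ofReal (2 * Real.Gamma (1 + α) * M ^ 2)
          * ENNReal.ofReal ((p.1 - p.2) ^ (-(1 + α))) := by
    intro p hp x M hx hxM
    rw [← ENNReal.ofReal_mul (by positivity)]
    refine ENNReal.ofReal_le_ofReal ?_
    have h5 : 0 ≤ (p.1 - p.2) ^ (-(1 + α)) := Real.rpow_nonneg (sub_nonneg.2 hp.le) _
    calc _ ≤ 2 * Real.Gamma (1 + α) * (p.1 - p.2) ^ (-(1 + α)) * M ^ 2 := by gcongr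
      _ = _ := by ring
  have hcomb : ∀ j : Fin n, ENNReal.ofReal (2 * Real.Gamma (1 + α) * M j ^ 2)
        * ENNReal.ofReal ((τ (j + 1) - τ j) ^ (1 - α) / (α * (1 - α)))
      = ENNReal.ofReal
        (2 * Real.Gamma (1 + α) / (α * (1 - α)) * ((τ (j + 1) - τ j) ^ (1 - α) * M j ^ 2)) := by
    intro j
    rw [← ENNReal.ofReal_mul (by positivity)]
    congr 1
    field_simp
  have eB : ∀ j : Fin n, ∫⁻ p in B j, JB p ≤ ENNReal.ofReal
      (2 * Real.Gamma (1 + α) / (α * (1 - α)) * ((τ (j + 1) - τ j) ^ (1 - α) * M j ^ 2)) := by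
    intro j
    refine (setLIntegral_mono_ae' (hBm j) (ae_of_all _ fun p hp =>
      hpt p (lt_of_le_of_lt hp.2.2 hp.1.1) _ _ (norm_nonneg _) (h1 j j.2 _ hp.1))).trans ?_
    rw [lintegral_const_mul' _ _ ENNReal.ofReal_ne_top, ← hcomb]
    refine mul_le_mul_right ((lintegral_mono_set (prod_mono_right Ioc_subset_Iic_self)).trans ?_) _
    rw [Measure.volume_eq_prod, ← Measure.prod_restrict, lintegral_prod _ (by fun_prop),
      lintegral_kernel_left hα0 hα1 (h.lt j j.2).le]
  have eC : ∀ j : Fin n, ∫⁻ p in C j, JC p ≤ ENNReal.ofReal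
      (2 * Real.Gamma (1 + α) / (α * (1 - α)) * ((τ (j + 1) - τ j) ^ (1 - α) * M j ^ 2)) := by
    intro j
    refine (setLIntegral_mono_ae' (hCm j) (ae_of_all _ fun p hp =>
      hpt p (lt_of_le_of_lt hp.2.2 hp.1.1) _ _ (norm_nonneg _) (h1 j j.2 _ hp.2))).trans ?_
    rw [lintegral_const_mul' _ _ ENNReal.ofReal_ne_top, ← hcomb]
    refine mul_le_mul_right ((lintegral_mono_set (prod_mono_left Ioc_subset_Ioi_self)).trans ?_) _
    rw [Measure.volume_eq_prod, ← Measure.prod_restrict, lintegral_prod_symm _ (by fun_prop),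
      lintegral_kernel_right hα0 hα1 (h.lt j j.2).le]
  have hJle : ∀ p ∈ Off, J p ≤ JB p + JC p := by
    intro p hp
    have h5 : 0 ≤ (p.1 - p.2) ^ (-(1 + α)) := Real.rpow_nonneg (sub_nonneg.2 (hlt p hp).le) _
    simp only [hJ, hJB, hJC]
    rw [← ENNReal.ofReal_add (by positivity) (by positivity)]
    refine ENNReal.ofReal_le_ofReal ?_
    have h6 : ‖v p.1 - v p.2‖ ^ 2 ≤ 2 * ‖v p.1‖ ^ 2 + 2 * ‖v p.2‖ ^ 2 := by
      have := norm_sub_le (v p.1) (v p.2)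
      have := norm_nonneg (v p.1 - v p.2)
      nlinarith [sq_nonneg (‖v p.1‖ - ‖v p.2‖)]
    have := mul_le_mul_of_nonneg_left h6 (mul_nonneg hG1.le h5)
    linarith
  have hJBm : AEMeasurable JB (volume.restrict Off) := by
    have i1 : AEStronglyMeasurable (fun p : ℝ × ℝ => v p.1) (volume.restrict Off) := by
      have i2 : AEStronglyMeasurable (fun p : ℝ × ℝ => v p.1)
          ((timeMeasure S).prod (timeMeasure S)) := hv.1.comp_fst
      rw [Measure.prod_restrict, ← Measure.volume_eq_prod] at i2
      exact i2.mono_measure (Measure.restrict_mono hOsub le_rfl)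
    exact ((by fun_prop : Measurable fun p : ℝ × ℝ => 2 * Real.Gamma (1 + α)
      * (p.1 - p.2) ^ (-(1 + α))).aemeasurable.mul (i1.norm.pow 2).aemeasurable).ennreal_ofReal
  have e2 : ∫⁻ p in (Ioc 0 S ×ˢ Ioc 0 S) ∩ {p : ℝ × ℝ | p.2 < p.1}, J p
      ≤ ∑ j : Fin n, ENNReal.ofReal
        (5 * Real.Gamma (1 + α) / (α * (1 - α)) * ((τ (j + 1) - τ j) ^ (1 - α) * M j ^ 2)) := by
    calc _ ≤ (∫⁻ p in ⋃ j, A j, J p) + ∫⁻ p in Off, J p :=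
          (lintegral_mono_set hcov).trans (lintegral_union_le _ _ _)
      _ ≤ (∫⁻ p in ⋃ j, A j, J p) + ((∫⁻ p in ⋃ j, B j, JB p) + ∫⁻ p in ⋃ j, C j, JC p) := by
          refine add_le_add le_rfl ((setLIntegral_mono_ae' hOm (ae_of_all _ hJle)).trans ?_)
          rw [lintegral_add_left' hJBm]
          exact add_le_add (lintegral_mono_set inter_subset_left)
            (lintegral_mono_set inter_subset_right)
      _ ≤ (∑ j, ∫⁻ p in A j, J p) + ((∑ j, ∫⁻ p in B j, JB p) + ∑ j, ∫⁻ p in C j, JC p) := by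
          simp only [← tsum_fintype (L := .unconditional _)]
          exact add_le_add (lintegral_iUnion_le _ _)
            (add_le_add (lintegral_iUnion_le _ _) (lintegral_iUnion_le _ _))
      _ ≤ _ := by
          rw [← Finset.sum_add_distrib, ← Finset.sum_add_distrib]
          refine Finset.sum_le_sum fun j _ => ?_
          refine (add_le_add (eA j) (add_le_add (eB j) (eC j))).trans (le_of_eq ?_)
          have := hk j
          rw [← ENNReal.ofReal_add (by positivity) (by positivity),
            ← ENNReal.ofReal_add (by positivity) (by positivity)]
          congr 1
          ring
  refine (add_le_add e1 e2).trans (le_of_eq ?_)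
  rw [Finset.sum_range, Finset.mul_sum, ENNReal.ofReal_sum_of_nonneg, ← Finset.sum_add_distrib]
  · refine Finset.sum_congr rfl fun j _ => ?_
    have := hk j
    rw [← ENNReal.ofReal_add (by positivity) (by positivity), fracConst]
    congr 1
    ring
  · intro j _
    have := hk j
    rw [fracConst]
    positivity

end Mesh

section Primitive

open scoped ENNReal

variable {H : Type*} [NormedAddCommGroup H] [InnerProductSpace ℝ H] [CompleteSpace H]
variable {τ : ℕ → ℝ} {n : ℕ} {S α : ℝ}

theorem fracSq_le_of_primitive (hα0 : 0 < α) (hα1 : α < 1) (h : IsMesh τ n S) {v f : ℝ → H}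
    (hv : MemLp v ⊤ (timeMeasure S)) {M : ℕ → ℝ} (hM0 : ∀ j, 0 ≤ M j)
    (hf : Integrable f (timeMeasure S))
    (h1 : ∀ j < n, ∀ t ∈ Ioc (τ j) (τ (j + 1)), ‖v t‖ ≤ M j)
    (h2 : ∀ j < n, ∀ s t, τ j < s → s < t → t ≤ τ (j + 1) → v t - v s = ∫ x in Ioc s t, f x)
    (h3 : ∀ j < n, ∫ x in Ioc (τ j) (τ (j + 1)), ‖f x‖ ≤ M j) :
    fracSq α S v ≤ ENNReal.ofReal
      (fracConst α * ∑ j ∈ Finset.range n, (τ (j + 1) - τ j) ^ (1 - α) * M j ^ 2) := by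
  set g := hf.1.mk f with hg
  have hgm : StronglyMeasurable g := hf.1.stronglyMeasurable_mk
  have key : ∀ A ⊆ Ioc 0 S, ∫⁻ x in A, ‖g x‖ₑ = ENNReal.ofReal (∫ x in A, ‖f x‖) := by
    intro A hA
    have hle : volume.restrict A ≤ timeMeasure S := Measure.restrict_mono hA le_rfl
    rw [ofReal_integral_norm_eq_lintegral_enorm (hf.mono_measure hle)]
    refine lintegral_congr_ae ?_
    filter_upwards [hf.1.ae_eq_mk.filter_mono (ae_mono hle)] with x hx
    rw [hx]
  refine fracSq_le_of_mesh hα0 hα1 h hv hM0 (b := fun x => ‖g x‖ₑ) hgm.enorm h1 ?_ ?_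
  · intro j hj s t hs hst ht
    have hsub : Ioc s t ⊆ Ioc (τ j) (τ (j + 1)) := Ioc_subset_Ioc hs.le ht
    have hle : volume.restrict (Ioc (τ j) (τ (j + 1))) ≤ timeMeasure S :=
      Measure.restrict_mono (h.subset hj) le_rfl
    have i1 : ‖v t - v s‖ ≤ ∫ x in Ioc s t, ‖f x‖ := by
      rw [h2 j hj s t hs hst ht]
      exact norm_integral_le_integral_norm _
    have i2 : ∫ x in Ioc s t, ‖f x‖ ≤ M j :=
      (setIntegral_mono_set (hf.mono_measure hle).norm (ae_of_all _ fun _ => norm_nonneg _)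
        (LE.le.eventuallyLE hsub)).trans (h3 j hj)
    rw [key _ (hsub.trans (h.subset hj)), ← ENNReal.ofReal_mul (hM0 j)]
    refine ENNReal.ofReal_le_ofReal ?_
    nlinarith [norm_nonneg (v t - v s)]
  · intro j hj
    rw [key _ (h.subset hj)]
    exact ENNReal.ofReal_le_ofReal (h3 j hj)

end Primitive

/-! ### Smoothing of the fractional integral -/

section Smoothing

open scoped ENNReal

variable {H : Type*} [NormedAddCommGroup H] [InnerProductSpace ℝ H] [CompleteSpace H]
variable {τ : ℕ → ℝ} {n : ℕ} {S α : ℝ}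

/-- Young's inequality. -/
theorem normSq_cv_le {k : ℝ → ℝ} {g : ℝ → H} {κ : ℝ} (hk : Integrable k) (hκ : ∫ x, |k x| ≤ κ)
    (hg : MemLp g ⊤ (timeMeasure S)) :
    normSq S (cv (timeMeasure S) k g) ≤ κ ^ 2 * normSq S g := by
  set c := ∫ x, |k x| with hc
  have hc0 : 0 ≤ c := integral_nonneg fun _ => abs_nonneg _
  have hslice : ∀ t, ∫ s, |k (t - s)| ∂(timeMeasure S) ≤ c := fun t =>
    (setIntegral_le_integral (hk.comp_sub_left t).norm (ae_of_all _ fun _ => abs_nonneg _)).trans_eq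
      (integral_sub_left_eq_self (fun x => |k x|) volume t)
  have hslice' : ∀ s, ∫ t, |k (t - s)| ∂(timeMeasure S) ≤ c := fun s =>
    (setIntegral_le_integral (hk.comp_sub_right s).norm (ae_of_all _ fun _ => abs_nonneg _)).trans_eq
      (integral_sub_right_eq_self (fun x => |k x|) s)
  obtain ⟨M, hM, hb⟩ := exists_bound_of_memLp_top hg
  have hg2 := integrable_normSq hg
  have hI := integrable_cv_integrand hk.abs hg2 S
  have h1 : ∀ t, ‖cv (timeMeasure S) k g t‖ ^ 2
      ≤ c * ∫ s, |k (t - s)| * ‖g s‖ ^ 2 ∂(timeMeasure S) := by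
    intro t
    have hki := (integrable_comp_sub hk t S).abs
    have i1 : Integrable (fun s => |k (t - s)| * ‖g s‖) (timeMeasure S) :=
      hki.mul_bdd (c := M) hg.1.norm (hb.mono fun s hs => by simpa using hs)
    have i2 : Integrable (fun s => |k (t - s)| * ‖g s‖ ^ 2) (timeMeasure S) :=
      hki.mul_bdd (c := M ^ 2) (hg.1.norm.pow 2) (hb.mono fun s hs => by
        rw [norm_pow, norm_norm]; gcongr)
    have i3 : ‖cv (timeMeasure S) k g t‖ ≤ ∫ s, |k (t - s)| * ‖g s‖ ∂(timeMeasure S) := by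
      refine norm_integral_le_of_norm_le i1 (ae_of_all _ fun s => ?_)
      rw [norm_smul, Real.norm_eq_abs]
    have i4 : (∫ s, |k (t - s)| * ‖g s‖ ∂(timeMeasure S)) ^ 2
        ≤ (∫ s, |k (t - s)| ∂(timeMeasure S)) * ∫ s, |k (t - s)| * ‖g s‖ ^ 2 ∂(timeMeasure S) := by
      have hq : ∀ x : ℝ, 0 ≤ (∫ s, |k (t - s)| ∂(timeMeasure S)) * (x * x)
          + (-2 * ∫ s, |k (t - s)| * ‖g s‖ ∂(timeMeasure S)) * x
          + ∫ s, |k (t - s)| * ‖g s‖ ^ 2 ∂(timeMeasure S) := by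
        intro x
        have : 0 ≤ ∫ s, |k (t - s)| * (‖g s‖ - x) ^ 2 ∂(timeMeasure S) :=
          integral_nonneg fun s => by positivity
        refine this.trans_eq ?_
        rw [← integral_mul_const, ← integral_const_mul, ← integral_mul_const,
          ← integral_add (hki.mul_const _) ((i1.const_mul _).mul_const x),
          ← integral_add (f := fun s => |k (t - s)| * (x * x) + -2 * (|k (t - s)| * ‖g s‖) * x)
            ((hki.mul_const _).add ((i1.const_mul _).mul_const x)) i2]
        congr 1; ext s; ring
      have := discrim_le_zero hq
      rw [discrim] at this
      nlinarith
    have i5 : 0 ≤ ∫ s, |k (t - s)| * ‖g s‖ ^ 2 ∂(timeMeasure S) :=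
      integral_nonneg fun s => by positivity
    calc ‖cv (timeMeasure S) k g t‖ ^ 2 ≤ (∫ s, |k (t - s)| * ‖g s‖ ∂(timeMeasure S)) ^ 2 := by
          gcongr
      _ ≤ _ := i4
      _ ≤ _ := mul_le_mul_of_nonneg_right (hslice t) i5
  have hIc : Integrable (fun t => ∫ s, |k (t - s)| * ‖g s‖ ^ 2 ∂(timeMeasure S)) (timeMeasure S) :=
    hI.integral_prod_left
  calc normSq S (cv (timeMeasure S) k g)
      ≤ ∫ t, c * ∫ s, |k (t - s)| * ‖g s‖ ^ 2 ∂(timeMeasure S) ∂(timeMeasure S) :=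
        integral_mono (integrable_normSq (memLp_top_cv hk hg)) (hIc.const_mul c) h1
    _ = c * ∫ s, (∫ t, |k (t - s)| ∂(timeMeasure S)) * ‖g s‖ ^ 2 ∂(timeMeasure S) := by
        rw [integral_const_mul, integral_integral_swap hI]
        simp only [integral_mul_const]
    _ ≤ c * ∫ s, c * ‖g s‖ ^ 2 ∂(timeMeasure S) := by
        refine mul_le_mul_of_nonneg_left (integral_mono_of_nonneg
          (ae_of_all _ fun s => ?_) (hg2.const_mul c) (ae_of_all _ fun s => ?_)) hc0
        · exact mul_nonneg (integral_nonneg fun _ => abs_nonneg _) (sq_nonneg _)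
        · exact mul_le_mul_of_nonneg_right (hslice' s) (sq_nonneg _)
    _ = c ^ 2 * normSq S g := by rw [integral_const_mul, normSq]; ring
    _ ≤ κ ^ 2 * normSq S g := by
        have := normSq_nonneg (S := S) g
        gcongr

theorem omega_antitone (hα0 : 0 < α) (hα1 : α < 1) {s x : ℝ} (hs : 0 < s) (hsx : s ≤ x) :
    omega α x ≤ omega α s :=
  div_le_div_of_nonneg_right (Real.rpow_le_rpow_of_nonpos hs hsx (by linarith))
    (Real.Gamma_pos_of_pos hα0).le

theorem mul_integral_expK_le_one (hS : 0 < S) {l : ℝ} : l * ∫ x, expK S l x ≤ 1 := by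
  have h1 := mul_integral_expK (l := l) (show S ∈ Ioc 0 S from ⟨hS, le_rfl⟩)
  rw [integral_reflect S (expK S l), setIntegral_eq_integral_of_forall_compl_eq_zero
    fun x hx => expK_of_notMem hx] at h1
  rw [h1]
  linarith [Real.exp_pos (-(l * S))]

/-- The kernel of `∂ₜ (l + ∂ₜ)⁻¹` applied to the fractional integral of order `α`. -/
def smoothK (α S l : ℝ) : ℝ → ℝ := (Ioc 0 S).indicator fun x =>
  omK S α x - l * cv (timeMeasure S) (expK S l) (omK S α) x

theorem integrable_smoothK (hα0 : 0 < α) (S l : ℝ) : Integrable (smoothK α S l) :=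
  (integrable_indicator_iff measurableSet_Ioc).2 ((integrable_omK hα0 S).restrict.sub
    ((integrable_cv (integrable_expK S l) (integrable_omK hα0 S).restrict S).const_mul l))

theorem integral_abs_smoothK_le (hα0 : 0 < α) (hα1 : α < 1) (hS : 0 < S) {l : ℝ} (hl : 0 < l) :
    ∫ x, |smoothK α S l x| ≤ 2 * l ^ (-α) := by
  set om := omK S α with hom
  set c : ℝ → ℝ := fun x => l * cv (timeMeasure S) (expK S l) om x with hc
  have homi : Integrable om (timeMeasure S) := (integrable_omK hα0 S).restrict
  have hci : Integrable c (timeMeasure S) :=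
    (integrable_cv (integrable_expK S l) homi S).const_mul l
  have hG := Real.Gamma_pos_of_pos hα0
  have hei : Integrable (fun x => om x * Real.exp (-(l * x))) (timeMeasure S) := by
    refine homi.mul_bdd (c := 1) (by fun_prop) ?_
    filter_upwards [ae_restrict_mem measurableSet_Ioc] with x hx
    rw [Real.norm_of_nonneg (Real.exp_pos _).le, Real.exp_le_one_iff]
    nlinarith [hx.1]
  -- Since `ω_α` is decreasing, its exponential average `c` is at least `(1 - exp (-l x)) ω_α`.
  have h1 : ∀ x ∈ Ioc 0 S, (1 - Real.exp (-(l * x))) * om x ≤ c x := by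
    intro x hx
    have i1 : Integrable (fun s => expK S l (x - s) * om s) (timeMeasure S) := by
      simpa using integrable_expK_slice (S := S) (h := om) hl.le homi x
    have i2 : (∫ s, expK S l (x - s) ∂(timeMeasure S)) * om x
        ≤ ∫ s, expK S l (x - s) * om s ∂(timeMeasure S) := by
      rw [← integral_mul_const]
      refine integral_mono_ae ((integrable_comp_sub (integrable_expK S l) x S).mul_const _) i1 ?_
      filter_upwards [ae_restrict_mem measurableSet_Ioc] with s hs
      rcases le_or_gt x s with h | h
      · rw [expK_of_notMem fun h' => by linarith [h'.1], zero_mul, zero_mul]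
      · refine mul_le_mul_of_nonneg_left ?_ (expK_nonneg _ _)
        rw [hom, omK_of_mem hx, omK_of_mem hs]
        exact omega_antitone hα0 hα1 hs.1 h.le
    rw [← mul_integral_expK hx, mul_assoc]
    exact mul_le_mul_of_nonneg_left i2 hl.le
  have h2 : ∫ x, c x ∂(timeMeasure S) ≤ ∫ x, om x ∂(timeMeasure S) := by
    have hI := integrable_cv_integrand (m := timeMeasure S) (integrable_expK S l) homi S
    have i1 : ∫ x, c x ∂(timeMeasure S)
        = ∫ s, (l * ∫ x, expK S l (x - s) ∂(timeMeasure S)) * om s ∂(timeMeasure S) := by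
      simp only [hc, cv]
      rw [integral_const_mul, integral_integral_swap hI, ← integral_const_mul]
      simp only [smul_eq_mul, integral_mul_const, mul_assoc]
    rw [i1]
    refine integral_mono_of_nonneg (ae_of_all _ fun s => ?_) homi (ae_of_all _ fun s => ?_)
    · exact mul_nonneg (mul_nonneg hl.le (integral_nonneg fun _ => expK_nonneg _ _))
        (omK_nonneg hα0 s)
    · refine mul_le_of_le_one_left (omK_nonneg hα0 s) ?_
      refine le_trans (mul_le_mul_of_nonneg_left ?_ hl.le) (mul_integral_expK_le_one hS (l := l))
      exact (setIntegral_le_integral ((integrable_expK S l).comp_sub_right s)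
        (ae_of_all _ fun _ => expK_nonneg _ _)).trans_eq
        (integral_sub_right_eq_self (expK S l) s)
  have h3 : ∫ x, om x * Real.exp (-(l * x)) ∂(timeMeasure S) ≤ l ^ (-α) := by
    have i1 : ∫ x, om x * Real.exp (-(l * x)) ∂(timeMeasure S)
        = ∫ x in Ioc 0 S, x ^ (α - 1) * Real.exp (-(l * x)) / Real.Gamma α := by
      refine setIntegral_congr_fun measurableSet_Ioc fun x hx => ?_
      rw [hom, omK_of_mem hx, omega]
      ring
    rw [i1, integral_div, div_le_iff₀ hG]
    refine (setIntegral_mono_set (integrableOn_rpow_mul_exp hα0 hl) ?_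
      (LE.le.eventuallyLE Ioc_subset_Ioi_self)).trans_eq ?_
    · exact (ae_restrict_mem measurableSet_Ioi).mono fun x hx =>
        mul_nonneg (Real.rpow_nonneg (le_of_lt hx) _) (Real.exp_pos _).le
    · rw [Real.integral_rpow_mul_exp_neg_mul_Ioi hα0 hl, one_div, Real.inv_rpow hl.le,
        ← Real.rpow_neg hl.le]
  have h4 : ∫ x, |smoothK α S l x| = ∫ x, |om x - c x| ∂(timeMeasure S) := by
    rw [← setIntegral_eq_integral_of_forall_compl_eq_zero (s := Ioc 0 S)]
    · refine setIntegral_congr_fun measurableSet_Ioc fun x hx => ?_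
      rw [smoothK, indicator_of_mem hx]
    · intro x hx
      rw [smoothK, indicator_of_notMem hx, abs_zero]
  rw [h4]
  calc ∫ x, |om x - c x| ∂(timeMeasure S)
      ≤ ∫ x, (2 * (om x * Real.exp (-(l * x))) + (c x - om x)) ∂(timeMeasure S) := by
        refine integral_mono_ae (homi.sub hci).abs ((hei.const_mul 2).add (hci.sub homi)) ?_
        filter_upwards [ae_restrict_mem measurableSet_Ioc] with x hx
        have i1 := h1 x hx
        have i2 := mul_nonneg (omK_nonneg (S := S) hα0 x) (Real.exp_pos (-(l * x))).le
        rw [abs_le]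
        constructor <;> linarith
    _ = 2 * ∫ x, om x * Real.exp (-(l * x)) ∂(timeMeasure S)
        + (∫ x, c x ∂(timeMeasure S) - ∫ x, om x ∂(timeMeasure S)) := by
        rw [integral_add (g := fun x => c x - om x) (hei.const_mul 2) (hci.sub homi), integral_const_mul,
          integral_sub hci homi]
    _ ≤ 2 * l ^ (-α) := by linarith

theorem highPass_fracInt {g : ℝ → H} (hα0 : 0 < α) {l : ℝ} (hl : 0 ≤ l)
    (hg : MemLp g ⊤ (timeMeasure S)) {t : ℝ} (ht : t ∈ Ioc 0 S) :
    highPass S l (cv (timeMeasure S) (omK S α) g) t = cv (timeMeasure S) (smoothK α S l) g t := by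
  obtain ⟨M, hM, hb⟩ := exists_bound_of_memLp_top hg
  have hgi := integrable_of_memLp_top hg
  have hom := integrable_omK hα0 S
  set k := cv (timeMeasure S) (expK S l) (omK S α) with hk
  have h1 := cv_cv_of_bounded (k₁₂ := k) (integrable_expK S l) hom hgi (ae_timeMeasure_nonneg S)
    (fun x => expK_of_notMem) (fun x => omK_of_notMem) (fun x _ => by
      rw [hk, cv, setIntegral_eq_integral_of_forall_compl_eq_zero fun s hs => by
        rw [omK_of_notMem hs, smul_zero]]
      rfl) (abs_expK_le hl) ht
  have i1 : Integrable (fun s => omK S α (t - s) • g s) (timeMeasure S) :=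
    (integrable_comp_sub hom t S).smul_bdd M hg.1 hb
  have i2 : Integrable (fun s => smoothK α S l (t - s) • g s) (timeMeasure S) :=
    (integrable_comp_sub (integrable_smoothK hα0 S l) t S).smul_bdd M hg.1 hb
  have h2 : ∀ᵐ s ∂(timeMeasure S), omK S α (t - s) • g s - smoothK α S l (t - s) • g s
      = l • k (t - s) • g s := by
    filter_upwards [ae_timeMeasure_nonneg S] with s hs
    by_cases hx : t - s ∈ Ioc 0 S
    · rw [smoothK, indicator_of_mem hx]
      module
    · have h3 : k (t - s) = 0 := by
        rw [hk, cv]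
        refine integral_eq_zero_of_ae ?_
        filter_upwards [ae_restrict_mem measurableSet_Ioc] with x hx'
        rw [expK_of_notMem, zero_smul]; · rfl
        intro h
        exact hx ⟨by linarith [h.1, hx'.1], by linarith [ht.2]⟩
      rw [smoothK, indicator_of_notMem hx, omK_of_notMem hx, h3]
      simp
  rw [highPass, h1, cv, cv, cv, ← integral_smul, ← integral_congr_ae h2, integral_sub i1 i2]
  abel

theorem normSq_highPass_fracInt_le {g : ℝ → H} (hα0 : 0 < α) (hα1 : α < 1) (hS : 0 < S) {l : ℝ}
    (hl : 0 < l) (hg : MemLp g ⊤ (timeMeasure S)) :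
    normSq S (highPass S l (cv (timeMeasure S) (omK S α) g)) ≤ 4 * l ^ (-(2 * α)) * normSq S g := by
  have h1 : normSq S (highPass S l (cv (timeMeasure S) (omK S α) g))
      = normSq S (cv (timeMeasure S) (smoothK α S l) g) := by
    refine setIntegral_congr_fun measurableSet_Ioc fun t ht => ?_
    rw [highPass_fracInt hα0 hl.le hg ht]
  rw [h1]
  refine (normSq_cv_le (integrable_smoothK hα0 S l)
    (integral_abs_smoothK_le hα0 hα1 hS hl) hg).trans_eq ?_
  rw [mul_pow, ← Real.rpow_natCast (l ^ (-α)), ← Real.rpow_mul hl.le]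
  rw [show -α * ((2 : ℕ) : ℝ) = -(2 * α) by push_cast; ring]
  norm_num

end Smoothing

/-! ### Approximation of fractional integrals by step functions -/

section Step

open scoped ENNReal

variable {H : Type*} [NormedAddCommGroup H] [InnerProductSpace ℝ H] [CompleteSpace H]
variable {τ : ℕ → ℝ} {n : ℕ} {S α : ℝ}

/-- The step function with value `c j` on `(τ j, τ (j + 1)]`. -/
def stepFun (τ : ℕ → ℝ) (n : ℕ) (c : ℕ → H) (t : ℝ) : H :=
  ∑ j ∈ Finset.range n, (Ioc (τ j) (τ (j + 1))).indicator (fun _ => c j) t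

theorem stepFun_of_mem (h : IsMesh τ n S) (c : ℕ → H) {j : ℕ} (hj : j < n) {t : ℝ}
    (ht : t ∈ Ioc (τ j) (τ (j + 1))) : stepFun τ n c t = c j := by
  rw [stepFun, Finset.sum_eq_single_of_mem j (Finset.mem_range.2 hj), indicator_of_mem ht]
  intro i hi hij
  exact indicator_of_notMem (fun hti => hij (h.eq_of_mem (Finset.mem_range.1 hi) hj hti ht)) _

theorem IsMesh.timeMeasure_eq (h : IsMesh τ n S) :
    timeMeasure S = volume.restrict (⋃ j : Fin n, Ioc (τ j) (τ (j + 1))) := by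
  have : Ioc 0 S = ⋃ j : Fin n, Ioc (τ j) (τ (j + 1)) := by
    refine Subset.antisymm (fun t ht => ?_) (iUnion_subset fun j => h.subset j.2)
    obtain ⟨j, hj, hjt⟩ := h.exists_mem ht
    exact mem_iUnion.2 ⟨⟨j, hj⟩, hjt⟩
  rw [← this]

theorem IsMesh.memLp_top {v : ℝ → H} (h : IsMesh τ n S)
    (hc : ∀ j < n, ContinuousOn v (Ioc (τ j) (τ (j + 1)))) {M : ℝ}
    (hM : ∀ j < n, ∀ t ∈ Ioc (τ j) (τ (j + 1)), ‖v t‖ ≤ M) : MemLp v ⊤ (timeMeasure S) := by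
  refine memLp_top_of_bound ?_ M ?_
  · rw [h.timeMeasure_eq, aestronglyMeasurable_iUnion_iff]
    exact fun j => (hc j j.2).aestronglyMeasurable measurableSet_Ioc
  · filter_upwards [ae_restrict_mem measurableSet_Ioc] with t ht
    obtain ⟨j, hj, hjt⟩ := h.exists_mem ht
    exact hM j hj t hjt

theorem memLp_stepFun (h : IsMesh τ n S) (c : ℕ → H) :
    MemLp (stepFun τ n c) ⊤ (timeMeasure S) := by
  refine h.memLp_top (M := ∑ j ∈ Finset.range n, ‖c j‖)
    (fun j hj => continuousOn_const.congr fun t ht => stepFun_of_mem h c hj ht) fun j hj t ht => ?_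
  rw [stepFun_of_mem h c hj ht]
  exact Finset.single_le_sum (f := fun j => ‖c j‖) (fun _ _ => norm_nonneg _) (Finset.mem_range.2 hj)

theorem IsMesh.integral_eq_sum {F : Type*} [NormedAddCommGroup F] [NormedSpace ℝ F] {f : ℝ → F}
    (h : IsMesh τ n S) (hf : Integrable f (timeMeasure S)) :
    ∫ t, f t ∂(timeMeasure S) = ∑ j ∈ Finset.range n, ∫ t in Ioc (τ j) (τ (j + 1)), f t := by
  have h1 := intervalIntegral.sum_integral_adjacent_intervals (f := f) (μ := volume) (a := τ) (n := n)
    fun j hj => (intervalIntegrable_iff_integrableOn_Ioc_of_le (h.lt j hj).le).2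
      (IntegrableOn.mono_set hf (h.subset hj))
  rw [h.zero, h.last, intervalIntegral.integral_of_le
    (by rw [← h.zero]; exact h.le_last (Nat.zero_le n))] at h1
  rw [← h1]
  refine Finset.sum_congr rfl fun j hj => ?_
  rw [intervalIntegral.integral_of_le (h.lt j (Finset.mem_range.1 hj)).le]

theorem sq_integral_norm_le {a b : ℝ} (hab : a ≤ b) {f : ℝ → H}
    (hf : MemLp f ⊤ (volume.restrict (Ioc a b))) :
    (∫ x in Ioc a b, ‖f x‖) ^ 2 ≤ (b - a) * ∫ x in Ioc a b, ‖f x‖ ^ 2 := by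
  have hi : Integrable (fun x => ‖f x‖) (volume.restrict (Ioc a b)) :=
    (integrable_of_memLp_top hf).norm
  have hi2 : Integrable (fun x => ‖f x‖ ^ 2) (volume.restrict (Ioc a b)) := by
    simpa only [real_inner_self_eq_norm_sq] using
      integrable_inner_of_bounded (integrable_of_memLp_top hf) hf
  have hq : ∀ y : ℝ, 0 ≤ (b - a) * (y * y) + (-2 * ∫ x in Ioc a b, ‖f x‖) * y
      + ∫ x in Ioc a b, ‖f x‖ ^ 2 := by
    intro y
    have : 0 ≤ ∫ x in Ioc a b, (‖f x‖ - y) ^ 2 := integral_nonneg fun x => sq_nonneg _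
    refine this.trans_eq ?_
    have e1 : ∫ _ in Ioc a b, y * y = (b - a) * (y * y) := by
      simp [hab]
    rw [← e1, ← integral_const_mul, ← integral_mul_const,
      ← integral_add (integrable_const _) ((hi.const_mul _).mul_const y),
      ← integral_add (f := fun x => y * y + -2 * ‖f x‖ * y)
        ((integrable_const _).add ((hi.const_mul _).mul_const y)) hi2]
    congr 1; ext x; ring
  have := discrim_le_zero hq
  rw [discrim] at this
  nlinarith

theorem cv_expK_zero {f : ℝ → H} {t : ℝ} (ht : t ∈ Ioc 0 S) :
    cv (timeMeasure S) (expK S 0) f t = ∫ x in Ioc 0 t, f x := by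
  rw [cv, ← integral_indicator measurableSet_Ioc, ← integral_indicator measurableSet_Ioc]
  refine integral_congr_ae ?_
  have h0 : ∀ᵐ s : ℝ, s ≠ t := by simp [ae_iff, measure_singleton]
  filter_upwards [h0] with s hs
  by_cases hs1 : s ∈ Ioc 0 t
  · have : s ∈ Ioc 0 S := ⟨hs1.1, hs1.2.trans ht.2⟩
    rw [indicator_of_mem this, indicator_of_mem hs1, expK_of_mem]
    · simp
    · exact ⟨by linarith [lt_of_le_of_ne hs1.2 hs], by linarith [hs1.1, ht.2]⟩
  · rw [indicator_of_notMem hs1]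
    by_cases hs2 : s ∈ Ioc 0 S
    · rw [indicator_of_mem hs2, expK_of_notMem, zero_smul]
      exact fun hx => hs1 ⟨hs2.1, by linarith [hx.1]⟩
    · rw [indicator_of_notMem hs2]

section

variable {g : ℝ → H} {k : ℝ}

theorem normSq_highPass_highPass_le (hα0 : 0 < α) (hα1 : α < 1) (hS : 0 < S) {μ l : ℝ}
    (hμ : 0 < μ) (hl : μ < l) (hg : MemLp g ⊤ (timeMeasure S)) :
    normSq S (highPass S l (highPass S μ (cv (timeMeasure S) (omK S α) g)))
      ≤ 16 * l ^ (-(2 * α)) * normSq S g := by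
  have hl0 : 0 < l := hμ.trans hl
  set Y := cv (timeMeasure S) (omK S α) g with hY
  have hYm : MemLp Y ⊤ (timeMeasure S) := memLp_top_cv (integrable_omK hα0 S) hg
  set f : ℝ → H := fun t => μ • highPass S μ Y t with hf
  have hfm : MemLp f ⊤ (timeMeasure S) := (memLp_highPass μ hYm).const_smul μ
  set Z : ℝ → H := fun t => -(μ • cv (timeMeasure S) (expK S μ) Y t) with hZ
  have hZm : MemLp Z ⊤ (timeMeasure S) :=
    ((memLp_top_cv (integrable_expK S μ) hYm).const_smul μ).neg
  have hPZ : ∀ᵐ t ∂(timeMeasure S), highPass S l Z t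
      = cv (timeMeasure S) (expK S l) (fun t => - f t) t := by
    refine highPass_eq_cv hl0.le (integrable_of_memLp_top hfm).neg (ae_timeMeasure_nonneg S) ?_
    filter_upwards [ae_restrict_mem measurableSet_Ioc] with t ht
    simp only [hZ, hf]
    rw [cv_expK_eq_cv_highPass hμ.le hYm ht]
    simp only [cv, smul_neg, integral_neg, smul_comm _ μ, integral_smul]
  have h1 : normSq S (highPass S l (highPass S μ Y))
      ≤ 2 * normSq S (highPass S l Y) + 2 * normSq S (highPass S l Z) := by
    refine le_trans (le_of_eq ?_)
      (normSq_add_le (memLp_highPass l hYm) (memLp_highPass l hZm))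
    have e1 : highPass S μ Y = fun t => Y t + Z t := by
      ext t
      simp only [highPass, hZ, sub_eq_add_neg]
    have e2 : highPass S l (highPass S μ Y) = fun t => highPass S l Y t + highPass S l Z t := by
      ext t
      rw [e1, highPass_add hl0.le hYm hZm]
    rw [e2]
  have h2 := normSq_highPass_fracInt_le hα0 hα1 hS hl0 hg
  have h3 : l ^ 2 * normSq S (highPass S l Z) ≤ μ ^ 2 * (4 * μ ^ (-(2 * α)) * normSq S g) := by
    have e1 : normSq S (highPass S l Z)
        = normSq S (cv (timeMeasure S) (expK S l) (fun t => - f t)) :=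
      integral_congr_ae (hPZ.mono fun t ht => by simp only [ht])
    have e2 := sq_mul_normSq_cv_le hl0.le hfm.neg
    have e3 : normSq S (-f) = μ ^ 2 * normSq S (highPass S μ Y) := by
      simp only [normSq, hf, Pi.neg_apply, norm_neg, norm_smul, mul_pow, Real.norm_eq_abs, sq_abs,
        integral_const_mul]
    rw [e1]
    refine e2.trans (e3.le.trans ?_)
    gcongr
    exact normSq_highPass_fracInt_le hα0 hα1 hS hμ hg
  have h4 : μ ^ 2 * μ ^ (-(2 * α)) ≤ l ^ 2 * l ^ (-(2 * α)) := by
    have e : ∀ x : ℝ, 0 < x → x ^ 2 * x ^ (-(2 * α)) = x ^ (2 - 2 * α) := by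
      intro x hx
      rw [← Real.rpow_two, ← Real.rpow_add hx]
      rfl
    rw [e μ hμ, e l hl0]
    exact Real.rpow_le_rpow hμ.le hl.le (by linarith)
  have hN := normSq_nonneg (S := S) g
  have h5 : normSq S (highPass S l Z) ≤ 4 * l ^ (-(2 * α)) * normSq S g := by
    have : l ^ 2 * normSq S (highPass S l Z) ≤ l ^ 2 * (4 * l ^ (-(2 * α)) * normSq S g) := by
      refine h3.trans ?_
      have := mul_le_mul_of_nonneg_right h4 hN
      linarith
    exact le_of_mul_le_mul_left this (by positivity)
  linarith

theorem fracSq_highPass_fracInt_le (hα0 : 0 < α) (hα1 : α < 1) (hS : 0 < S) {μ : ℝ}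
    (hμ : 0 < μ) (hg : MemLp g ⊤ (timeMeasure S)) :
    fracSq α S (highPass S μ (cv (timeMeasure S) (omK S α) g))
      ≤ ENNReal.ofReal (20 / α * μ ^ (-α) * normSq S g) := by
  have hN := normSq_nonneg (S := S) g
  have hYm : MemLp (cv (timeMeasure S) (omK S α) g) ⊤ (timeMeasure S) :=
    memLp_top_cv (integrable_omK hα0 S) hg
  have hsplit : Ioi (0 : ℝ) = Ioc 0 μ ∪ Ioi μ := (Ioc_union_Ioi_eq_Ioi hμ.le).symm
  have hμp : μ ^ (-(2 * α)) * μ ^ α = μ ^ (-α) := by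
    rw [← Real.rpow_add hμ]; congr 1; ring
  have h1 : ∫⁻ l in Ioc 0 μ, ENNReal.ofReal
      (l ^ (α - 1) * normSq S (highPass S l (highPass S μ (cv (timeMeasure S) (omK S α) g))))
      ≤ ENNReal.ofReal (4 / α * μ ^ (-α) * normSq S g) := by
    have i1 : IntegrableOn (fun l : ℝ => l ^ (α - 1) * (4 * μ ^ (-(2 * α)) * normSq S g))
        (Ioc 0 μ) :=
      ((intervalIntegrable_iff_integrableOn_Ioc_of_le hμ.le).1
        (intervalIntegral.intervalIntegrable_rpow' (by linarith))).mul_const _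
    have i2 : ∫ l in Ioc 0 μ, l ^ (α - 1) * (4 * μ ^ (-(2 * α)) * normSq S g)
        = 4 / α * μ ^ (-α) * normSq S g := by
      rw [integral_mul_const, ← intervalIntegral.integral_of_le hμ.le,
        integral_rpow (Or.inl (by linarith)), sub_add_cancel, Real.zero_rpow hα0.ne', sub_zero,
        ← hμp]
      ring
    rw [← i2, ofReal_integral_eq_lintegral_ofReal i1]
    · refine setLIntegral_mono_ae' measurableSet_Ioc (ae_of_all _ fun l hl => ?_)
      refine ENNReal.ofReal_le_ofReal (mul_le_mul_of_nonneg_left ?_ (Real.rpow_nonneg hl.1.le _))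
      exact (normSq_highPass_le hl.1.le (memLp_highPass μ hYm)).trans
        (normSq_highPass_fracInt_le hα0 hα1 hS hμ hg)
    · filter_upwards [ae_restrict_mem measurableSet_Ioc] with l hl
      have := Real.rpow_nonneg hl.1.le (α - 1)
      have := Real.rpow_nonneg hμ.le (-(2 * α))
      positivity
  have h2 : ∫⁻ l in Ioi μ, ENNReal.ofReal
      (l ^ (α - 1) * normSq S (highPass S l (highPass S μ (cv (timeMeasure S) (omK S α) g))))
      ≤ ENNReal.ofReal (16 / α * μ ^ (-α) * normSq S g) := by
    have i1 : IntegrableOn (fun l : ℝ => l ^ (-α - 1) * (16 * normSq S g)) (Ioi μ) :=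
      (integrableOn_Ioi_rpow_of_lt (by linarith) hμ).mul_const _
    have i2 : ∫ l in Ioi μ, l ^ (-α - 1) * (16 * normSq S g) = 16 / α * μ ^ (-α) * normSq S g := by
      rw [integral_mul_const, integral_Ioi_rpow_of_lt (by linarith) hμ, sub_add_cancel]
      field_simp
    rw [← i2, ofReal_integral_eq_lintegral_ofReal i1]
    · refine setLIntegral_mono_ae' measurableSet_Ioi (ae_of_all _ fun l hl => ?_)
      have hl0 : 0 < l := hμ.trans hl
      refine ENNReal.ofReal_le_ofReal ((mul_le_mul_of_nonneg_left
        (normSq_highPass_highPass_le hα0 hα1 hS hμ hl hg) (Real.rpow_nonneg hl0.le _)).trans_eq ?_)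
      have : l ^ (-α - 1) = l ^ (α - 1) * l ^ (-(2 * α)) := by
        rw [← Real.rpow_add hl0]; congr 1; ring
      rw [this]; ring
    · filter_upwards [ae_restrict_mem measurableSet_Ioi] with l hl
      have := Real.rpow_nonneg (hμ.trans hl).le (-α - 1)
      positivity
  have hp := Real.rpow_nonneg hμ.le (-α)
  rw [fracSq, hsplit, lintegral_union measurableSet_Ioi (Ioc_disjoint_Ioi le_rfl)]
  refine (add_le_add h1 h2).trans_eq ?_
  rw [← ENNReal.ofReal_add (by positivity) (by positivity)]
  congr 1; ring

/-- A fractional integral of order `α`, regularized at scale `k` and sampled on a mesh of width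
`k`, yields a step function that approximates it to order `k ^ (α / 2)` in the fractional
seminorm. -/
theorem exists_step_fracSq_le (hα0 : 0 < α) (hα1 : α < 1) (h : IsMesh τ n S) (hS : 0 < S)
    (hk : 0 < k) (hmesh : ∀ j < n, τ (j + 1) - τ j ≤ k) (hg : MemLp g ⊤ (timeMeasure S)) :
    ∃ c : ℕ → H, fracSq α S (fun t => cv (timeMeasure S) (omK S α) g t - stepFun τ n c t)
      ≤ ENNReal.ofReal ((40 / α + 8 * fracConst α) * k ^ α * normSq S g) := by
  have hN := normSq_nonneg (S := S) g
  set μ := k⁻¹ with hμd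
  have hμ : 0 < μ := inv_pos.2 hk
  have hμk : ∀ x : ℝ, μ ^ (-x) = k ^ x := fun x => by
    rw [hμd, Real.inv_rpow hk.le, Real.rpow_neg hk.le, inv_inv]
  set Y := cv (timeMeasure S) (omK S α) g with hY
  have hYm : MemLp Y ⊤ (timeMeasure S) := memLp_top_cv (integrable_omK hα0 S) hg
  set f : ℝ → H := fun t => μ • highPass S μ Y t with hf
  have hfm : MemLp f ⊤ (timeMeasure S) := (memLp_highPass μ hYm).const_smul μ
  have hfi := integrable_of_memLp_top hfm
  set Z : ℝ → H := fun t => μ • cv (timeMeasure S) (expK S μ) Y t with hZ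
  have hZm : MemLp Z ⊤ (timeMeasure S) := (memLp_top_cv (integrable_expK S μ) hYm).const_smul μ
  have hZf : ∀ t ∈ Ioc 0 S, Z t = ∫ x in Ioc 0 t, f x := by
    intro t ht
    simp only [hZ, hf]
    rw [cv_expK_eq_cv_highPass hμ.le hYm ht, cv_expK_zero ht, integral_smul]
  have hZd : ∀ s t, 0 < s → s ≤ t → t ≤ S → Z t - Z s = ∫ x in Ioc s t, f x := by
    intro s t hs hst ht
    have hI : ∀ b, b ≤ S → IntegrableOn f (Ioc 0 b) := fun b hb =>
      IntegrableOn.mono_set hfi (Ioc_subset_Ioc_right hb)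
    rw [hZf t ⟨hs.trans_le hst, ht⟩, hZf s ⟨hs, hst.trans ht⟩,
      ← intervalIntegral.integral_of_le (hs.le.trans hst), ← intervalIntegral.integral_of_le hs.le,
      ← intervalIntegral.integral_of_le hst, intervalIntegral.integral_interval_sub_left]
    · exact (intervalIntegrable_iff_integrableOn_Ioc_of_le (hs.le.trans hst)).2 (hI t ht)
    · exact (intervalIntegrable_iff_integrableOn_Ioc_of_le hs.le).2 (hI s (hst.trans ht))
  set c : ℕ → H := fun j => Z (τ (j + 1)) with hc
  refine ⟨c, ?_⟩
  set M : ℕ → ℝ := fun j => ∫ x in Ioc (τ j) (τ (j + 1)), ‖f x‖ with hM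
  have hvm : MemLp (fun t => Z t - stepFun τ n c t) ⊤ (timeMeasure S) :=
    hZm.sub (memLp_stepFun h c)
  have hsub : ∀ j < n, volume.restrict (Ioc (τ j) (τ (j + 1))) ≤ timeMeasure S := fun j hj =>
    Measure.restrict_mono (h.subset hj) le_rfl
  have key := fracSq_le_of_primitive hα0 hα1 h hvm (M := M) (f := f)
    (fun j => integral_nonneg fun _ => norm_nonneg _) hfi
    (fun j hj t ht => by
      have h1 := hZd t (τ (j + 1)) ((h.nonneg hj.le).trans_lt ht.1) ht.2 (h.le_last hj)
      rw [stepFun_of_mem h c hj ht, norm_sub_rev, hc, h1]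
      refine (norm_integral_le_integral_norm _).trans (setIntegral_mono_set
        (hfi.mono_measure (hsub j hj)).norm (ae_of_all _ fun _ => norm_nonneg _)
        (LE.le.eventuallyLE (Ioc_subset_Ioc_left ht.1.le))))
    (fun j hj s t hs hst ht => by
      rw [stepFun_of_mem h c hj ⟨hs.trans hst, ht⟩, stepFun_of_mem h c hj ⟨hs, hst.le.trans ht⟩,
        sub_sub_sub_cancel_right]
      exact hZd s t ((h.nonneg hj.le).trans_lt hs) hst.le (ht.trans (h.le_last hj)))
    (fun j hj => le_rfl)
  have hFC : 0 ≤ fracConst α := by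
    have := Real.Gamma_pos_of_pos hα0
    have := Real.Gamma_pos_of_pos (show 0 < 1 + α by linarith)
    have : 0 < 1 - α := by linarith
    rw [fracConst]; positivity
  have hsum : ∑ j ∈ Finset.range n, (τ (j + 1) - τ j) ^ (1 - α) * M j ^ 2
      ≤ 4 * k ^ α * normSq S g := by
    have h1 : ∀ j ∈ Finset.range n, (τ (j + 1) - τ j) ^ (1 - α) * M j ^ 2
        ≤ k ^ (2 - α) * ∫ x in Ioc (τ j) (τ (j + 1)), ‖f x‖ ^ 2 := by
      intro j hj
      have hj' := Finset.mem_range.1 hj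
      have hpos : 0 < τ (j + 1) - τ j := sub_pos.2 (h.lt j hj')
      have e1 := sq_integral_norm_le (h.lt j hj').le (hfm.mono_measure (hsub j hj'))
      have e2 : (τ (j + 1) - τ j) ^ (1 - α) * (τ (j + 1) - τ j) = (τ (j + 1) - τ j) ^ (2 - α) := by
        rw [← Real.rpow_add_one hpos.ne']; congr 1; ring
      have e3 : 0 ≤ ∫ x in Ioc (τ j) (τ (j + 1)), ‖f x‖ ^ 2 := integral_nonneg fun _ => sq_nonneg _
      calc (τ (j + 1) - τ j) ^ (1 - α) * M j ^ 2
          ≤ (τ (j + 1) - τ j) ^ (1 - α) * ((τ (j + 1) - τ j)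
            * ∫ x in Ioc (τ j) (τ (j + 1)), ‖f x‖ ^ 2) :=
            mul_le_mul_of_nonneg_left e1 (Real.rpow_nonneg hpos.le _)
        _ = (τ (j + 1) - τ j) ^ (2 - α) * ∫ x in Ioc (τ j) (τ (j + 1)), ‖f x‖ ^ 2 := by
            rw [← mul_assoc, e2]
        _ ≤ _ := mul_le_mul_of_nonneg_right
            (Real.rpow_le_rpow hpos.le (hmesh j hj') (by linarith)) e3
    refine (Finset.sum_le_sum h1).trans ?_
    rw [← Finset.mul_sum, ← h.integral_eq_sum (integrable_normSq hfm)]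
    have e1 : ∫ t, ‖f t‖ ^ 2 ∂(timeMeasure S) = μ ^ 2 * normSq S (highPass S μ Y) := by
      simp only [normSq, hf, norm_smul, mul_pow, Real.norm_eq_abs, sq_abs, integral_const_mul]
    have e2 := normSq_highPass_fracInt_le hα0 hα1 hS hμ hg
    rw [hμk] at e2
    have e3 : k ^ (2 - α) * μ ^ 2 * k ^ (2 * α) = k ^ α := by
      rw [hμd, inv_pow, ← Real.rpow_two k, ← Real.rpow_neg hk.le, ← Real.rpow_add hk,
        ← Real.rpow_add hk]
      congr 1; ring
    rw [e1]
    calc k ^ (2 - α) * (μ ^ 2 * normSq S (highPass S μ Y))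
        ≤ k ^ (2 - α) * (μ ^ 2 * (4 * k ^ (2 * α) * normSq S g)) := by gcongr
      _ = 4 * (k ^ (2 - α) * μ ^ 2 * k ^ (2 * α)) * normSq S g := by ring
      _ = _ := by rw [e3]
  have hp := Real.rpow_nonneg hk.le α
  have hsplit : (fun t => Y t - stepFun τ n c t)
      = fun t => highPass S μ Y t + (Z t - stepFun τ n c t) := by
    ext t; simp only [highPass, hZ]; abel
  rw [hsplit]
  refine (fracSq_add_le (memLp_highPass μ hYm) hvm).trans ?_
  have h1 := fracSq_highPass_fracInt_le hα0 hα1 hS hμ hg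
  rw [hμk] at h1
  have h2 := key.trans (ENNReal.ofReal_le_ofReal (mul_le_mul_of_nonneg_left hsum hFC))
  calc 2 * fracSq α S (highPass S μ Y) + 2 * fracSq α S (fun t => Z t - stepFun τ n c t)
      ≤ ENNReal.ofReal 2 * ENNReal.ofReal (20 / α * k ^ α * normSq S g)
        + ENNReal.ofReal 2 * ENNReal.ofReal (fracConst α * (4 * k ^ α * normSq S g)) := by
        rw [ENNReal.ofReal_ofNat]
        gcongr
    _ = _ := by
        rw [← ENNReal.ofReal_mul zero_le_two, ← ENNReal.ofReal_mul zero_le_two,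
          ← ENNReal.ofReal_add (by positivity) (by positivity)]
        congr 1; ring

theorem IsMesh.reflect (h : IsMesh τ n S) : IsMesh (fun j => S - τ (n - j)) n S := by
  refine ⟨by simp [h.last], by simp [h.zero], fun j hj => ?_⟩
  have := h.lt (n - (j + 1)) (by omega)
  rw [show n - (j + 1) + 1 = n - j by omega] at this
  simpa using this

/-- The adjoint fractional integral of `g` is approximated by a step function on the given mesh,
in the seminorm that is conjugate to `fracSq` under time reversal. -/
theorem exists_step_fracSq_rev_le (hα0 : 0 < α) (hα1 : α < 1) (h : IsMesh τ n S) (hS : 0 < S)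
    (hk : 0 < k) (hmesh : ∀ j < n, τ (j + 1) - τ j ≤ k) (hg : MemLp g ⊤ (timeMeasure S)) :
    ∃ c : ℕ → H, fracSq α S (rev S fun t =>
        rev S (cv (timeMeasure S) (omK S α) (rev S g)) t - stepFun τ n c t)
      ≤ ENNReal.ofReal ((40 / α + 8 * fracConst α) * k ^ α * normSq S g) := by
  obtain ⟨c, hc⟩ := exists_step_fracSq_le hα0 hα1 h.reflect hS hk (fun j hj => by
    have := hmesh (n - (j + 1)) (by omega)
    rw [show n - (j + 1) + 1 = n - j by omega] at this
    linarith) (memLp_rev hg)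
  refine ⟨fun j => c (n - 1 - j), ?_⟩
  rw [normSq_rev] at hc
  refine le_trans (le_of_eq (fracSq_congr_ae ?_)) hc
  have h1 : ∀ᵐ t : ℝ, ∀ j : ℕ, t ≠ S - τ j :=
    ae_all_iff.2 fun j => by simp [ae_iff, measure_singleton]
  filter_upwards [ae_restrict_mem measurableSet_Ioc, ae_restrict_of_ae h1] with t ht hne
  obtain ⟨j, hj, hjt⟩ := h.reflect.exists_mem ht
  rw [stepFun_of_mem h.reflect c hj hjt]
  have h2 : S - t ∈ Ioc (τ (n - 1 - j)) (τ (n - 1 - j + 1)) := by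
    have e1 : n - (j + 1) = n - 1 - j := by omega
    have e2 : n - j = n - 1 - j + 1 := by omega
    simp only [e1, e2] at hjt
    have := lt_of_le_of_ne hjt.2 (hne _)
    exact ⟨by linarith, by linarith [hjt.1]⟩
  simp only [rev, sub_sub_cancel]
  rw [stepFun_of_mem h _ (by omega) h2]
  congr 2
  omega

end

end Step

/-! ### Piecewise absolutely continuous functions and their fractional derivatives -/

section Jump

variable {H : Type*} [NormedAddCommGroup H] [InnerProductSpace ℝ H]
variable {τ : ℕ → ℝ} {n : ℕ} {S α : ℝ}

/-- Lebesgue measure on `(0, S]` plus a unit mass at the left endpoint of each mesh interval. -/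
def jumpMeasure (τ : ℕ → ℝ) (n : ℕ) (S : ℝ) : Measure ℝ :=
  timeMeasure S + ∑ j ∈ Finset.range n, Measure.dirac (τ j)

instance : IsFiniteMeasure (jumpMeasure τ n S) := by
  rw [jumpMeasure]; infer_instance

open Classical in
/-- The density, with respect to `jumpMeasure`, of the derivative of a function that jumps by `J j`
at `τ j` and has the derivative `f` elsewhere. -/
def jumpDensity (τ : ℕ → ℝ) (n : ℕ) (J : ℕ → H) (f : ℝ → H) (t : ℝ) : H :=
  if ∃ j < n, τ j = t then ∑ j ∈ Finset.range n, if τ j = t then J j else 0 else f t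

theorem IsMesh.strict (h : IsMesh τ n S) {i j : ℕ} (hij : i < j) (hj : j ≤ n) : τ i < τ j :=
  (h.lt i (by omega)).trans_le (h.le hij hj)

theorem jumpDensity_node (h : IsMesh τ n S) (J : ℕ → H) (f : ℝ → H) {j : ℕ} (hj : j < n) :
    jumpDensity τ n J f (τ j) = J j := by
  rw [jumpDensity, if_pos ⟨j, hj, rfl⟩, Finset.sum_eq_single_of_mem j (Finset.mem_range.2 hj),
    if_pos rfl]
  intro i hi hij
  have hi' := Finset.mem_range.1 hi
  refine if_neg fun he => ?_
  rcases lt_or_gt_of_ne hij with h1 | h1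
  · exact (h.strict h1 hj.le).ne he
  · exact (h.strict h1 hi'.le).ne he.symm

theorem jumpDensity_ae (J : ℕ → H) (f : ℝ → H) :
    ∀ᵐ t ∂(timeMeasure S), jumpDensity τ n J f t = f t := by
  have h1 : ∀ᵐ t : ℝ, ∀ j : ℕ, t ≠ τ j :=
    ae_all_iff.2 fun j => by simp [ae_iff, measure_singleton]
  filter_upwards [ae_restrict_of_ae h1] with t ht
  rw [jumpDensity, if_neg]
  rintro ⟨j, -, hj⟩
  exact ht j hj.symm

theorem integrable_jumpMeasure {F : Type*} [NormedAddCommGroup F] {φ : ℝ → F} :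
    Integrable φ (jumpMeasure τ n S) ↔ Integrable φ (timeMeasure S) := by
  rw [jumpMeasure, integrable_add_measure, and_iff_left]
  exact integrable_finsetSum_measure.2 fun j _ => integrable_dirac enorm_lt_top

theorem integrable_jumpDensity (J : ℕ → H) {f : ℝ → H} (hf : Integrable f (timeMeasure S)) :
    Integrable (jumpDensity τ n J f) (jumpMeasure τ n S) :=
  integrable_jumpMeasure.2 (hf.congr ((jumpDensity_ae J f).mono fun _ h => h.symm))

theorem ae_jumpMeasure_nonneg (h : IsMesh τ n S) : ∀ᵐ t ∂(jumpMeasure τ n S), 0 ≤ t := by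
  rw [jumpMeasure, ae_add_measure_iff]
  refine ⟨ae_timeMeasure_nonneg S, ?_⟩
  rw [ae_finsetSum_measure_iff]
  intro j hj
  rw [ae_dirac_eq]
  exact h.nonneg (Finset.mem_range.1 hj).le

variable [CompleteSpace H]

theorem cv_jumpMeasure (h : IsMesh τ n S) (J : ℕ → H) {f : ℝ → H} {k : ℝ → ℝ} {t : ℝ}
    (hf : Integrable (fun s => k (t - s) • f s) (timeMeasure S)) :
    cv (jumpMeasure τ n S) k (jumpDensity τ n J f) t
      = cv (timeMeasure S) k f t + ∑ j ∈ Finset.range n, k (t - τ j) • J j := by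
  have h1 : ∀ᵐ s ∂(timeMeasure S),
      k (t - s) • jumpDensity τ n J f s = k (t - s) • f s :=
    (jumpDensity_ae J f).mono fun s hs => by rw [hs]
  rw [cv, jumpMeasure, integral_add_measure, cv, integral_congr_ae h1, integral_finsetSum_measure]
  · congr 1
    refine Finset.sum_congr rfl fun j hj => ?_
    rw [integral_dirac, jumpDensity_node h J f (Finset.mem_range.1 hj)]
  · exact fun j _ => integrable_dirac enorm_lt_top
  · exact hf.congr (h1.mono fun _ h => h.symm)
  · exact integrable_finsetSum_measure.2 fun j _ => integrable_dirac enorm_lt_top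

theorem eq_cv_jumpDensity (h : IsMesh τ n S) (J : ℕ → H) {f v : ℝ → H}
    (hf : Integrable f (timeMeasure S))
    (hv : ∀ j < n, ∀ t ∈ Ioc (τ j) (τ (j + 1)),
      v t = ∑ i ∈ Finset.range (j + 1), J i + ∫ s in Ioc 0 t, f s) :
    ∀ᵐ t ∂(timeMeasure S), v t = cv (jumpMeasure τ n S) (expK S 0) (jumpDensity τ n J f) t := by
  filter_upwards [ae_restrict_mem measurableSet_Ioc] with t ht
  obtain ⟨j, hj, hjt⟩ := h.exists_mem ht
  rw [cv_jumpMeasure h J (integrable_expK_slice le_rfl hf t), cv_expK_zero ht, hv j hj t hjt,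
    add_comm]
  congr 1
  rw [← Finset.sum_subset (Finset.range_subset_range.2 (show j + 1 ≤ n from hj))]
  · refine Finset.sum_congr rfl fun i hi => ?_
    have hi' := Finset.mem_range.1 hi
    have h1 := h.le (show i ≤ j by omega) hj.le
    have h2 := h.nonneg (show i ≤ n by omega)
    rw [expK_of_mem ⟨by linarith [hjt.1], by linarith [ht.2]⟩]
    simp
  · intro i hi hi'
    have h1 := Finset.mem_range.1 hi
    have h2 : j + 1 ≤ i := by simpa using hi'
    have h3 := h.le h2 h1.le
    rw [expK_of_notMem, zero_smul]
    exact fun hx => by linarith [hx.1, hjt.2]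

/-- A step function is the primitive of its jumps. -/
theorem stepFun_eq_cv (h : IsMesh τ n S) (c : ℕ → H) :
    ∀ᵐ t ∂(timeMeasure S), stepFun τ n c t = cv (jumpMeasure τ n S) (expK S 0)
      (jumpDensity τ n (fun j => c j - if j = 0 then 0 else c (j - 1)) 0) t := by
  refine eq_cv_jumpDensity h _ (integrable_zero _ _ _) fun j hj t ht => ?_
  have h1 : ∀ j, ∑ i ∈ Finset.range (j + 1), (c i - if i = 0 then 0 else c (i - 1)) = c j := by
    intro j
    induction j with
    | zero => simp
    | succ j ih =>
      rw [Finset.sum_range_succ, ih]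
      simp
  rw [stepFun_of_mem h c hj ht, h1]
  simp

theorem integral_mul_comm_conv (k₁ k₂ : ℝ → ℝ) (x : ℝ) :
    ∫ s, k₁ (x - s) * k₂ s = ∫ s, k₂ (x - s) * k₁ s := by
  rw [← integral_sub_left_eq_self (fun s => k₁ (x - s) * k₂ s) volume x]
  simp only [sub_sub_cancel, mul_comm]

theorem rlIntegral_eq_cv {β : ℝ} (v : ℝ → H) {t : ℝ} (ht : t ∈ Ioc 0 S) :
    rlIntegral β v t = cv (timeMeasure S) (omK S β) v t := by
  rw [rlIntegral, intervalIntegral.integral_of_le ht.1.le, cv,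
    ← integral_indicator measurableSet_Ioc, ← integral_indicator measurableSet_Ioc]
  refine integral_congr_ae ?_
  have h0 : ∀ᵐ s : ℝ, s ≠ t := by simp [ae_iff, measure_singleton]
  filter_upwards [h0] with s hs
  by_cases hs1 : s ∈ Ioc 0 t
  · have : s ∈ Ioc 0 S := ⟨hs1.1, hs1.2.trans ht.2⟩
    rw [indicator_of_mem this, indicator_of_mem hs1, omK_of_mem]
    exact ⟨by linarith [lt_of_le_of_ne hs1.2 hs], by linarith [hs1.1, ht.2]⟩
  · rw [indicator_of_notMem hs1]
    by_cases hs2 : s ∈ Ioc 0 S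
    · rw [indicator_of_mem hs2, omK_of_notMem, zero_smul]
      exact fun hx => hs1 ⟨hs2.1, by linarith [hx.1]⟩
    · rw [indicator_of_notMem hs2]

/-- The Riemann–Liouville derivative of the primitive of a vector measure `h dm` is the convolution
of `h dm` with `ω_(1-α)`. -/
theorem rlDeriv_eq_cv {m : Measure ℝ} [IsFiniteMeasure m] {h v : ℝ → H}
    (hα1 : α < 1) (hh : Integrable h m) (hm : ∀ᵐ τ ∂m, 0 ≤ τ)
    (hv : ∀ᵐ t ∂(timeMeasure S), v t = cv m (expK S 0) h t) :
    ∀ᵐ t ∂(timeMeasure S), rlDeriv α v t = cv m (omK S (1 - α)) h t := by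
  set om := omK S (1 - α) with hom
  have homi : Integrable om := integrable_omK (by linarith) S
  have hGi := integrable_cv homi hh S
  have h2 : ∀ t ∈ Ioc 0 S, rlIntegral (1 - α) v t = ∫ s in (0 : ℝ)..t, cv m om h s := by
    intro t ht
    rw [rlIntegral_eq_cv v ht, intervalIntegral.integral_of_le ht.1.le, ← cv_expK_zero ht,
      cv_congr_ae hv]
    have e1 := cv_cv_of_integrable (k₁₂ := fun x => ∫ s, om (x - s) * expK S 0 s)
      homi (integrable_expK S 0) hh hm (fun x => omK_of_notMem) (fun x => expK_of_notMem)
      (fun x _ => rfl) ht (by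
        refine (integrable_comp_sub homi t S).abs.mul_bdd (c := ∫ τ, ‖h τ‖ ∂m) ?_ ?_
        · exact (integrable_cv (integrable_expK S 0).abs hh.norm S).aestronglyMeasurable
        · refine ae_of_all _ fun s => ?_
          rw [cv]
          refine norm_integral_le_of_norm_le hh.norm (ae_of_all _ fun x => ?_)
          rw [norm_smul, norm_norm, norm_abs_eq_norm]
          exact mul_le_of_le_one_left (norm_nonneg _) (abs_expK_le le_rfl _))
    have e2 := cv_cv_of_bounded (k₁₂ := fun x => ∫ s, om (x - s) * expK S 0 s)
      (integrable_expK S 0) homi hh hm (fun x => expK_of_notMem) (fun x => omK_of_notMem)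
      (fun x _ => integral_mul_comm_conv _ _ _) (abs_expK_le le_rfl) ht
    rw [e1, e2]
  rcases le_or_gt S 0 with hS | hS
  · simp [Ioc_eq_empty hS.not_gt]
  have h3 := ((intervalIntegrable_iff_integrableOn_Ioc_of_le hS.le).2 hGi).ae_hasDerivAt_integral
  have hne : ∀ᵐ t : ℝ, t ≠ S := by simp [ae_iff, measure_singleton]
  filter_upwards [ae_restrict_of_ae h3, ae_restrict_mem measurableSet_Ioc, ae_restrict_of_ae hne]
    with t ht htS htne
  rw [uIcc_of_le hS.le] at ht
  have h4 := ht ⟨htS.1.le, htS.2⟩ 0 ⟨le_rfl, hS.le⟩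
  have h5 : rlIntegral (1 - α) v =ᶠ[𝓝 t] fun x => ∫ s in (0 : ℝ)..x, cv m om h s := by
    filter_upwards [Ioo_mem_nhds htS.1 (lt_of_le_of_ne htS.2 htne)] with x hx
    exact h2 x ⟨hx.1, hx.2.le⟩
  rw [rlDeriv, h5.deriv_eq, h4.deriv]

end Jump

/-! ### The bilinear form of the fractional derivative -/

section Form

open scoped ENNReal

variable {H : Type*} [NormedAddCommGroup H] [InnerProductSpace ℝ H] [CompleteSpace H]
variable {τ : ℕ → ℝ} {n : ℕ} {S α : ℝ} {v w : ℝ → H}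

/-- `v` is, almost everywhere on `(0, S]`, the primitive of a vector measure which is absolutely
continuous apart from atoms at the left endpoints of the mesh intervals. -/
def IsPiecewiseAC (τ : ℕ → ℝ) (n : ℕ) (S : ℝ) (v : ℝ → H) : Prop :=
  ∃ h : ℝ → H, Integrable h (jumpMeasure τ n S) ∧
    ∀ᵐ t ∂(timeMeasure S), v t = cv (jumpMeasure τ n S) (expK S 0) h t

/-- The form `∫₀^S ⟨∂ₜ^α v, w⟩`. -/
def rlForm (α S : ℝ) (v w : ℝ → H) : ℝ := ∫ t, inner ℝ (rlDeriv α v t) (w t) ∂(timeMeasure S)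

theorem IsPiecewiseAC.of_jumps (h : IsMesh τ n S) (J : ℕ → H) {f : ℝ → H}
    (hf : Integrable f (timeMeasure S))
    (hv : ∀ j < n, ∀ t ∈ Ioc (τ j) (τ (j + 1)),
      v t = ∑ i ∈ Finset.range (j + 1), J i + ∫ s in Ioc 0 t, f s) : IsPiecewiseAC τ n S v :=
  ⟨_, integrable_jumpDensity J hf, eq_cv_jumpDensity h J hf hv⟩

theorem isPiecewiseAC_stepFun (h : IsMesh τ n S) (c : ℕ → H) :
    IsPiecewiseAC τ n S (stepFun τ n c) :=
  ⟨_, integrable_jumpDensity _ (integrable_zero _ _ _), stepFun_eq_cv h c⟩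

theorem IsPiecewiseAC.memLp (hv : IsPiecewiseAC τ n S v) : MemLp v ⊤ (timeMeasure S) := by
  obtain ⟨h, hh, hv⟩ := hv
  exact memLp_of_ae_eq_cv hh hv

/-- The fractional derivatives of finitely many functions and of their linear combinations with
vector coefficients. -/
theorem rlDeriv_sum_smul (hm : IsMesh τ n S) (hα1 : α < 1) {ι : Type*} (s : Finset ι)
    {φ : ι → ℝ → ℝ} (hφ : ∀ i ∈ s, IsPiecewiseAC τ n S (φ i)) (c : ι → H) :
    IsPiecewiseAC τ n S (fun t => ∑ i ∈ s, φ i t • c i) ∧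
    ∀ᵐ t ∂(timeMeasure S), rlDeriv α (fun t => ∑ i ∈ s, φ i t • c i) t
      = ∑ i ∈ s, rlDeriv α (φ i) t • c i := by
  choose! h hh hv using hφ
  set m := jumpMeasure τ n S with hmd
  have hm0 := ae_jumpMeasure_nonneg hm
  have e0 : ∀ {k : ℝ → ℝ} {t : ℝ}, (∀ i ∈ s, Integrable (fun x => k (t - x) • h i x) m) →
      cv m k (fun x => ∑ i ∈ s, h i x • c i) t = ∑ i ∈ s, cv m k (h i) t • c i := by
    intro k t hk
    simp only [cv, Finset.smul_sum, ← smul_assoc]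
    rw [integral_finsetSum _ fun i hi => (hk i hi).smul_const (c i)]
    exact Finset.sum_congr rfl fun i _ => integral_smul_const _ _
  have hH : Integrable (fun x => ∑ i ∈ s, h i x • c i) m :=
    integrable_finsetSum _ fun i hi => (hh i hi).smul_const (c i)
  have hV : ∀ᵐ t ∂(timeMeasure S), ∑ i ∈ s, φ i t • c i
      = cv m (expK S 0) (fun x => ∑ i ∈ s, h i x • c i) t := by
    filter_upwards [(Finset.eventually_all s).2 hv] with t ht
    rw [e0 fun i hi => integrable_expK_slice le_rfl (hh i hi) t]
    exact Finset.sum_congr rfl fun i hi => by rw [ht i hi]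
  refine ⟨⟨_, hH, hV⟩, ?_⟩
  have h1 : ∀ i ∈ s, ∀ᵐ t ∂(timeMeasure S), rlDeriv α (φ i) t = cv m (omK S (1 - α)) (h i) t :=
    fun i hi => rlDeriv_eq_cv hα1 (hh i hi) hm0 (hv i hi)
  have h2 : ∀ i ∈ s, ∀ᵐ t ∂(timeMeasure S),
      Integrable (fun x => omK S (1 - α) (t - x) • h i x) m := fun i hi =>
    (integrable_cv_integrand (integrable_omK (by linarith) S) (hh i hi) S).prod_right_ae
  filter_upwards [rlDeriv_eq_cv hα1 hH hm0 hV, (Finset.eventually_all s).2 h1,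
    (Finset.eventually_all s).2 h2] with t h3 h4 h5
  rw [h3, e0 h5]
  exact Finset.sum_congr rfl fun i hi => by rw [h4 i hi]

theorem rlDeriv_sub (hm : IsMesh τ n S) (hα1 : α < 1) (hv : IsPiecewiseAC τ n S v)
    (hw : IsPiecewiseAC τ n S w) : IsPiecewiseAC τ n S (fun t => v t - w t) ∧
    ∀ᵐ t ∂(timeMeasure S), rlDeriv α (fun t => v t - w t) t = rlDeriv α v t - rlDeriv α w t := by
  obtain ⟨f, hf, hv⟩ := hv
  obtain ⟨g, hg, hw⟩ := hw
  set m := jumpMeasure τ n S with hmd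
  have hm0 := ae_jumpMeasure_nonneg hm
  have e0 : ∀ {k : ℝ → ℝ} {t : ℝ}, Integrable (fun x => k (t - x) • f x) m →
      Integrable (fun x => k (t - x) • g x) m →
      cv m k (fun x => f x - g x) t = cv m k f t - cv m k g t := by
    intro k t h1 h2
    simp only [cv, smul_sub]
    exact integral_sub h1 h2
  have hV : ∀ᵐ t ∂(timeMeasure S), v t - w t = cv m (expK S 0) (fun x => f x - g x) t := by
    filter_upwards [hv, hw] with t h1 h2
    rw [e0 (integrable_expK_slice le_rfl hf t) (integrable_expK_slice le_rfl hg t), h1, h2]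
  refine ⟨⟨_, hf.sub hg, hV⟩, ?_⟩
  have hom := integrable_omK (S := S) (b := 1 - α) (by linarith)
  filter_upwards [rlDeriv_eq_cv hα1 (hf.sub hg) hm0 hV, rlDeriv_eq_cv hα1 hf hm0 hv,
    rlDeriv_eq_cv hα1 hg hm0 hw, (integrable_cv_integrand hom hf S).prod_right_ae,
    (integrable_cv_integrand hom hg S).prod_right_ae] with t h1 h2 h3 h4 h5
  rw [h1, h2, h3]
  exact e0 h4 h5

theorem IsPiecewiseAC.integrable_rlDeriv (hm : IsMesh τ n S) (hα1 : α < 1)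
    (hv : IsPiecewiseAC τ n S v) : Integrable (rlDeriv α v) (timeMeasure S) := by
  obtain ⟨f, hf, hv⟩ := hv
  exact (integrable_cv (integrable_omK (by linarith) S) hf S).congr
    ((rlDeriv_eq_cv hα1 hf (ae_jumpMeasure_nonneg hm) hv).mono fun _ h => h.symm)

theorem rlForm_eq {f : ℝ → H} (hm : IsMesh τ n S) (hα1 : α < 1)
    (hf : Integrable f (jumpMeasure τ n S))
    (hv : ∀ᵐ t ∂(timeMeasure S), v t = cv (jumpMeasure τ n S) (expK S 0) f t) (w : ℝ → H) :
    rlForm α S v w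
      = ∫ t, inner ℝ (cv (jumpMeasure τ n S) (omK S (1 - α)) f t) (w t) ∂(timeMeasure S) :=
  integral_congr_ae ((rlDeriv_eq_cv hα1 hf (ae_jumpMeasure_nonneg hm) hv).mono
    fun t ht => by simp only [ht])

section

variable (hm : IsMesh τ n S) (hα0 : 0 < α) (hα1 : α < 1) (hv : IsPiecewiseAC τ n S v)

include hm hα0 hα1 hv

theorem rlForm_self_nonneg : 0 ≤ rlForm α S v v := by
  obtain ⟨f, hf, hv⟩ := hv
  rw [rlForm_eq hm hα1 hf hv]
  exact integral_rlDeriv_nonneg hα0 hα1 hf (ae_jumpMeasure_nonneg hm) hv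

theorem fracSq_le_rlForm : fracSq α S v
    ≤ ENNReal.ofReal (Real.Gamma α * Real.Gamma (1 - α) * rlForm α S v v) := by
  obtain ⟨f, hf, hv⟩ := hv
  rw [rlForm_eq hm hα1 hf hv]
  exact fracSq_le_integral_rlDeriv hα0 hα1 hf (ae_jumpMeasure_nonneg hm) hv

theorem fracSq_rev_le_rlForm : fracSq α S (rev S v)
    ≤ ENNReal.ofReal (Real.Gamma α * Real.Gamma (1 - α) * rlForm α S v v) := by
  obtain ⟨f, hf, hv⟩ := hv
  rw [rlForm_eq hm hα1 hf hv]
  exact fracSq_rev_le_integral_rlDeriv hα0 hα1 hf (ae_jumpMeasure_nonneg hm) hv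

theorem abs_rlForm_le (hw : MemLp w ⊤ (timeMeasure S)) {A B : ℝ} (hA0 : 0 ≤ A) (hB0 : 0 ≤ B)
    (hA : fracSq α S v ≤ ENNReal.ofReal A) (hB : fracSq α S (rev S w) ≤ ENNReal.ofReal B) :
    Real.Gamma α * Real.Gamma (1 - α) * |rlForm α S v w| ≤ (1 - α)⁻¹ * (√A * √B) := by
  obtain ⟨f, hf, hv⟩ := hv
  rw [rlForm_eq hm hα1 hf hv]
  exact abs_integral_rlDeriv_inner_le hα0 hα1 hf (ae_jumpMeasure_nonneg hm) hv hw hA0 hB0 hA hB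

theorem rlForm_fracInt {g : ℝ → H} (hg : MemLp g ⊤ (timeMeasure S)) :
    rlForm α S v (rev S (cv (timeMeasure S) (omK S α) (rev S g)))
      = ∫ t, inner ℝ (v t) (g t) ∂(timeMeasure S) := by
  obtain ⟨f, hf, hv⟩ := hv
  rw [rlForm_eq hm hα1 hf hv]
  exact integral_rlDeriv_inner_fracInt hα0 hα1 hf (ae_jumpMeasure_nonneg hm) hv hg

/-- The form is definite. -/
theorem ae_eq_zero_of_rlForm_self (h0 : rlForm α S v v ≤ 0) : ∀ᵐ t ∂(timeMeasure S), v t = 0 := by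
  have hvm := hv.memLp
  have h1 : fracSq α S v = 0 := by
    have e := fracSq_le_rlForm hm hα0 hα1 hv
    rwa [ENNReal.ofReal_of_nonpos (mul_nonpos_of_nonneg_of_nonpos (mul_pos
      (Real.Gamma_pos_of_pos hα0) (Real.Gamma_pos_of_pos (by linarith))).le h0), nonpos_iff_eq_zero]
      at e
  rw [fracSq, lintegral_eq_zero_iff' (aemeasurable_fracSq_integrand α hvm.1)] at h1
  have : (ae (volume.restrict (Ioi (0 : ℝ)))).NeBot := ae_neBot.2 (by simp)
  obtain ⟨l, h2, h3⟩ := (h1.and (ae_restrict_mem measurableSet_Ioi)).exists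
  have hl : 0 < l := h3
  have h4 : normSq S (highPass S l v) = 0 := by
    have e := ENNReal.ofReal_eq_zero.1 h2
    refine le_antisymm (nonpos_of_mul_nonpos_right e (Real.rpow_pos_of_pos hl _)) (normSq_nonneg _)
  have h5 : ∀ᵐ t ∂(timeMeasure S), highPass S l v t = 0 := by
    have e := (integral_eq_zero_iff_of_nonneg (fun t => by positivity)
      (integrable_normSq (memLp_highPass l hvm))).1 h4
    exact e.mono fun t ht => by simpa using ht
  filter_upwards [h5, ae_restrict_mem measurableSet_Ioc] with t ht htS
  have h6 : cv (timeMeasure S) (expK S l) v t = 0 := by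
    rw [cv_expK_eq_cv_highPass hl.le hvm htS,
      cv_congr_ae (w := 0) (h5.mono fun _ h => h) t]
    simp [cv]
  rwa [highPass, h6, smul_zero, sub_zero] at ht

end

theorem rlForm_sub_left (hm : IsMesh τ n S) (hα1 : α < 1) {v' : ℝ → H}
    (hv : IsPiecewiseAC τ n S v) (hv' : IsPiecewiseAC τ n S v') (hw : MemLp w ⊤ (timeMeasure S)) :
    rlForm α S (fun t => v t - v' t) w = rlForm α S v w - rlForm α S v' w := by
  rw [rlForm, rlForm, rlForm, ← integral_sub
    (integrable_inner_of_bounded (hv.integrable_rlDeriv hm hα1) hw)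
    (integrable_inner_of_bounded (hv'.integrable_rlDeriv hm hα1) hw)]
  exact integral_congr_ae ((rlDeriv_sub hm hα1 hv hv').2.mono fun t ht => by
    simp only [ht, inner_sub_left])

theorem rlForm_sub_right (hm : IsMesh τ n S) (hα1 : α < 1) {w' : ℝ → H}
    (hv : IsPiecewiseAC τ n S v) (hw : MemLp w ⊤ (timeMeasure S))
    (hw' : MemLp w' ⊤ (timeMeasure S)) :
    rlForm α S v (fun t => w t - w' t) = rlForm α S v w - rlForm α S v w' := by
  rw [rlForm, rlForm, rlForm, ← integral_sub
    (integrable_inner_of_bounded (hv.integrable_rlDeriv hm hα1) hw)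
    (integrable_inner_of_bounded (hv.integrable_rlDeriv hm hα1) hw')]
  simp only [inner_sub_right]

end Form

/-! ### The duality estimate -/

section Duality

variable {H : Type*} [NormedAddCommGroup H] [InnerProductSpace ℝ H] [CompleteSpace H]
variable {τ : ℕ → ℝ} {n : ℕ} {S α k : ℝ} {θ η X : ℝ → H}

/-- The constant in `normSq_le_of_dual`. -/
def dualConst (α : ℝ) : ℝ :=
  2 * ((1 - α)⁻¹ ^ 2 + 1) * (40 / α + 8 * fracConst α)
    * ((1 - α)⁻¹ / (Real.Gamma α * Real.Gamma (1 - α))) ^ 2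

theorem fracConst_nonneg (hα0 : 0 < α) (hα1 : α < 1) : 0 ≤ fracConst α := by
  have := Real.Gamma_pos_of_pos hα0
  have := Real.Gamma_pos_of_pos (show 0 < 1 + α by linarith)
  have : 0 < 1 - α := by linarith
  rw [fracConst]; positivity

/-- Let `X` solve the discrete dual problem with data `θ`, and let `Y` be the solution of the
continuous dual problem `rlForm v Y = ∫ ⟨v, θ⟩`. Then `rlForm η X = rlForm η (X - Y)`, and `X - Y`
is small of order `k ^ (α / 2)` since `X` is a quasi-optimal approximation of `Y`. -/
theorem normSq_le_of_dual (hα0 : 0 < α) (hα1 : α < 1) (hm : IsMesh τ n S) (hS : 0 < S)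
    (hk : 0 < k) (hmesh : ∀ j < n, τ (j + 1) - τ j ≤ k) (hθ : MemLp θ ⊤ (timeMeasure S))
    (hη : IsPiecewiseAC τ n S η) (hX : IsPiecewiseAC τ n S X)
    (hdual : ∀ c : ℕ → H, rlForm α S (fun t => X t - stepFun τ n c t) X
      = ∫ t, inner ℝ (X t - stepFun τ n c t) (θ t) ∂(timeMeasure S))
    (horth : ∫ t, inner ℝ (η t) (θ t) ∂(timeMeasure S) = 0)
    (hle : normSq S θ ≤ rlForm α S η X) {A : ℝ} (hA0 : 0 ≤ A)
    (hA : fracSq α S η ≤ ENNReal.ofReal A) :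
    normSq S θ ≤ dualConst α * k ^ α * A := by
  set γ := Real.Gamma α * Real.Gamma (1 - α) with hγd
  have hγ : 0 < γ := mul_pos (Real.Gamma_pos_of_pos hα0) (Real.Gamma_pos_of_pos (by linarith))
  set β := (1 - α)⁻¹ with hβd
  have hβ : 0 < β := inv_pos.2 (by linarith)
  have hFC := fracConst_nonneg hα0 hα1
  have hN := normSq_nonneg (S := S) θ
  have hkp := Real.rpow_nonneg hk.le α
  set Y := rev S (cv (timeMeasure S) (omK S α) (rev S θ)) with hYd
  have hYm : MemLp Y ⊤ (timeMeasure S) :=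
    memLp_rev (memLp_top_cv (integrable_omK hα0 S) (memLp_rev hθ))
  obtain ⟨c, hc⟩ := exists_step_fracSq_rev_le hα0 hα1 hm hS hk hmesh hθ
  set B := (40 / α + 8 * fracConst α) * k ^ α * normSq S θ with hBd
  have hB0 : 0 ≤ B := by positivity
  set W := stepFun τ n c with hWd
  have hW := isPiecewiseAC_stepFun hm c
  set ζ : ℝ → H := fun t => X t - W t with hζd
  have hζ : IsPiecewiseAC τ n S ζ := (rlDeriv_sub (α := α) hm hα1 hX hW).1
  have hYW : MemLp (fun t => Y t - W t) ⊤ (timeMeasure S) := hYm.sub hW.memLp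
  set q := γ * rlForm α S ζ ζ with hqd
  have hq0 : 0 ≤ q := mul_nonneg hγ.le (rlForm_self_nonneg hm hα0 hα1 hζ)
  -- quasi-optimality of `X`
  have h1 : rlForm α S ζ ζ = rlForm α S ζ (fun t => Y t - W t) := by
    rw [rlForm_sub_right hm hα1 hζ hYm hW.memLp, rlForm_fracInt hm hα0 hα1 hζ hθ, ← hdual c,
      ← rlForm_sub_right hm hα1 hζ hX.memLp hW.memLp]
  have h2 : q ≤ β * (√q * √B) := by
    have e := abs_rlForm_le hm hα0 hα1 hζ hYW hq0 hB0 (fracSq_le_rlForm hm hα0 hα1 hζ) hc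
    rw [← h1] at e
    exact (mul_le_mul_of_nonneg_left (le_abs_self _) hγ.le).trans e
  have h3 : q ≤ β ^ 2 * B := by
    have e1 := Real.sq_sqrt hq0
    have e2 := Real.sq_sqrt hB0
    have e3 := Real.sqrt_nonneg q
    have e4 := Real.sqrt_nonneg B
    nlinarith [sq_nonneg (√q - β * √B)]
  have h4 : fracSq α S (rev S fun t => X t - Y t) ≤ ENNReal.ofReal (2 * (β ^ 2 + 1) * B) := by
    have e1 : (rev S fun t => X t - Y t)
        = fun t => rev S ζ t + -(rev S (fun t => Y t - W t) t) := by
      ext t; simp only [rev, hζd]; abel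
    rw [e1]
    refine (fracSq_add_le (w := fun t => -(rev S (fun t => Y t - W t) t)) (memLp_rev hζ.memLp)
      (memLp_rev hYW).neg).trans ?_
    rw [fracSq_neg]
    calc _ ≤ ENNReal.ofReal 2 * ENNReal.ofReal (β ^ 2 * B) + ENNReal.ofReal 2 * ENNReal.ofReal B := by
          rw [ENNReal.ofReal_ofNat]
          gcongr
          exact (fracSq_rev_le_rlForm hm hα0 hα1 hζ).trans (ENNReal.ofReal_le_ofReal h3)
      _ = _ := by
          rw [← ENNReal.ofReal_mul zero_le_two, ← ENNReal.ofReal_mul zero_le_two,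
            ← ENNReal.ofReal_add (by positivity) (by positivity)]
          congr 1; ring
  have h5 : normSq S θ ≤ rlForm α S η (fun t => X t - Y t) := by
    rw [rlForm_sub_right hm hα1 hη hX.memLp hYm, rlForm_fracInt hm hα0 hα1 hη hθ, horth, sub_zero]
    exact hle
  have hB' : 0 ≤ 2 * (β ^ 2 + 1) * B := by positivity
  have h6 := abs_rlForm_le hm hα0 hα1 hη (hX.memLp.sub hYm) hA0 hB' hA h4
  have h7 : normSq S θ ≤ β / γ * (√A * √(2 * (β ^ 2 + 1) * B)) := by
    rw [div_mul_eq_mul_div, le_div_iff₀ hγ, mul_comm]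
    exact (mul_le_mul_of_nonneg_left (h5.trans (le_abs_self _)) hγ.le).trans h6
  have h8 : normSq S θ ^ 2 ≤ (β / γ) ^ 2 * (A * (2 * (β ^ 2 + 1) * B)) := by
    calc normSq S θ ^ 2 ≤ (β / γ * (√A * √(2 * (β ^ 2 + 1) * B))) ^ 2 := by gcongr
      _ = _ := by rw [mul_pow, mul_pow, Real.sq_sqrt hA0, Real.sq_sqrt hB']
  rcases hN.eq_or_lt with h0 | h0
  · rw [← h0, dualConst]
    have : 0 < 1 - α := by linarith
    positivity
  · refine le_of_mul_le_mul_right (le_of_eq_of_le (sq (normSq S θ)).symm (h8.trans_eq ?_)) h0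
    rw [hBd, dualConst]
    ring

end Duality

/-! ### Orthonormal piecewise polynomials in time -/

section Legendre

open Polynomial

/-- Orthonormal polynomials of degree at most `p` on `(0, 1]`, spanning the polynomials of degree at
most `p`. -/
theorem exists_orthonormal_polynomial (p : ℕ) : ∃ (d : ℕ) (ψ : Fin d → ℝ[X]),
    (∀ i, (ψ i).natDegree ≤ p) ∧
    (∀ i j, ∫ x in Ioc (0 : ℝ) 1, (ψ i).eval x * (ψ j).eval x = if i = j then 1 else 0) ∧
    ∀ q : ℝ[X], q.natDegree ≤ p → ∃ c : Fin d → ℝ, ∀ x, q.eval x = ∑ i, c i * (ψ i).eval x := by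
  let V := degreeLT ℝ (p + 1)
  have hint : ∀ q r : ℝ[X], IntegrableOn (fun x => q.eval x * r.eval x) (Ioc (0 : ℝ) 1) :=
    fun q r => ((q.continuous.mul r.continuous).integrableOn_Icc).mono_set Ioc_subset_Icc_self
  let core : InnerProductSpace.Core ℝ V :=
    { inner := fun q r => ∫ x in Ioc (0 : ℝ) 1, (q : ℝ[X]).eval x * (r : ℝ[X]).eval x
      conj_inner_symm := fun q r => by simp only [mul_comm, conj_trivial]
      re_inner_nonneg := fun q => by
        simpa using integral_nonneg (fun x => mul_self_nonneg ((q : ℝ[X]).eval x))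
      add_left := fun q r s => by
        simp only [Submodule.coe_add, eval_add, add_mul]
        exact integral_add (hint _ _) (hint _ _)
      smul_left := fun q r a => by
        simp only [Submodule.coe_smul, eval_smul, smul_eq_mul, mul_assoc, conj_trivial]
        exact integral_const_mul _ _
      definite := fun q hq => by
        have h1 := (integral_eq_zero_iff_of_nonneg (fun x => mul_self_nonneg ((q : ℝ[X]).eval x))
          (hint q q)).1 hq
        have h2 : ∀ x ∈ Ioo (0 : ℝ) 1, (q : ℝ[X]).eval x = 0 := by
          have h3 : (fun x => (q : ℝ[X]).eval x) =ᵐ[volume.restrict (Ioo (0 : ℝ) 1)] fun _ => 0 := by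
            filter_upwards [ae_restrict_of_ae_restrict_of_subset Ioo_subset_Ioc_self h1] with x hx
            simpa using hx
          exact Measure.eqOn_open_of_ae_eq h3 isOpen_Ioo (q : ℝ[X]).continuous.continuousOn
            continuousOn_const
        refine Subtype.ext (Polynomial.eq_zero_of_infinite_isRoot _ ?_)
        exact (Ioo_infinite zero_lt_one).mono fun x hx => h2 x hx }
  let : NormedAddCommGroup V := core.toNormedAddCommGroup
  let : InnerProductSpace ℝ V := InnerProductSpace.ofCore core.toCore
  let b := stdOrthonormalBasis ℝ V
  refine ⟨Module.finrank ℝ V, fun i => b i, fun i => ?_, fun i j => ?_, fun q hq => ?_⟩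
  · exact natDegree_le_iff_coeff_eq_zero.2 fun m hm =>
      (degree_lt_iff_coeff_zero _ _).1 (mem_degreeLT.1 (b i).2) m hm
  · exact (orthonormal_iff_ite.1 b.orthonormal) i j
  · have hqV : q ∈ V := Polynomial.mem_degreeLT.2 (lt_of_le_of_lt degree_le_natDegree
      (by exact_mod_cast Nat.lt_succ_of_le hq))
    refine ⟨fun i => b.repr ⟨q, hqV⟩ i, fun x => ?_⟩
    have h1 := congrArg (fun v : V => (v : ℝ[X]).eval x) (b.sum_repr ⟨q, hqV⟩)
    simp only [AddSubmonoidClass.coe_finsetSum, Submodule.coe_smul, eval_finsetSum, eval_smul,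
      smul_eq_mul] at h1
    exact h1.symm

end Legendre

section Basis

open Polynomial

variable {τ : ℕ → ℝ} {n d : ℕ} {S : ℝ}

/-- The polynomial `q` on `(0, 1]`, transplanted to `(a, b]` with the same `L²` norm and extended
by zero. -/
def pieceFn (a b : ℝ) (q : ℝ[X]) : ℝ → ℝ :=
  (Ioc a b).indicator fun t => (√(b - a))⁻¹ * q.eval ((t - a) / (b - a))

theorem integral_scaled {a b : ℝ} (hab : a < b) (q : ℝ[X]) :
    ∫ t in Ioc a b, (b - a)⁻¹ * q.eval ((t - a) / (b - a)) = ∫ x in Ioc (0 : ℝ) 1, q.eval x := by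
  have hk : b - a ≠ 0 := (sub_pos.2 hab).ne'
  rw [← intervalIntegral.integral_of_le hab.le, ← intervalIntegral.integral_of_le zero_le_one,
    intervalIntegral.integral_const_mul]
  have := intervalIntegral.integral_comp_div_sub (a := a) (b := b) (fun x => q.eval x) hk (a / (b - a))
  simp only [← sub_div, sub_self, div_self hk, smul_eq_mul] at this
  rw [this, inv_mul_cancel_left₀ hk]

theorem integral_pieceFn_mul {a b : ℝ} (hab : a < b) (q r : ℝ[X]) :
    ∫ t in Ioc a b, pieceFn a b q t * pieceFn a b r t
      = ∫ x in Ioc (0 : ℝ) 1, q.eval x * r.eval x := by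
  have hk : 0 < b - a := sub_pos.2 hab
  have h1 := integral_scaled hab (q * r)
  simp only [eval_mul] at h1
  rw [← h1]
  refine setIntegral_congr_fun measurableSet_Ioc fun t ht => ?_
  rw [pieceFn, pieceFn, indicator_of_mem ht, indicator_of_mem ht]
  have : (√(b - a))⁻¹ * (√(b - a))⁻¹ = (b - a)⁻¹ := by
    rw [← mul_inv, Real.mul_self_sqrt hk.le]
  rw [← this]; ring

theorem isPolyOn_pieceFn {F : Type*} [NormedAddCommGroup F] [NormedSpace ℝ F] {p : ℕ} {a b : ℝ}
    {q : ℝ[X]} (hq : q.natDegree ≤ p) (s : Set ℝ) (hs : s ⊆ Ioc a b ∨ Disjoint s (Ioc a b)) (x : F) :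
    IsPolyOn p s fun t => pieceFn a b q t • x := by
  rcases hs with hs | hs
  · let q' : ℝ[X] := C (√(b - a))⁻¹ * q.comp (C (b - a)⁻¹ * (X - C a))
    have hd : q'.natDegree < p + 1 := by
      refine Nat.lt_succ_of_le ((natDegree_C_mul_le _ _).trans (natDegree_comp_le.trans ?_))
      have : (C (b - a)⁻¹ * (X - C a)).natDegree ≤ 1 :=
        (natDegree_C_mul_le _ _).trans (natDegree_X_sub_C_le a)
      exact (Nat.mul_le_mul hq this).trans_eq (mul_one p)
    refine ⟨fun j => q'.coeff j • x, fun t ht => ?_⟩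
    have h1 : pieceFn a b q t = q'.eval t := by
      rw [pieceFn, indicator_of_mem (hs ht)]
      simp only [q', eval_mul, eval_C, eval_comp, eval_sub, eval_X]
      rw [div_eq_inv_mul]
    dsimp only
    rw [h1, eval_eq_sum_range' hd, Finset.sum_range, Finset.sum_smul]
    simp only [smul_smul, mul_comm]
  · refine ⟨0, fun t ht => ?_⟩
    dsimp only
    rw [pieceFn, indicator_of_notMem fun h => disjoint_left.1 hs ht h]
    simp

/-- A polynomial on `(a, b]` is a combination of transplanted basis polynomials. -/
theorem IsPolyOn.exists_pieceFn {F : Type*} [NormedAddCommGroup F] [NormedSpace ℝ F] {p : ℕ}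
    {a b : ℝ} (hab : a < b) {ψ : Fin d → ℝ[X]}
    (hψ : ∀ q : ℝ[X], q.natDegree ≤ p → ∃ c : Fin d → ℝ, ∀ x, q.eval x = ∑ i, c i * (ψ i).eval x)
    {v : ℝ → F} (hv : IsPolyOn p (Ioc a b) v) :
    ∃ c : Fin d → F, ∀ t ∈ Ioc a b, v t = ∑ i, pieceFn a b (ψ i) t • c i := by
  obtain ⟨e, he⟩ := hv
  have hk : 0 < b - a := sub_pos.2 hab
  have hs : √(b - a) ≠ 0 := (Real.sqrt_pos.2 hk).ne'
  have h1 : ∀ m : Fin (p + 1), ∃ c : Fin d → ℝ, ∀ x : ℝ,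
      (a + (b - a) * x) ^ (m : ℕ) = ∑ i, c i * (ψ i).eval x := by
    intro m
    obtain ⟨c, hc⟩ := hψ ((C a + C (b - a) * X) ^ (m : ℕ)) (by
      refine natDegree_pow_le.trans ?_
      have : (C a + C (b - a) * X : ℝ[X]).natDegree ≤ 1 := by
        rw [add_comm]; exact natDegree_linear_le
      exact (Nat.mul_le_mul (Nat.lt_succ_iff.1 m.2) this).trans_eq (mul_one p))
    exact ⟨c, fun x => by simpa using hc x⟩
  choose c hc using h1
  refine ⟨fun i => ∑ m, (√(b - a) * c m i) • e m, fun t ht => ?_⟩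
  rw [he t ht]
  simp only [Finset.smul_sum]
  rw [Finset.sum_comm]
  refine Finset.sum_congr rfl fun m _ => ?_
  have h2 := hc m ((t - a) / (b - a))
  rw [mul_div_cancel₀ _ hk.ne', add_sub_cancel] at h2
  rw [h2, Finset.sum_smul]
  refine Finset.sum_congr rfl fun i _ => ?_
  rw [pieceFn, indicator_of_mem ht, smul_smul]
  congr 1
  field_simp

/-- The orthonormal basis of the piecewise polynomials. -/
def meshFn (τ : ℕ → ℝ) (ψ : Fin d → ℝ[X]) (x : Fin n × Fin d) : ℝ → ℝ :=
  pieceFn (τ x.1) (τ (x.1 + 1)) (ψ x.2)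

theorem meshFn_of_mem (h : IsMesh τ n S) (ψ : Fin d → ℝ[X]) {i j : Fin n} (hij : i ≠ j) (l : Fin d)
    {t : ℝ} (ht : t ∈ Ioc (τ j) (τ (j + 1))) : meshFn τ ψ (i, l) t = 0 := by
  rw [meshFn, pieceFn]
  exact indicator_of_notMem (fun hti => hij (Fin.ext (h.eq_of_mem i.2 j.2 hti ht))) _

theorem sum_meshFn {F : Type*} [NormedAddCommGroup F] [NormedSpace ℝ F] (h : IsMesh τ n S)
    (ψ : Fin d → ℝ[X]) (c : Fin n × Fin d → F) (j : Fin n) {t : ℝ}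
    (ht : t ∈ Ioc (τ j) (τ (j + 1))) :
    ∑ x, meshFn τ ψ x t • c x = ∑ l, pieceFn (τ j) (τ (j + 1)) (ψ l) t • c (j, l) := by
  rw [Fintype.sum_prod_type, Finset.sum_eq_single_of_mem j (Finset.mem_univ j)]
  · rfl
  · intro i _ hij
    exact Finset.sum_eq_zero fun l _ => by rw [meshFn_of_mem h ψ hij l ht, zero_smul]

theorem exists_eq_sum_meshFn {F : Type*} [NormedAddCommGroup F] [NormedSpace ℝ F] {p : ℕ}
    (h : IsMesh τ n S) {ψ : Fin d → ℝ[X]}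
    (hψ : ∀ q : ℝ[X], q.natDegree ≤ p → ∃ c : Fin d → ℝ, ∀ x, q.eval x = ∑ i, c i * (ψ i).eval x)
    {v : ℝ → F} (hv : ∀ j < n, IsPolyOn p (Ioc (τ j) (τ (j + 1))) v) :
    ∃ c : Fin n × Fin d → F, ∀ t ∈ Ioc 0 S, v t = ∑ x, meshFn τ ψ x t • c x := by
  choose c hc using fun j : Fin n => IsPolyOn.exists_pieceFn (h.lt j j.2) hψ (hv j j.2)
  refine ⟨fun x => c x.1 x.2, fun t ht => ?_⟩
  obtain ⟨j, hj, hjt⟩ := h.exists_mem ht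
  rw [sum_meshFn h ψ _ ⟨j, hj⟩ hjt, hc ⟨j, hj⟩ t hjt]

theorem exists_bound_eval (q : ℝ[X]) : ∃ B : ℝ, 0 ≤ B ∧ ∀ x ∈ Icc (0 : ℝ) 1, |q.eval x| ≤ B := by
  obtain ⟨B, hB⟩ := isCompact_Icc.exists_bound_of_continuousOn (s := Icc (0 : ℝ) 1)
    q.continuous.continuousOn
  exact ⟨B, (norm_nonneg _).trans (hB 0 ⟨le_rfl, zero_le_one⟩), hB⟩

theorem scaled_mem {a b t : ℝ} (hab : a < b) (ht : t ∈ Ioc a b) :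
    (t - a) / (b - a) ∈ Icc (0 : ℝ) 1 :=
  ⟨div_nonneg (by linarith [ht.1]) (by linarith),
    (div_le_one (sub_pos.2 hab)).2 (by linarith [ht.2])⟩

theorem memLp_meshFn (h : IsMesh τ n S) (ψ : Fin d → ℝ[X]) (x : Fin n × Fin d) :
    MemLp (meshFn τ ψ x) ⊤ (timeMeasure S) := by
  obtain ⟨B, hB0, hB⟩ := exists_bound_eval (ψ x.2)
  refine memLp_top_of_bound (Measurable.aestronglyMeasurable (Measurable.indicator ?_
    measurableSet_Ioc)) ((√(τ (x.1 + 1) - τ x.1))⁻¹ * B) (ae_of_all _ fun t => ?_)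
  · exact ((ψ x.2).continuous.measurable.comp (by fun_prop)).const_mul _
  · rw [meshFn, pieceFn]
    by_cases ht : t ∈ Ioc (τ x.1) (τ (x.1 + 1))
    · rw [indicator_of_mem ht, norm_mul, norm_inv, Real.norm_of_nonneg (Real.sqrt_nonneg _)]
      exact mul_le_mul_of_nonneg_left (hB _ (scaled_mem (h.lt _ x.1.2) ht)) (by positivity)
    · rw [indicator_of_notMem ht, norm_zero]
      positivity

theorem integral_meshFn_mul (h : IsMesh τ n S) {ψ : Fin d → ℝ[X]}
    (hψ : ∀ i j, ∫ x in Ioc (0 : ℝ) 1, (ψ i).eval x * (ψ j).eval x = if i = j then 1 else 0)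
    (x y : Fin n × Fin d) :
    ∫ t, meshFn τ ψ x t * meshFn τ ψ y t ∂(timeMeasure S) = if x = y then 1 else 0 := by
  have h1 : ∫ t, meshFn τ ψ x t * meshFn τ ψ y t ∂(timeMeasure S)
      = ∫ t in Ioc (τ x.1) (τ (x.1 + 1)), meshFn τ ψ x t * meshFn τ ψ y t := by
    refine setIntegral_eq_of_subset_of_forall_sdiff_eq_zero measurableSet_Ioc (h.subset x.1.2) ?_
    intro t ht
    rw [meshFn, pieceFn, indicator_of_notMem ht.2, zero_mul]
  rw [h1]
  obtain ⟨i, l⟩ := x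
  obtain ⟨j, m⟩ := y
  by_cases hij : j = i
  · subst hij
    rw [show (if ((j, l) : Fin n × Fin d) = (j, m) then (1 : ℝ) else 0) = if l = m then 1 else 0 by
      simp, ← hψ l m]
    exact integral_pieceFn_mul (h.lt j j.2) _ _
  · rw [if_neg fun he => hij (congrArg Prod.fst he).symm]
    refine setIntegral_eq_zero_of_forall_eq_zero fun t ht => ?_
    rw [meshFn_of_mem h ψ hij m ht, mul_zero]

end Basis

section Pieces

variable {H : Type*} [NormedAddCommGroup H] [InnerProductSpace ℝ H] [CompleteSpace H]
variable {τ : ℕ → ℝ} {n : ℕ} {S : ℝ}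

theorem IsPiecewiseAC.of_offsets (h : IsMesh τ n S) (b : ℕ → H) {v f : ℝ → H}
    (hf : Integrable f (timeMeasure S))
    (hv : ∀ j < n, ∀ t ∈ Ioc (τ j) (τ (j + 1)), v t = b j + ∫ s in Ioc 0 t, f s) :
    IsPiecewiseAC τ n S v := by
  refine .of_jumps h (fun j => b j - if j = 0 then 0 else b (j - 1)) hf fun j hj t ht => ?_
  have h1 : ∀ j, ∑ i ∈ Finset.range (j + 1), (b i - if i = 0 then 0 else b (i - 1)) = b j := by
    intro j
    induction j with
    | zero => simp
    | succ j ih =>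
      rw [Finset.sum_range_succ, ih]
      simp
  rw [h1, hv j hj t ht]

theorem isPiecewiseAC_indicator (h : IsMesh τ n S) {j : ℕ} (hj : j < n) {P P' : ℝ → H}
    (hP : ∀ t, HasDerivAt P (P' t) t) (hc : Continuous P') :
    IsPiecewiseAC τ n S ((Ioc (τ j) (τ (j + 1))).indicator P) := by
  have hji := h.lt j hj
  have h0 := h.nonneg hj.le
  set f := (Ioc (τ j) (τ (j + 1))).indicator P' with hf
  have hfi : Integrable f (timeMeasure S) := by
    refine Integrable.restrict ((integrable_indicator_iff measurableSet_Ioc).2 ?_)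
    exact hc.integrableOn_Icc.mono_set Ioc_subset_Icc_self
  have hF : ∀ t, ∫ s in Ioc 0 t, f s = ∫ s in Ioc (τ j) (min t (τ (j + 1))), P' s := by
    intro t
    rw [hf, setIntegral_indicator measurableSet_Ioc, Ioc_inter_Ioc, max_eq_right h0]
  have hd : ∀ a b, a ≤ b → ∫ s in Ioc a b, P' s = P b - P a := by
    intro a b hab
    rw [← intervalIntegral.integral_of_le hab, intervalIntegral.integral_eq_sub_of_hasDerivAt
      (fun t _ => hP t) (hc.intervalIntegrable _ _)]
  refine .of_offsets h (fun i => if i < j then 0 else if i = j then P (τ j) else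
    P (τ j) - P (τ (j + 1))) hfi fun i hi t ht => ?_
  rw [hF]
  rcases lt_trichotomy i j with hij | hij | hij
  · have h1 := h.le (show i + 1 ≤ j from hij) hj.le
    rw [if_pos hij, indicator_of_notMem fun h' => by linarith [h'.1, ht.2], Ioc_eq_empty, zero_add,
      Measure.restrict_empty, integral_zero_measure]
    exact fun h' => by linarith [min_le_left t (τ (j + 1)), ht.2]
  · subst hij
    rw [if_neg (lt_irrefl _), if_pos rfl, indicator_of_mem ht, min_eq_left ht.2, hd _ _ ht.1.le]
    abel
  · have h1 := h.le (show j + 1 ≤ i from hij) hi.le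
    rw [if_neg hij.not_gt, if_neg hij.ne', indicator_of_notMem fun h' => by linarith [h'.2, ht.1],
      min_eq_right (by linarith [ht.1]), hd _ _ hji.le]
    abel

open Polynomial in
theorem isPiecewiseAC_meshFn {d : ℕ} (h : IsMesh τ n S) (ψ : Fin d → ℝ[X]) (x : Fin n × Fin d) :
    IsPiecewiseAC τ n S (meshFn τ ψ x) := by
  set a := τ x.1
  set b := τ (x.1 + 1)
  refine isPiecewiseAC_indicator h x.1.2
    (P' := fun t => (√(b - a))⁻¹ * ((derivative (ψ x.2)).eval ((t - a) / (b - a)) * (1 / (b - a))))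
    (fun t => ?_) ?_
  · have h1 : HasDerivAt (fun t => (t - a) / (b - a)) (1 / (b - a)) t :=
      ((hasDerivAt_id t).sub_const a).div_const (b - a)
    exact (((ψ x.2).hasDerivAt ((t - a) / (b - a))).comp t h1).const_mul _
  · have := (derivative (ψ x.2)).continuous
    fun_prop

end Pieces

/-! ### Error of the projection method -/

section Galerkin

variable {τ : ℕ → ℝ} {n : ℕ} {S α k : ℝ}
variable {ι : Type*} [Fintype ι] {φ : ι → ℝ → ℝ}

section

variable {H : Type*} [NormedAddCommGroup H] [InnerProductSpace ℝ H] [CompleteSpace H]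

theorem IsPiecewiseAC.congr {v v' : ℝ → H} (hv : IsPiecewiseAC τ n S v)
    (h : v =ᵐ[timeMeasure S] v') : IsPiecewiseAC τ n S v' := by
  obtain ⟨f, hf, hv⟩ := hv
  refine ⟨f, hf, ?_⟩
  filter_upwards [hv, h] with t h1 h2
  rw [← h2, h1]

theorem rlForm_congr {v v' : ℝ → H} (hm : IsMesh τ n S) (hα1 : α < 1)
    (hv : IsPiecewiseAC τ n S v) (h : v =ᵐ[timeMeasure S] v') (w : ℝ → H) :
    rlForm α S v w = rlForm α S v' w := by
  obtain ⟨f, hf, hv⟩ := hv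
  rw [rlForm_eq hm hα1 hf hv, rlForm_eq hm hα1 hf]
  filter_upwards [hv, h] with t h1 h2
  rw [← h2, h1]

theorem memLp_sum_smul {s : Finset ι} (hφ : ∀ i, MemLp (φ i) ⊤ (timeMeasure S)) (c : ι → H) :
    MemLp (fun t => ∑ i ∈ s, φ i t • c i) ⊤ (timeMeasure S) := by
  refine memLp_finsetSum s fun i _ => ?_
  obtain ⟨M, hM, hb⟩ := exists_bound_of_memLp_top (hφ i)
  refine memLp_top_of_bound ((hφ i).1.smul_const _) (M * ‖c i‖) (hb.mono fun t ht => ?_)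
  rw [norm_smul]
  gcongr

theorem integral_inner_sum_smul {e : ℝ → H} (hφ : ∀ i, MemLp (φ i) ⊤ (timeMeasure S))
    (he : MemLp e ⊤ (timeMeasure S)) (x : ι → H) :
    ∫ t, inner ℝ (e t) (∑ i, φ i t • x i) ∂(timeMeasure S)
      = ∑ i, inner ℝ (∫ t, φ i t • e t ∂(timeMeasure S)) (x i) := by
  have h1 : ∀ i, Integrable (fun t => φ i t • e t) (timeMeasure S) := fun i => by
    obtain ⟨M, hM, hb⟩ := exists_bound_of_memLp_top he
    exact (integrable_of_memLp_top (hφ i)).smul_bdd M he.1 hb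
  simp only [inner_sum]
  rw [integral_finsetSum]
  · refine Finset.sum_congr rfl fun i _ => ?_
    rw [real_inner_comm, ← integral_inner (h1 i)]
    simp only [inner_smul_right, real_inner_comm]
  · intro i _
    have := (h1 i).inner_const (𝕜 := ℝ) (x i)
    simpa only [inner_smul_left, inner_smul_right, RCLike.conj_to_real] using this

variable [DecidableEq ι]

theorem integral_smul_sum_smul (hφ : ∀ i, MemLp (φ i) ⊤ (timeMeasure S))
    (hon : ∀ i j, ∫ t, φ i t * φ j t ∂(timeMeasure S) = if i = j then 1 else 0) (x : ι → H) (i : ι) :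
    ∫ t, φ i t • ∑ j, φ j t • x j ∂(timeMeasure S) = x i := by
  have h1 : ∀ i j, Integrable (fun t => φ i t * φ j t) (timeMeasure S) := fun i j => by
    have := integrable_inner_of_bounded (integrable_of_memLp_top (hφ j)) (hφ i)
    simpa using this
  simp only [Finset.smul_sum, smul_smul]
  rw [integral_finsetSum _ fun j _ => (h1 i j).smul_const (x j)]
  simp only [integral_smul_const, hon, ite_smul, one_smul, zero_smul]
  simp

theorem integral_inner_orthonormal (hφ : ∀ i, MemLp (φ i) ⊤ (timeMeasure S))
    (hon : ∀ i j, ∫ t, φ i t * φ j t ∂(timeMeasure S) = if i = j then 1 else 0) (w x : ι → H) :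
    ∫ t, inner ℝ (∑ i, φ i t • w i) (∑ i, φ i t • x i) ∂(timeMeasure S)
      = ∑ i, inner ℝ (w i) (x i) := by
  rw [integral_inner_sum_smul hφ (memLp_sum_smul hφ w)]
  simp only [integral_smul_sum_smul hφ hon]

theorem rlForm_sum_smul (hm : IsMesh τ n S) (hα1 : α < 1) (hφ : ∀ i, IsPiecewiseAC τ n S (φ i))
    (w x : ι → H) :
    rlForm α S (fun t => ∑ i, φ i t • w i) (fun t => ∑ j, φ j t • x j)
      = ∑ i, ∑ j, rlForm α S (φ i) (φ j) * inner ℝ (w i) (x j) := by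
  have h1 := (rlDeriv_sum_smul hm hα1 Finset.univ (fun i _ => hφ i) w).2
  have h2 : rlForm α S (fun t => ∑ i, φ i t • w i) (fun t => ∑ j, φ j t • x j)
      = ∫ t, ∑ i, ∑ j, inner ℝ (rlDeriv α (φ i) t) (φ j t) * inner ℝ (w i) (x j)
        ∂(timeMeasure S) := by
    refine integral_congr_ae (h1.mono fun t ht => ?_)
    dsimp only
    rw [ht, sum_inner]
    refine Finset.sum_congr rfl fun i _ => ?_
    rw [inner_sum]
    refine Finset.sum_congr rfl fun j _ => ?_
    rw [inner_smul_left, inner_smul_right]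
    simp only [RCLike.inner_apply, conj_trivial]
    ring
  have h3 : ∀ i j, Integrable (fun t => inner ℝ (rlDeriv α (φ i) t) (φ j t) * inner ℝ (w i) (x j))
      (timeMeasure S) := fun i j => (integrable_inner_of_bounded
    ((hφ i).integrable_rlDeriv hm hα1) (hφ j).memLp).mul_const _
  rw [h2, integral_finsetSum _ fun i _ => integrable_finsetSum _ fun j _ => h3 i j]
  refine Finset.sum_congr rfl fun i _ => ?_
  rw [integral_finsetSum _ fun j _ => h3 i j]
  refine Finset.sum_congr rfl fun j _ => ?_
  rw [integral_mul_const, rlForm]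

/-- The discrete dual problem is solvable, since the form is definite. -/
theorem exists_dual_coeff (hm : IsMesh τ n S) (hα0 : 0 < α) (hα1 : α < 1)
    (hφ : ∀ i, IsPiecewiseAC τ n S (φ i))
    (hon : ∀ i j, ∫ t, φ i t * φ j t ∂(timeMeasure S) = if i = j then 1 else 0)
    {F : Type*} [AddCommGroup F] [Module ℝ F] (θ : ι → F) :
    ∃ x : ι → F, ∀ i, ∑ j, rlForm α S (φ i) (φ j) • x j = θ i := by
  set A : Matrix ι ι ℝ := Matrix.of fun i j => rlForm α S (φ i) (φ j) with hA
  have hdet : A.det ≠ 0 := by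
    intro h0
    obtain ⟨y, hy0, hy⟩ := Matrix.exists_mulVec_eq_zero_iff.2 h0
    refine hy0 (funext fun i => ?_)
    have h1 := rlForm_sum_smul hm hα1 hφ y y
    have h2 : rlForm α S (fun t => ∑ i, φ i t • y i) (fun t => ∑ i, φ i t • y i) = 0 := by
      rw [h1]
      refine Finset.sum_eq_zero fun i _ => ?_
      have := congrFun hy i
      simp only [hA, Matrix.mulVec, dotProduct, Matrix.of_apply, Pi.zero_apply] at this
      simp only [RCLike.inner_apply, conj_trivial]
      calc _ = (∑ j, rlForm α S (φ i) (φ j) * y j) * y i := by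
            rw [Finset.sum_mul]
            exact Finset.sum_congr rfl fun j _ => by ring
        _ = 0 := by rw [this, zero_mul]
    have h3 := ae_eq_zero_of_rlForm_self hm hα0 hα1
      (rlDeriv_sum_smul (α := α) hm hα1 Finset.univ (fun i _ => hφ i) y).1 h2.le
    rw [← integral_smul_sum_smul (fun i => (hφ i).memLp) hon y i]
    refine integral_eq_zero_of_ae (h3.mono fun t ht => ?_)
    simp only [ht, smul_zero]
    rfl
  refine ⟨fun j => ∑ l, A⁻¹ j l • θ l, fun i => ?_⟩
  have h1 : A * A⁻¹ = 1 := Matrix.mul_nonsing_inv A (isUnit_iff_ne_zero.2 hdet)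
  calc ∑ j, rlForm α S (φ i) (φ j) • ∑ l, A⁻¹ j l • θ l
      = ∑ l, (A * A⁻¹) i l • θ l := by
        simp only [Finset.smul_sum, Matrix.mul_apply, Finset.sum_smul, smul_smul]
        rw [Finset.sum_comm]
        rfl
    _ = θ i := by rw [h1]; simp [Matrix.one_apply]

end

variable [DecidableEq ι]
variable {F H H' : Type*} [NormedAddCommGroup F] [InnerProductSpace ℝ F] [CompleteSpace F]
  [NormedAddCommGroup H] [InnerProductSpace ℝ H] [CompleteSpace H]
  [NormedAddCommGroup H'] [InnerProductSpace ℝ H'] [CompleteSpace H']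

theorem integral_inner_projection_error (hφ : ∀ i, MemLp (φ i) ⊤ (timeMeasure S))
    (hon : ∀ i j, ∫ t, φ i t * φ j t ∂(timeMeasure S) = if i = j then 1 else 0)
    {u : ℝ → F} (hu : MemLp u ⊤ (timeMeasure S)) (T : F →L[ℝ] H) (y : ι → H) :
    ∫ t, inner ℝ (T (u t) - ∑ i, φ i t • T (∫ s, φ i s • u s ∂(timeMeasure S)))
      (∑ i, φ i t • y i) ∂(timeMeasure S) = 0 := by
  have hint : ∀ i, Integrable (fun t => φ i t • u t) (timeMeasure S) := fun i => by
    obtain ⟨M, hM, hb⟩ := exists_bound_of_memLp_top hu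
    exact (integrable_of_memLp_top (hφ i)).smul_bdd M hu.1 hb
  set a : ι → F := fun i => ∫ s, φ i s • u s ∂(timeMeasure S) with ha
  have hTu : MemLp (fun t => T (u t)) ⊤ (timeMeasure S) := T.comp_memLp' hu
  have h2 : ∀ i, ∫ t, φ i t • T (u t) ∂(timeMeasure S) = T (a i) := fun i => by
    rw [ha, ← T.integral_comp_comm (hint i)]
    simp only [map_smul]
  have h3 : ∀ i, Integrable (fun t => φ i t • T (u t)) (timeMeasure S) := fun i => by
    simpa only [map_smul] using T.integrable_comp (hint i)
  have h4 : ∀ i, Integrable (fun t => φ i t • ∑ j, φ j t • T (a j)) (timeMeasure S) := fun i => by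
    have hs := memLp_sum_smul (s := Finset.univ) hφ fun j => T (a j)
    obtain ⟨M, hM, hb⟩ := exists_bound_of_memLp_top hs
    exact (integrable_of_memLp_top (hφ i)).smul_bdd M hs.1 hb
  refine (integral_inner_sum_smul (e := fun t => T (u t) - ∑ i, φ i t • T (a i)) hφ
    (hTu.sub (memLp_sum_smul hφ fun i => T (a i))) y).trans ?_
  refine Finset.sum_eq_zero fun i _ => ?_
  simp only [smul_sub]
  rw [integral_sub (h3 i) (h4 i), h2, integral_smul_sum_smul hφ hon (fun i => T (a i)) i, sub_self,
    inner_zero_left]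

/-- The error of a Galerkin method in time with an orthonormal basis `φ` is bounded by the error
`u - Π u` of the `L²` projection, measured in the fractional seminorm. The elliptic part of the form
does not enter, because it vanishes on `u - Π u` and is nonnegative on the discrete part. -/
theorem normSq_galerkin_error_le (hα0 : 0 < α) (hα1 : α < 1) (hm : IsMesh τ n S) (hS : 0 < S)
    (hk : 0 < k) (hmesh : ∀ j < n, τ (j + 1) - τ j ≤ k) (L : F →L[ℝ] H) (G : F →L[ℝ] H')
    (hφ : ∀ i, IsPiecewiseAC τ n S (φ i))
    (hon : ∀ i j, ∫ t, φ i t * φ j t ∂(timeMeasure S) = if i = j then 1 else 0)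
    (hstep : ∀ c : ℕ → H, ∃ w : ι → H, ∀ t ∈ Ioc 0 S, stepFun τ n c t = ∑ i, φ i t • w i)
    {U u : ℝ → F} {b : ι → F} (hu : MemLp u ⊤ (timeMeasure S))
    (hU : ∀ t ∈ Ioc 0 S, U t = ∑ i, φ i t • b i)
    (hLu : IsPiecewiseAC τ n S fun t => L (u t))
    (hgal : ∀ x : ι → F, rlForm α S (fun t => L (U t) - L (u t)) (fun t => ∑ i, φ i t • L (x i))
      + ∫ t, inner ℝ (G (U t) - G (u t)) (∑ i, φ i t • G (x i)) ∂(timeMeasure S) = 0)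
    {η : ℝ → H} (hη : ∀ t ∈ Ioc 0 S,
      η t = L (u t) - ∑ i, φ i t • L (∫ s, φ i s • u s ∂(timeMeasure S)))
    {A : ℝ} (hA0 : 0 ≤ A) (hA : fracSq α S η ≤ ENNReal.ofReal A) :
    MemLp (fun t => L (U t) - L (u t)) ⊤ (timeMeasure S) ∧
    normSq S (fun t => L (U t) - L (u t)) ≤ 2 * (dualConst α * k ^ α * A) + 2 * normSq S η := by
  have hφm : ∀ i, MemLp (φ i) ⊤ (timeMeasure S) := fun i => (hφ i).memLp
  set a : ι → F := fun i => ∫ s, φ i s • u s ∂(timeMeasure S) with ha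
  have hmem : ∀ {p : ℝ → Prop}, (∀ t ∈ Ioc 0 S, p t) → ∀ᵐ t ∂(timeMeasure S), p t := fun h =>
    (ae_restrict_mem measurableSet_Ioc).mono h
  have hsum : ∀ c : ι → H, IsPiecewiseAC τ n S (fun t => ∑ i, φ i t • c i) := fun c =>
    (rlDeriv_sum_smul (α := α) hm hα1 Finset.univ (fun i _ => hφ i) c).1
  set θc : ι → F := fun i => b i - a i with hθc
  obtain ⟨x, hx⟩ := exists_dual_coeff hm hα0 hα1 hφ hon θc
  set θ : ℝ → H := fun t => ∑ i, φ i t • L (θc i) with hθ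
  set X : ℝ → H := fun t => ∑ i, φ i t • L (x i) with hX
  have hxL : ∀ i, ∑ j, rlForm α S (φ i) (φ j) • L (x j) = L (θc i) := fun i => by
    rw [← hx i, map_sum]
    simp only [map_smul]
  have hxG : ∀ i, ∑ j, rlForm α S (φ i) (φ j) • G (x j) = G (θc i) := fun i => by
    rw [← hx i, map_sum]
    simp only [map_smul]
  have hform : ∀ w : ι → H, rlForm α S (fun t => ∑ i, φ i t • w i) X
      = ∑ i, inner ℝ (w i) (L (θc i)) := by
    intro w
    rw [hX, rlForm_sum_smul hm hα1 hφ]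
    refine Finset.sum_congr rfl fun i _ => ?_
    rw [← hxL i, inner_sum]
    simp only [inner_smul_right]
  -- the projection error
  have hηae : ∀ᵐ t ∂(timeMeasure S), L (u t) - ∑ i, φ i t • L (a i) = η t :=
    hmem fun t ht => (hη t ht).symm
  have hηP : IsPiecewiseAC τ n S η :=
    (rlDeriv_sub (α := α) hm hα1 hLu (hsum fun i => L (a i))).1.congr hηae
  have hdiff : ∀ t ∈ Ioc 0 S, θ t - η t = L (U t) - L (u t) := by
    intro t ht
    rw [hη t ht, hU t ht, map_sum]
    simp only [hθ, hθc, map_sub, map_smul, smul_sub, Finset.sum_sub_distrib]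
    abel
  have horth : ∫ t, inner ℝ (η t) (θ t) ∂(timeMeasure S) = 0 := by
    rw [← integral_inner_projection_error hφm hon hu L fun i => L (θc i)]
    exact integral_congr_ae (hηae.mono fun t ht => by simp only [← ht]; rfl)
  have hGpos : 0 ≤ ∫ t, inner ℝ (G (U t) - G (u t)) (∑ i, φ i t • G (x i)) ∂(timeMeasure S) := by
    have hGX : IsPiecewiseAC τ n S (fun t => ∑ i, φ i t • G (x i)) :=
      (rlDeriv_sum_smul (α := α) hm hα1 Finset.univ (fun i _ => hφ i) _).1
    have hGum : MemLp (fun t => G (u t)) ⊤ (timeMeasure S) := G.comp_memLp' hu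
    have h1 : ∫ t, inner ℝ (G (U t) - G (u t)) (∑ i, φ i t • G (x i)) ∂(timeMeasure S)
        = ∫ t, inner ℝ (∑ i, φ i t • G (θc i)) (∑ i, φ i t • G (x i)) ∂(timeMeasure S)
          - ∫ t, inner ℝ (G (u t) - ∑ i, φ i t • G (a i)) (∑ i, φ i t • G (x i))
            ∂(timeMeasure S) := by
      rw [← integral_sub]
      · refine integral_congr_ae (hmem fun t ht => ?_)
        dsimp only
        rw [← inner_sub_left, hU t ht, map_sum]
        congr 1
        simp only [hθc, map_sub, map_smul, smul_sub, Finset.sum_sub_distrib]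
        abel
      · exact integrable_inner_of_bounded (integrable_of_memLp_top (memLp_sum_smul hφm _)) hGX.memLp
      · exact integrable_inner_of_bounded
          (integrable_of_memLp_top (hGum.sub (memLp_sum_smul hφm _))) hGX.memLp
    rw [h1, integral_inner_projection_error hφm hon hu G, sub_zero, integral_inner_orthonormal hφm hon]
    have h2 := rlForm_self_nonneg hm hα0 hα1 hGX
    rw [rlForm_sum_smul hm hα1 hφ] at h2
    refine h2.trans_eq (Finset.sum_congr rfl fun i _ => ?_)
    rw [← hxG i, sum_inner]
    refine Finset.sum_congr rfl fun j _ => ?_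
    rw [inner_smul_left, real_inner_comm]
    rfl
  have hθsq : rlForm α S θ X = normSq S θ := by
    rw [hθ, hform, normSq]
    simp only [← real_inner_self_eq_norm_sq]
    exact (integral_inner_orthonormal hφm hon _ _).symm
  have hle : normSq S θ ≤ rlForm α S η X := by
    have h1 := hgal x
    have h2 : rlForm α S (fun t => L (U t) - L (u t)) X = rlForm α S θ X - rlForm α S η X := by
      rw [← rlForm_sub_left hm hα1 (hsum _) hηP (hsum _).memLp]
      exact (rlForm_congr hm hα1 (rlDeriv_sub (α := α) hm hα1 (hsum _) hηP).1 (hmem hdiff) _).symm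
    rw [h2, hθsq] at h1
    linarith
  have hθm : MemLp θ ⊤ (timeMeasure S) := (hsum _).memLp
  have hmain := normSq_le_of_dual hα0 hα1 hm hS hk hmesh hθm hηP (hsum fun i => L (x i))
    (fun c => by
      obtain ⟨w, hw⟩ := hstep c
      have h1 : ∀ᵐ t ∂(timeMeasure S), ∑ i, φ i t • (L (x i) - w i) = X t - stepFun τ n c t :=
        hmem fun t ht => by
          rw [hw t ht]
          simp only [hX, smul_sub, Finset.sum_sub_distrib]
      rw [← rlForm_congr hm hα1 (hsum _) h1, hform,
        ← integral_inner_orthonormal hφm hon]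
      exact integral_congr_ae (h1.mono fun t ht => by simp only [ht]; rfl)) horth hle hA0 hA
  have hd : (fun t => θ t + -η t) =ᵐ[timeMeasure S] fun t => L (U t) - L (u t) :=
    hmem fun t ht => by simp only [← hdiff t ht, sub_eq_add_neg]
  refine ⟨(hθm.add hηP.memLp.neg).ae_eq hd, ?_⟩
  have h1 := normSq_add_le hθm hηP.memLp.neg
  have h2 : normSq S (fun t => θ t + -η t) = normSq S (fun t => L (U t) - L (u t)) :=
    integral_congr_ae (hd.mono fun t ht => by simp only [← ht])
  have h3 : normSq S (-η) = normSq S η := by simp [normSq]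
  rw [h3] at h1
  rw [← h2]
  exact h1.trans (by linarith)

end Galerkin

/-! ### Taylor polynomials at the right endpoint of an interval -/

section Taylor

variable {H : Type*} [NormedAddCommGroup H] [InnerProductSpace ℝ H] [CompleteSpace H]

/-- The Taylor polynomial at `b`, of degree `m`, of a function with the derivatives `D`. -/
def taylorAt (b : ℝ) (m : ℕ) (D : ℕ → ℝ → H) (t : ℝ) : H :=
  ∑ i ∈ Finset.range (m + 1), ((t - b) ^ i / (i.factorial : ℝ)) • D i b

theorem taylorAt_self (b : ℝ) (m : ℕ) (D : ℕ → ℝ → H) : taylorAt b m D b = D 0 b := by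
  rw [taylorAt, Finset.sum_range_succ']
  simp

theorem hasDerivAt_taylorAt (b : ℝ) (m : ℕ) (D : ℕ → ℝ → H) (t : ℝ) :
    HasDerivAt (taylorAt b (m + 1) D) (taylorAt b m (fun l => D (l + 1)) t) t := by
  have h1 : taylorAt b (m + 1) D = fun t => (∑ i ∈ Finset.range (m + 1),
      ((t - b) ^ (i + 1) / ((i + 1).factorial : ℝ)) • D (i + 1) b) + D 0 b := by
    ext t
    rw [taylorAt, Finset.sum_range_succ']
    simp
  rw [h1]
  refine HasDerivAt.add_const _ (HasDerivAt.fun_sum fun i _ => ?_)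
  refine HasDerivAt.smul_const ?_ _
  have h2 := (((hasDerivAt_id t).sub_const b).pow (i + 1)).div_const ((i + 1).factorial : ℝ)
  refine h2.congr_deriv ?_
  have h3 : ((i.factorial : ℕ) : ℝ) ≠ 0 := by positivity
  rw [Nat.factorial_succ]
  push_cast
  field_simp
  simp

theorem hasDerivAt_taylorAt_zero (b : ℝ) (D : ℕ → ℝ → H) (t : ℝ) :
    HasDerivAt (taylorAt b 0 D) 0 t := by
  have : taylorAt b 0 D = fun _ => D 0 b := by ext t; simp [taylorAt]
  rw [this]
  exact hasDerivAt_const t _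

open Polynomial in
theorem isPolyOn_taylorAt {p m : ℕ} (hm : m ≤ p) (b : ℝ) (D : ℕ → ℝ → H) (s : Set ℝ) :
    IsPolyOn p s (taylorAt b m D) := by
  refine ⟨fun j => ∑ i ∈ Finset.range (m + 1),
    (((X - C b) ^ i : ℝ[X]).coeff j / (i.factorial : ℝ)) • D i b, fun t _ => ?_⟩
  simp only [Finset.smul_sum]
  rw [taylorAt, Finset.sum_comm]
  refine Finset.sum_congr rfl fun i hi => ?_
  have h1 : ((X - C b) ^ i : ℝ[X]).natDegree < p + 1 := by
    rw [natDegree_pow, natDegree_X_sub_C]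
    have := Finset.mem_range.1 hi
    omega
  have h2 : (t - b) ^ i = ((X - C b) ^ i : ℝ[X]).eval t := by simp
  rw [h2, eval_eq_sum_range' h1, Finset.sum_range, Finset.sum_div, Finset.sum_smul]
  refine Finset.sum_congr rfl fun j _ => ?_
  rw [smul_smul]
  congr 1
  ring

variable {a b I : ℝ}

theorem sub_eq_integral_of_hasDerivWithinAt {f f' : ℝ → H}
    (hf : ∀ t ∈ Ioc a b, HasDerivWithinAt f (f' t) (Ioc a b) t)
    (hi : IntegrableOn f' (Ioc a b)) {s t : ℝ} (hs : a < s) (hst : s ≤ t) (ht : t ≤ b) :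
    f t - f s = ∫ x in Ioc s t, f' x := by
  rw [← intervalIntegral.integral_of_le hst,
    intervalIntegral.integral_eq_sub_of_hasDerivAt_of_le hst]
  · exact fun x hx => ((hf x ⟨hs.trans_le hx.1, hx.2.trans ht⟩).mono
      (fun y hy => ⟨hs.trans_le hy.1, hy.2.trans ht⟩)).continuousWithinAt
  · exact fun x hx => (hf x ⟨hs.trans hx.1, hx.2.le.trans ht⟩).hasDerivAt
      (Ioc_mem_nhds (hs.trans hx.1) (hx.2.trans_le ht))
  · exact (intervalIntegrable_iff_integrableOn_Ioc_of_le hst).2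
      (hi.mono_set (Ioc_subset_Ioc hs.le ht))

theorem norm_sub_taylorAt_le (hab : a < b) (m : ℕ) (D : ℕ → ℝ → H)
    (hD : ∀ l ≤ m, ∀ t ∈ Ioc a b, HasDerivWithinAt (D l) (D (l + 1) t) (Ioc a b) t)
    (hi : IntegrableOn (D (m + 1)) (Ioc a b)) (hI : ∫ t in Ioc a b, ‖D (m + 1) t‖ ≤ I) {t : ℝ}
    (ht : t ∈ Ioc a b) : ‖D 0 t - taylorAt b m D t‖ ≤ (b - a) ^ m * I := by
  have hI0 : 0 ≤ I := (integral_nonneg fun _ => norm_nonneg _).trans hI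
  induction m generalizing D t with
  | zero =>
    have h1 : taylorAt b 0 D t = D 0 b := by simp [taylorAt]
    rw [pow_zero, one_mul, h1, norm_sub_rev,
      sub_eq_integral_of_hasDerivWithinAt (hD 0 le_rfl) hi ht.1 ht.2 le_rfl]
    exact (norm_integral_le_integral_norm _).trans ((setIntegral_mono_set hi.norm
      (ae_of_all _ fun _ => norm_nonneg _)
      (LE.le.eventuallyLE (Ioc_subset_Ioc_left ht.1.le))).trans hI)
  | succ m ih =>
    have h1 : ∀ s ∈ Ioc a b, ‖D 1 s - taylorAt b m (fun l => D (l + 1)) s‖ ≤ (b - a) ^ m * I :=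
      fun s hs => ih (fun l => D (l + 1)) (fun l hl => hD (l + 1) (by omega)) hi hI hs
    have h2 := Convex.norm_image_sub_le_of_norm_hasDerivWithin_le
      (f := fun s => D 0 s - taylorAt b (m + 1) D s)
      (fun s hs => (hD 0 (Nat.zero_le _) s hs).sub (hasDerivAt_taylorAt b m D s).hasDerivWithinAt)
      h1 (convex_Ioc a b) (right_mem_Ioc.2 hab) ht
    simp only [taylorAt_self, sub_self, sub_zero] at h2
    refine h2.trans ?_
    have h3 : ‖t - b‖ ≤ b - a := by
      rw [Real.norm_eq_abs, abs_le]
      constructor <;> linarith [ht.1, ht.2]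
    have h4 : 0 ≤ (b - a) ^ m * I := mul_nonneg (pow_nonneg (by linarith) _) hI0
    calc _ ≤ (b - a) ^ m * I * (b - a) := mul_le_mul_of_nonneg_left h3 h4
      _ = _ := by ring

/-- A polynomial of degree `m` that approximates a function and its derivative, with error bounds
that only use the integral of the derivative of order `m + 1`. -/
theorem exists_poly_approx {p : ℕ} (hab : a < b) (m : ℕ) (hmp : m ≤ p) (D : ℕ → ℝ → H)
    (hD : ∀ l ≤ m, ∀ t ∈ Ioc a b, HasDerivWithinAt (D l) (D (l + 1) t) (Ioc a b) t)
    (hi : IntegrableOn (D (m + 1)) (Ioc a b)) (hI : ∫ t in Ioc a b, ‖D (m + 1) t‖ ≤ I) :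
    ∃ q q' : ℝ → H, IsPolyOn p (Ioc a b) q ∧ (∀ t, HasDerivAt q (q' t) t) ∧ Continuous q' ∧
      (∀ t ∈ Ioc a b, ‖D 0 t - q t‖ ≤ (b - a) ^ m * I) ∧
      ∫ t in Ioc a b, ‖D 1 t - q' t‖ ≤ (b - a) ^ m * I := by
  rcases m with _ | m
  · refine ⟨taylorAt b 0 D, 0, isPolyOn_taylorAt hmp b D _, hasDerivAt_taylorAt_zero b D,
      continuous_const, fun t ht => norm_sub_taylorAt_le hab 0 D hD hi hI ht, ?_⟩
    simpa using hI
  · refine ⟨taylorAt b (m + 1) D, taylorAt b m (fun l => D (l + 1)), isPolyOn_taylorAt hmp b D _,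
      hasDerivAt_taylorAt b m D, ?_,
      fun t ht => norm_sub_taylorAt_le hab (m + 1) D hD hi hI ht, ?_⟩
    · unfold taylorAt
      fun_prop
    · have h1 : ∀ s ∈ Ioc a b, ‖D 1 s - taylorAt b m (fun l => D (l + 1)) s‖ ≤ (b - a) ^ m * I :=
        fun s hs => norm_sub_taylorAt_le hab m (fun l => D (l + 1))
          (fun l hl => hD (l + 1) (by omega)) hi hI hs
      have h2 := norm_setIntegral_le_of_norm_le_const (μ := volume) (s := Ioc a b)
        (f := fun s => ‖D 1 s - taylorAt b m (fun l => D (l + 1)) s‖) (by simp)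
        (fun s hs => by rw [norm_norm]; exact h1 s hs)
      rw [Real.volume_real_Ioc_of_le hab.le] at h2
      refine ((le_abs_self _).trans h2).trans_eq ?_
      ring

end Taylor

/-! ### The error of the projection onto piecewise polynomials -/

section Projection

open Polynomial

variable {H : Type*} [NormedAddCommGroup H] [InnerProductSpace ℝ H] [CompleteSpace H]
variable {a b M B : ℝ} {d p : ℕ} {ψ : Fin d → ℝ[X]}

/-- The derivative of `pieceFn a b q` on `(a, b)`. -/
def pieceDeriv (a b : ℝ) (q : ℝ[X]) : ℝ → ℝ :=
  (Ioc a b).indicator fun t => (√(b - a))⁻¹ * ((derivative q).eval ((t - a) / (b - a)) / (b - a))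

theorem hasDerivWithinAt_pieceFn (q : ℝ[X]) {t : ℝ} (ht : t ∈ Ioc a b) :
    HasDerivWithinAt (pieceFn a b q) (pieceDeriv a b q t) (Ioc a b) t := by
  have h1 : HasDerivAt (fun t => (t - a) / (b - a)) (1 / (b - a)) t :=
    ((hasDerivAt_id t).sub_const a).div_const (b - a)
  have h2 := ((q.hasDerivAt ((t - a) / (b - a))).comp t h1).const_mul (√(b - a))⁻¹
  rw [pieceDeriv, indicator_of_mem ht]
  refine (h2.congr_deriv (by ring)).hasDerivWithinAt.congr (fun s hs => ?_) ?_
  · rw [pieceFn, indicator_of_mem hs]; rfl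
  · rw [pieceFn, indicator_of_mem ht]; rfl

theorem abs_pieceFn_le (hab : a < b) {q : ℝ[X]} (hB : ∀ x ∈ Icc (0 : ℝ) 1, |q.eval x| ≤ B) {t : ℝ}
    (ht : t ∈ Ioc a b) : |pieceFn a b q t| ≤ (√(b - a))⁻¹ * B := by
  rw [pieceFn, indicator_of_mem ht, abs_mul, abs_of_nonneg (by positivity)]
  exact mul_le_mul_of_nonneg_left (hB _ (scaled_mem hab ht)) (by positivity)

theorem abs_pieceDeriv_le (hab : a < b) {q : ℝ[X]}
    (hB : ∀ x ∈ Icc (0 : ℝ) 1, |(derivative q).eval x| ≤ B) {t : ℝ} (ht : t ∈ Ioc a b) :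
    |pieceDeriv a b q t| ≤ (√(b - a))⁻¹ * (B / (b - a)) := by
  have hk : 0 < b - a := sub_pos.2 hab
  rw [pieceDeriv, indicator_of_mem ht, abs_mul, abs_of_nonneg (by positivity), abs_div,
    abs_of_pos hk]
  have := hB _ (scaled_mem hab ht)
  gcongr

theorem measurable_pieceFn (a b : ℝ) (q : ℝ[X]) : Measurable (pieceFn a b q) :=
  Measurable.indicator ((q.continuous.measurable.comp (by fun_prop)).const_mul _) measurableSet_Ioc

/-- Stability of the `L²` projection in the uniform norm and in variation, combined with its
invariance on polynomials. -/
theorem projection_error_le (hab : a < b)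
    (hon : ∀ i j, ∫ x in Ioc (0 : ℝ) 1, (ψ i).eval x * (ψ j).eval x = if i = j then 1 else 0)
    (hspan : ∀ q : ℝ[X], q.natDegree ≤ p →
      ∃ c : Fin d → ℝ, ∀ x, q.eval x = ∑ i, c i * (ψ i).eval x)
    (hB0 : 0 ≤ B) (hB : ∀ l, ∀ x ∈ Icc (0 : ℝ) 1, |(ψ l).eval x| ≤ B)
    (hB' : ∀ l, ∀ x ∈ Icc (0 : ℝ) 1, |(derivative (ψ l)).eval x| ≤ B) {v v' q q' : ℝ → H}
    (hv : IntegrableOn v (Ioc a b)) (hv' : IntegrableOn v' (Ioc a b))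
    (hq : IsPolyOn p (Ioc a b) q) (hqd : ∀ t, HasDerivAt q (q' t) t) (hqc : Continuous q')
    (h1 : ∀ t ∈ Ioc a b, ‖v t - q t‖ ≤ M) (h2 : ∫ t in Ioc a b, ‖v' t - q' t‖ ≤ M) {c : Fin d → H}
    (hc : ∀ l, c l = ∫ t in Ioc a b, pieceFn a b (ψ l) t • v t) :
    (∀ t ∈ Ioc a b, ‖v t - ∑ l, pieceFn a b (ψ l) t • c l‖ ≤ (1 + d * B ^ 2) * M) ∧
    ∫ t in Ioc a b, ‖v' t - ∑ l, pieceDeriv a b (ψ l) t • c l‖ ≤ (1 + d * B ^ 2) * M := by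
  have hk : 0 < b - a := sub_pos.2 hab
  have hs : 0 < √(b - a) := Real.sqrt_pos.2 hk
  have hss : √(b - a) * √(b - a) = b - a := Real.mul_self_sqrt hk.le
  have hM0 : 0 ≤ M := (norm_nonneg _).trans (h1 b (right_mem_Ioc.2 hab))
  obtain ⟨e, he⟩ := hq.exists_pieceFn hab hspan
  have hqi : IntegrableOn q (Ioc a b) :=
    (continuous_iff_continuousAt.2 fun t => (hqd t).continuousAt).integrableOn_Icc.mono_set
      Ioc_subset_Icc_self
  have hbd : ∀ l, ∀ t ∈ Ioc a b, |pieceFn a b (ψ l) t| ≤ (√(b - a))⁻¹ * B := fun l t ht =>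
    abs_pieceFn_le hab (hB l) ht
  have hint : ∀ l {f : ℝ → H}, IntegrableOn f (Ioc a b) →
      IntegrableOn (fun t => pieceFn a b (ψ l) t • f t) (Ioc a b) := fun l f hf =>
    hf.bdd_smul ((√(b - a))⁻¹ * B) (measurable_pieceFn _ _ _).aestronglyMeasurable
      ((ae_restrict_mem measurableSet_Ioc).mono fun t ht => hbd l t ht)
  have hintR : ∀ l m, IntegrableOn (fun t => pieceFn a b (ψ l) t * pieceFn a b (ψ m) t)
      (Ioc a b) := fun l m => by
    refine Measure.integrableOn_of_bounded (M := ((√(b - a))⁻¹ * B) * ((√(b - a))⁻¹ * B)) (by simp)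
      ((measurable_pieceFn _ _ _).mul (measurable_pieceFn _ _ _)).aestronglyMeasurable
      ((ae_restrict_mem measurableSet_Ioc).mono fun t ht => ?_)
    rw [norm_mul]
    exact mul_le_mul (hbd l t ht) (hbd m t ht) (abs_nonneg _) (by positivity)
  -- the coefficients of the projection of `v - q`
  have hce : ∀ l, c l - e l = ∫ t in Ioc a b, pieceFn a b (ψ l) t • (v t - q t) := by
    intro l
    simp only [smul_sub]
    rw [integral_sub (hint l hv) (hint l hqi), hc]
    congr 1
    have h3 : ∫ t in Ioc a b, pieceFn a b (ψ l) t • q t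
        = ∫ t in Ioc a b, ∑ m, (pieceFn a b (ψ l) t * pieceFn a b (ψ m) t) • e m := by
      refine setIntegral_congr_fun measurableSet_Ioc fun t ht => ?_
      simp only [he t ht, Finset.smul_sum, smul_smul]
    rw [h3, integral_finsetSum _ fun m _ => (hintR l m).smul_const (e m)]
    simp only [integral_smul_const, integral_pieceFn_mul hab, hon, ite_smul, one_smul, zero_smul]
    simp
  have hcb : ∀ l, ‖c l - e l‖ ≤ √(b - a) * B * M := by
    intro l
    rw [hce l]
    have h3 := norm_setIntegral_le_of_norm_le_const (μ := volume) (s := Ioc a b)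
      (f := fun t => pieceFn a b (ψ l) t • (v t - q t)) (C := (√(b - a))⁻¹ * B * M) (by simp)
      (fun t ht => by
        rw [norm_smul]
        exact mul_le_mul (hbd l t ht) (h1 t ht) (norm_nonneg _) (by positivity))
    rw [Real.volume_real_Ioc_of_le hab.le] at h3
    calc _ ≤ (√(b - a))⁻¹ * B * M * (b - a) := h3
      _ = (√(b - a))⁻¹ * B * M * (√(b - a) * √(b - a)) := by rw [hss]
      _ = √(b - a) * B * M := by field_simp
  have hqd' : ∀ t ∈ Ioc a b, q' t = ∑ l, pieceDeriv a b (ψ l) t • e l := by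
    intro t ht
    have h3 : HasDerivWithinAt q (∑ l, pieceDeriv a b (ψ l) t • e l) (Ioc a b) t :=
      (HasDerivWithinAt.fun_sum fun l _ => (hasDerivWithinAt_pieceFn (ψ l) ht).smul_const
        (e l)).congr (fun s hs => he s hs) (he t ht)
    exact (uniqueDiffOn_Ioc a b t ht).eq_deriv _ (hqd t).hasDerivWithinAt h3
  constructor
  · intro t ht
    have h3 : v t - ∑ l, pieceFn a b (ψ l) t • c l
        = (v t - q t) - ∑ l, pieceFn a b (ψ l) t • (c l - e l) := by
      rw [he t ht]
      simp only [smul_sub, Finset.sum_sub_distrib]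
      abel
    have h4 : ‖∑ l, pieceFn a b (ψ l) t • (c l - e l)‖ ≤ d * (B ^ 2 * M) := by
      refine (norm_sum_le _ _).trans ((Finset.sum_le_card_nsmul _ _ (B ^ 2 * M) fun l _ => ?_).trans
        (by simp))
      rw [norm_smul]
      refine (mul_le_mul (hbd l t ht) (hcb l) (norm_nonneg _) (by positivity)).trans_eq ?_
      field_simp
    rw [h3]
    refine (norm_sub_le _ _).trans ((add_le_add (h1 t ht) h4).trans_eq ?_)
    ring
  · have h3 : ∀ t ∈ Ioc a b, ‖v' t - ∑ l, pieceDeriv a b (ψ l) t • c l‖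
        ≤ ‖v' t - q' t‖ + d * (B ^ 2 * M / (b - a)) := by
      intro t ht
      have h4 : v' t - ∑ l, pieceDeriv a b (ψ l) t • c l
          = (v' t - q' t) - ∑ l, pieceDeriv a b (ψ l) t • (c l - e l) := by
        rw [hqd' t ht]
        simp only [smul_sub, Finset.sum_sub_distrib]
        abel
      have h5 : ‖∑ l, pieceDeriv a b (ψ l) t • (c l - e l)‖ ≤ d * (B ^ 2 * M / (b - a)) := by
        refine (norm_sum_le _ _).trans ((Finset.sum_le_card_nsmul _ _ (B ^ 2 * M / (b - a))
          fun l _ => ?_).trans (by simp))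
        rw [norm_smul]
        refine (mul_le_mul (abs_pieceDeriv_le hab (hB' l) ht) (hcb l) (norm_nonneg _)
          (by positivity)).trans_eq ?_
        field_simp
      rw [h4]
      exact (norm_sub_le _ _).trans (by gcongr)
    have hqi' : IntegrableOn q' (Ioc a b) := hqc.integrableOn_Icc.mono_set Ioc_subset_Icc_self
    have hd : IntegrableOn (fun t => ‖v' t - q' t‖) (Ioc a b) := (hv'.sub hqi').norm
    refine (integral_mono_of_nonneg (ae_of_all _ fun _ => norm_nonneg _)
      (hd.add (integrable_const (d * (B ^ 2 * M / (b - a))))) ((ae_restrict_mem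
        measurableSet_Ioc).mono h3)).trans ?_
    refine (integral_add (g := fun _ => (d : ℝ) * (B ^ 2 * M / (b - a))) hd
      (integrable_const _)).le.trans ?_
    have h6 : ∫ _ in Ioc a b, (d : ℝ) * (B ^ 2 * M / (b - a)) = d * B ^ 2 * M := by
      rw [setIntegral_const, Real.volume_real_Ioc_of_le hab.le, smul_eq_mul]
      field_simp
    rw [h6]
    linarith

end Projection

section MeshProjection

open Polynomial

variable {H : Type*} [NormedAddCommGroup H] [InnerProductSpace ℝ H] [CompleteSpace H]
variable {τ : ℕ → ℝ} {n d p : ℕ} {S α B : ℝ} {ψ : Fin d → ℝ[X]}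

/-- The error of the `L²` projection of `v` onto piecewise polynomials, in the fractional seminorm
and in the `L²` norm, in terms of local polynomial approximations with errors `M j`. -/
theorem mesh_projection_error_le (hα0 : 0 < α) (hα1 : α < 1) (h : IsMesh τ n S)
    (hon : ∀ i j, ∫ x in Ioc (0 : ℝ) 1, (ψ i).eval x * (ψ j).eval x = if i = j then 1 else 0)
    (hspan : ∀ q : ℝ[X], q.natDegree ≤ p →
      ∃ c : Fin d → ℝ, ∀ x, q.eval x = ∑ i, c i * (ψ i).eval x)
    (hB0 : 0 ≤ B) (hB : ∀ l, ∀ x ∈ Icc (0 : ℝ) 1, |(ψ l).eval x| ≤ B)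
    (hB' : ∀ l, ∀ x ∈ Icc (0 : ℝ) 1, |(derivative (ψ l)).eval x| ≤ B) {v v' : ℝ → H}
    (hv : MemLp v ⊤ (timeMeasure S)) (hv' : Integrable v' (timeMeasure S))
    (hd : ∀ t ∈ Ioc 0 S, HasDerivWithinAt v (v' t) (Ioc 0 S) t) {M : ℕ → ℝ} (hM0 : ∀ j, 0 ≤ M j)
    (hM : ∀ j < n, ∃ q q' : ℝ → H, IsPolyOn p (Ioc (τ j) (τ (j + 1))) q ∧
      (∀ t, HasDerivAt q (q' t) t) ∧ Continuous q' ∧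
      (∀ t ∈ Ioc (τ j) (τ (j + 1)), ‖v t - q t‖ ≤ M j) ∧
      ∫ t in Ioc (τ j) (τ (j + 1)), ‖v' t - q' t‖ ≤ M j) {η : ℝ → H}
    (hη : ∀ t, η t = v t - ∑ x : Fin n × Fin d,
      meshFn τ ψ x t • ∫ s, meshFn τ ψ x s • v s ∂(timeMeasure S)) :
    fracSq α S η ≤ ENNReal.ofReal (fracConst α * ((1 + d * B ^ 2) ^ 2
      * ∑ j ∈ Finset.range n, (τ (j + 1) - τ j) ^ (1 - α) * M j ^ 2)) ∧
    normSq S η ≤ (1 + d * B ^ 2) ^ 2 * ∑ j ∈ Finset.range n, (τ (j + 1) - τ j) * M j ^ 2 := by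
  set C := 1 + d * B ^ 2 with hC
  have hC0 : 0 ≤ C := by positivity
  set a : Fin n × Fin d → H := fun x => ∫ s, meshFn τ ψ x s • v s ∂(timeMeasure S) with ha
  set f : ℝ → H := fun t => v' t - ∑ x : Fin n × Fin d,
    pieceDeriv (τ x.1) (τ (x.1 + 1)) (ψ x.2) t • a x with hf
  have hfi : Integrable f (timeMeasure S) := by
    refine hv'.sub (integrable_finsetSum _ fun x _ => Integrable.smul_const ?_ _)
    have hx := h.lt x.1 x.1.2
    refine Integrable.restrict ?_
    refine (integrable_indicator_iff measurableSet_Ioc).2 (ContinuousOn.integrableOn_Icc ?_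
      |>.mono_set Ioc_subset_Icc_self)
    have := (derivative (ψ x.2)).continuous
    fun_prop
  have hηm : MemLp η ⊤ (timeMeasure S) := by
    have : η = fun t => v t - ∑ x, meshFn τ ψ x t • a x := funext hη
    rw [this]
    exact hv.sub (memLp_sum_smul (fun x => memLp_meshFn h ψ x) a)
  have hηj : ∀ j : Fin n, ∀ t ∈ Ioc (τ j) (τ (j + 1)),
      η t = v t - ∑ l, pieceFn (τ j) (τ (j + 1)) (ψ l) t • a (j, l) := fun j t ht => by
    rw [hη, sum_meshFn h ψ a j ht]
  have hfj : ∀ j : Fin n, ∀ t ∈ Ioc (τ j) (τ (j + 1)),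
      f t = v' t - ∑ l, pieceDeriv (τ j) (τ (j + 1)) (ψ l) t • a (j, l) := fun j t ht => by
    simp only [hf]
    congr 1
    rw [Fintype.sum_prod_type, Finset.sum_eq_single_of_mem j (Finset.mem_univ j)]
    intro i _ hij
    refine Finset.sum_eq_zero fun l _ => ?_
    rw [pieceDeriv, indicator_of_notMem fun hti => hij (Fin.ext (h.eq_of_mem i.2 j.2 hti ht)),
      zero_smul]
  have haj : ∀ (j : Fin n) (l : Fin d),
      a (j, l) = ∫ t in Ioc (τ j) (τ (j + 1)), pieceFn (τ j) (τ (j + 1)) (ψ l) t • v t := by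
    intro j l
    refine setIntegral_eq_of_subset_of_forall_sdiff_eq_zero measurableSet_Ioc (h.subset j.2) ?_
    intro t ht
    rw [meshFn, pieceFn, indicator_of_notMem ht.2, zero_smul]
  have hsub : ∀ j < n, volume.restrict (Ioc (τ j) (τ (j + 1))) ≤ timeMeasure S := fun j hj =>
    Measure.restrict_mono (h.subset hj) le_rfl
  have hvi := integrable_of_memLp_top hv
  have key : ∀ j < n, (∀ t ∈ Ioc (τ j) (τ (j + 1)), ‖η t‖ ≤ C * M j) ∧
      ∫ t in Ioc (τ j) (τ (j + 1)), ‖f t‖ ≤ C * M j := by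
    intro j hj
    obtain ⟨q, q', hq, hqd, hqc, hq1, hq2⟩ := hM j hj
    obtain ⟨h1, h2⟩ := projection_error_le (h.lt j hj) hon hspan hB0 hB hB'
      (hvi.mono_measure (hsub j hj)) (hv'.mono_measure (hsub j hj)) hq hqd hqc hq1 hq2
      (fun l => haj ⟨j, hj⟩ l)
    refine ⟨fun t ht => by rw [hηj ⟨j, hj⟩ t ht]; exact h1 t ht, ?_⟩
    refine le_of_eq_of_le (setIntegral_congr_fun measurableSet_Ioc fun t ht => ?_) h2
    rw [hfj ⟨j, hj⟩ t ht]
  constructor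
  · have h1 := fracSq_le_of_primitive hα0 hα1 h hηm (M := fun j => C * M j)
      (fun j => mul_nonneg hC0 (hM0 j)) hfi (fun j hj => (key j hj).1)
      (fun j hj s t hs hst ht => by
        refine sub_eq_integral_of_hasDerivWithinAt (a := τ j) (b := τ (j + 1)) (fun x hx => ?_)
          (hfi.mono_measure (hsub j hj)) hs hst.le ht
        rw [hfj ⟨j, hj⟩ x hx]
        refine HasDerivWithinAt.congr (((hd x (h.subset hj hx)).mono (h.subset hj)).sub
          (HasDerivWithinAt.fun_sum fun l _ => (hasDerivWithinAt_pieceFn (ψ l) hx).smul_const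
            (a (⟨j, hj⟩, l)))) (fun y hy => hηj ⟨j, hj⟩ y hy) (hηj ⟨j, hj⟩ x hx))
      (fun j hj => (key j hj).2)
    refine h1.trans_eq ?_
    congr 2
    rw [Finset.mul_sum]
    exact Finset.sum_congr rfl fun j _ => by ring
  · rw [normSq, h.integral_eq_sum (integrable_normSq hηm), Finset.mul_sum]
    refine Finset.sum_le_sum fun j hj => ?_
    have hj' := Finset.mem_range.1 hj
    have h1 := norm_setIntegral_le_of_norm_le_const (μ := volume) (s := Ioc (τ j) (τ (j + 1)))
      (f := fun t => ‖η t‖ ^ 2) (C := (C * M j) ^ 2) (by simp) (fun t ht => by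
        rw [norm_pow, norm_norm]
        exact pow_le_pow_left₀ (norm_nonneg _) ((key j hj').1 t ht) 2)
    rw [Real.volume_real_Ioc_of_le (h.lt j hj').le] at h1
    exact (le_abs_self _).trans (h1.trans_eq (by ring))

end MeshProjection

/-! ### Graded meshes and functions with a weak singularity at the initial time -/

section Grid

variable {T r : ℝ} {N n : ℕ}

theorem rpow_sub_rpow_le {x y : ℝ} (hr : 1 ≤ r) (hx : 0 < x) (hy : 0 ≤ y) :
    x ^ r - y ^ r ≤ r * x ^ (r - 1) * (x - y) := by
  have h1 := one_add_mul_self_le_rpow_one_add (s := y / x - 1) (by linarith [div_nonneg hy hx.le]) hr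
  have h2 : y ^ r = x ^ r * (1 + (y / x - 1)) ^ r := by
    rw [add_sub_cancel, ← Real.mul_rpow hx.le (div_nonneg hy hx.le), mul_div_cancel₀ _ hx.ne']
  have h3 := mul_le_mul_of_nonneg_left h1 (Real.rpow_nonneg hx.le r)
  have h4 : x ^ r = x ^ (r - 1) * x := by
    rw [← Real.rpow_add_one hx.ne', sub_add_cancel]
  rw [h2]
  have h5 : x ^ r * (1 + r * (y / x - 1)) = x ^ r - r * x ^ (r - 1) * (x - y) := by
    rw [h4]; field_simp; ring
  linarith

theorem gridPoint_zero (hr : 1 ≤ r) : gridPoint T r N 0 = 0 := by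
  rw [gridPoint, Nat.cast_zero, zero_div, Real.zero_rpow (by linarith), zero_mul]

theorem gridPoint_lt (hT : 0 < T) (hr : 1 ≤ r) (hN : 1 ≤ N) {i j : ℕ} (hij : i < j) :
    gridPoint T r N i < gridPoint T r N j := by
  have hN' : (0 : ℝ) < N := by exact_mod_cast hN
  have : (i : ℝ) < j := by exact_mod_cast hij
  exact mul_lt_mul_of_pos_right (Real.rpow_lt_rpow (by positivity)
    (div_lt_div_of_pos_right this hN') (by linarith)) hT

theorem isMesh_gridPoint (hT : 0 < T) (hr : 1 ≤ r) (hN : 1 ≤ N) (n : ℕ) :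
    IsMesh (gridPoint T r N) n (gridPoint T r N n) :=
  ⟨gridPoint_zero hr, rfl, fun j _ => gridPoint_lt hT hr hN j.lt_succ_self⟩

theorem gridPoint_le (hT : 0 < T) (hr : 1 ≤ r) (hN : 1 ≤ N) (hn : n ≤ N) : gridPoint T r N n ≤ T := by
  have hN' : (0 : ℝ) < N := by exact_mod_cast hN
  have : (n : ℝ) ≤ N := by exact_mod_cast hn
  exact mul_le_of_le_one_left hT.le (Real.rpow_le_one (by positivity)
    ((div_le_one hN').2 this) (by linarith))

theorem gridPoint_sub_le (hT : 0 < T) (hr : 1 ≤ r) (hN : 1 ≤ N) (j : ℕ) :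
    gridPoint T r N (j + 1) - gridPoint T r N j
      ≤ r * T * ((N : ℝ) ^ (-r) * ((j : ℝ) + 1) ^ (r - 1)) := by
  have hN' : (0 : ℝ) < N := by exact_mod_cast hN
  have h1 := rpow_sub_rpow_le (x := ((j : ℝ) + 1) / N) (y := (j : ℝ) / N) hr (by positivity)
    (by positivity)
  have h2 : r * (((j : ℝ) + 1) / N) ^ (r - 1) * (((j : ℝ) + 1) / N - (j : ℝ) / N)
      = r * ((N : ℝ) ^ (-r) * ((j : ℝ) + 1) ^ (r - 1)) := by
    have e1 : (N : ℝ) ^ (-r) = ((N : ℝ) ^ (r - 1))⁻¹ * (N : ℝ)⁻¹ := by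
      rw [← Real.rpow_neg hN'.le, ← Real.rpow_neg_one (N : ℝ), ← Real.rpow_add hN']
      congr 1; ring
    rw [Real.div_rpow (by positivity) hN'.le, e1]
    field_simp
    ring
  rw [h2] at h1
  rw [gridPoint, gridPoint, ← sub_mul]
  push_cast
  exact (mul_le_mul_of_nonneg_right h1 hT.le).trans_eq (by ring)

theorem gridPoint_sub_le' (hT : 0 < T) (hr : 1 ≤ r) (hN : 1 ≤ N) {j : ℕ} (hj : j < N) :
    gridPoint T r N (j + 1) - gridPoint T r N j ≤ r * T / N := by
  have hN' : (0 : ℝ) < N := by exact_mod_cast hN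
  refine (gridPoint_sub_le hT hr hN j).trans ?_
  have h1 : ((j : ℝ) + 1) ^ (r - 1) ≤ (N : ℝ) ^ (r - 1) :=
    Real.rpow_le_rpow (by positivity) (by exact_mod_cast hj) (by linarith)
  have h2 : (N : ℝ) ^ (-r) * (N : ℝ) ^ (r - 1) = (N : ℝ)⁻¹ := by
    rw [← Real.rpow_add hN', ← Real.rpow_neg_one]; congr 1; ring
  calc _ ≤ r * T * ((N : ℝ) ^ (-r) * (N : ℝ) ^ (r - 1)) := by gcongr
    _ = _ := by rw [h2, div_eq_mul_inv]

theorem gridPoint_succ_le (hT : 0 < T) (hr : 1 ≤ r) {j : ℕ} (hj : 1 ≤ j) :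
    gridPoint T r N (j + 1) ≤ 2 ^ r * gridPoint T r N j := by
  have hj' : (1 : ℝ) ≤ j := by exact_mod_cast hj
  rw [gridPoint, gridPoint, ← mul_assoc, ← Real.mul_rpow zero_le_two (by positivity)]
  refine mul_le_mul_of_nonneg_right (Real.rpow_le_rpow (by positivity) ?_ (by linarith)) hT.le
  rw [← mul_div_assoc]
  refine div_le_div_of_nonneg_right ?_ (Nat.cast_nonneg _)
  push_cast
  linarith

end Grid

section Singular

variable {H : Type*} [NormedAddCommGroup H] [InnerProductSpace ℝ H] [CompleteSpace H]
variable {T σ K r : ℝ} {p : ℕ} {D : ℕ → ℝ → H}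

/-- `D l`, for `l ≤ p + 1`, are the successive derivatives of `D 0` on `(0, T]`, and they grow at
most like those of `t ^ σ` as `t` tends to `0`. -/
structure HasSingularGrowth (T σ K : ℝ) (p : ℕ) (D : ℕ → ℝ → H) : Prop where
  deriv : ∀ l ≤ p, ∀ t ∈ Ioc 0 T, HasDerivWithinAt (D l) (D (l + 1) t) (Ioc 0 T) t
  bound : ∀ l ≤ p + 1, ∀ t ∈ Ioc 0 T, ‖D l t‖ ≤ K * (1 + t ^ (σ - l))

theorem one_add_rpow_le {e t : ℝ} (he : e ≤ 0) (ht : t ∈ Ioc 0 T) :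
    1 + t ^ e ≤ (1 + T ^ (-e)) * t ^ e := by
  have hT : 0 < T := ht.1.trans_le ht.2
  have h1 : T ^ e ≤ t ^ e := Real.rpow_le_rpow_of_nonpos ht.1 ht.2 he
  have h2 : T ^ (-e) * T ^ e = 1 := by
    rw [← Real.rpow_add hT, neg_add_cancel, Real.rpow_zero]
  have h3 := mul_le_mul_of_nonneg_left h1 (Real.rpow_nonneg hT.le (-e))
  linarith

theorem HasSingularGrowth.aestronglyMeasurable (h : HasSingularGrowth T σ K p D) {l : ℕ}
    (hl : l ≤ p) : AEStronglyMeasurable (D (l + 1)) (timeMeasure T) := by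
  refine (stronglyMeasurable_deriv (D l)).aestronglyMeasurable.congr ?_
  have hne : ∀ᵐ t : ℝ, t ≠ T := by simp [ae_iff, measure_singleton]
  filter_upwards [ae_restrict_mem measurableSet_Ioc, ae_restrict_of_ae hne] with t ht hne
  exact ((h.deriv l hl t ht).hasDerivAt
    (Ioc_mem_nhds ht.1 (lt_of_le_of_ne ht.2 hne))).deriv

theorem HasSingularGrowth.integrable (h : HasSingularGrowth T σ K p D) {l : ℕ} (hl : l ≤ p)
    (hlσ : (l : ℝ) < σ) : IntegrableOn (D (l + 1)) (Ioc 0 T) := by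
  rcases le_or_gt T 0 with hT | hT
  · simp [Ioc_eq_empty hT.not_gt]
  refine Integrable.mono' (g := fun t => K * (1 + t ^ (σ - (l + 1 : ℕ)))) ?_
    (h.aestronglyMeasurable hl) ?_
  · refine ((integrable_const 1).add ?_).const_mul K
    refine (intervalIntegrable_iff_integrableOn_Ioc_of_le hT.le).1
      (intervalIntegral.intervalIntegrable_rpow' ?_)
    push_cast
    linarith
  · exact (ae_restrict_mem measurableSet_Ioc).mono fun t ht => h.bound (l + 1) (by omega) t ht

theorem HasSingularGrowth.mono (h : HasSingularGrowth T σ K p D) {a b : ℝ} (ha : 0 ≤ a)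
    (hb : b ≤ T) : ∀ l ≤ p, ∀ t ∈ Ioc a b, HasDerivWithinAt (D l) (D (l + 1) t) (Ioc a b) t :=
  fun l hl t ht => (h.deriv l hl t (Ioc_subset_Ioc ha hb ht)).mono (Ioc_subset_Ioc ha hb)

/-- The constant in the polynomial approximation of functions with a weak singularity at `0`. -/
def approxConst (T σ r K : ℝ) (p : ℕ) : ℝ :=
  K * ((1 + T ^ (((⌈σ⌉₊ - 1 : ℕ) : ℝ) + 1 - σ)) / (σ - (⌈σ⌉₊ - 1 : ℕ))
    + (1 + T ^ ((p : ℝ) + 1 - σ)) * 2 ^ (r * (p + 1 - σ)))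

theorem ceil_sub_one_lt (hσ0 : 0 < σ) : (((⌈σ⌉₊ - 1 : ℕ)) : ℝ) < σ ∧
    σ ≤ ((⌈σ⌉₊ - 1 : ℕ) : ℝ) + 1 := by
  have h1 : 0 < ⌈σ⌉₊ := Nat.ceil_pos.2 hσ0
  constructor
  · exact Nat.lt_ceil.1 (by omega)
  · have := Nat.le_ceil σ
    rw [Nat.cast_sub h1]
    simpa using this

theorem approxConst_nonneg (hT : 0 < T) (hσ0 : 0 < σ) (hK : 0 ≤ K) :
    0 ≤ approxConst T σ r K p := by
  have := ceil_sub_one_lt hσ0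
  have : 0 < σ - (⌈σ⌉₊ - 1 : ℕ) := by linarith
  rw [approxConst]
  positivity

/-- On the first interval a Taylor polynomial of degree less than `σ` is used, since the higher
derivatives need not be integrable. -/
theorem HasSingularGrowth.exists_approx_first (h : HasSingularGrowth T σ K p D) (hσ0 : 0 < σ)
    (hσp : σ ≤ p + 1) (hK : 0 ≤ K) {b : ℝ} (hb : 0 < b) (hbT : b ≤ T) :
    ∃ q q' : ℝ → H, IsPolyOn p (Ioc 0 b) q ∧ (∀ t, HasDerivAt q (q' t) t) ∧ Continuous q' ∧
      (∀ t ∈ Ioc 0 b, ‖D 0 t - q t‖ ≤ approxConst T σ r K p * b ^ σ) ∧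
      ∫ t in Ioc 0 b, ‖D 1 t - q' t‖ ≤ approxConst T σ r K p * b ^ σ := by
  have hT : 0 < T := hb.trans_le hbT
  set m := ⌈σ⌉₊ - 1 with hm
  obtain ⟨hm1, hm2⟩ := ceil_sub_one_lt hσ0
  rw [← hm] at hm1 hm2
  have hmp : m ≤ p := by
    have : ⌈σ⌉₊ ≤ p + 1 := Nat.ceil_le.2 (by exact_mod_cast hσp)
    omega
  set C := K * ((1 + T ^ ((m : ℝ) + 1 - σ)) / (σ - m)) with hC
  have hi := (h.integrable hmp hm1).mono_set (Ioc_subset_Ioc_right hbT)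
  have hpi : IntegrableOn (fun t : ℝ => t ^ (σ - m - 1)) (Ioc 0 b) :=
    (intervalIntegrable_iff_integrableOn_Ioc_of_le hb.le).1
      (intervalIntegral.intervalIntegrable_rpow' (by linarith))
  have hI : ∫ t in Ioc 0 b, ‖D (m + 1) t‖ ≤ C * b ^ (σ - m) := by
    have h1 : ∫ t in Ioc 0 b, ‖D (m + 1) t‖
        ≤ ∫ t in Ioc 0 b, K * (1 + T ^ ((m : ℝ) + 1 - σ)) * t ^ (σ - m - 1) := by
      refine setIntegral_mono_on hi.norm (hpi.const_mul _) measurableSet_Ioc fun t ht => ?_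
      have ht' : t ∈ Ioc 0 T := ⟨ht.1, ht.2.trans hbT⟩
      have e1 := h.bound (m + 1) (by omega) t ht'
      have e2 := one_add_rpow_le (e := σ - m - 1) (by linarith) ht'
      have e3 : σ - ((m + 1 : ℕ) : ℝ) = σ - m - 1 := by push_cast; ring
      have e4 : -(σ - m - 1) = (m : ℝ) + 1 - σ := by ring
      rw [e3] at e1
      rw [e4] at e2
      exact e1.trans ((mul_le_mul_of_nonneg_left e2 hK).trans_eq (by ring))
    refine h1.trans_eq ?_
    rw [integral_const_mul, ← intervalIntegral.integral_of_le hb.le,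
      integral_rpow (Or.inl (by linarith)), sub_add_cancel, Real.zero_rpow (by linarith), hC]
    ring
  obtain ⟨q, q', h1, h2, h3, h4, h5⟩ := exists_poly_approx (p := p) hb m hmp D
    (fun l hl => h.mono le_rfl hbT l (hl.trans hmp)) hi hI
  have hle : (b - 0) ^ m * (C * b ^ (σ - m)) ≤ approxConst T σ r K p * b ^ σ := by
    have e1 : b ^ m * b ^ (σ - m) = b ^ σ := by
      rw [← Real.rpow_natCast, ← Real.rpow_add hb]; congr 1; ring
    calc _ = C * (b ^ m * b ^ (σ - m)) := by rw [sub_zero]; ring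
      _ = C * b ^ σ := by rw [e1]
      _ ≤ _ := by
          refine mul_le_mul_of_nonneg_right ?_ (Real.rpow_nonneg hb.le _)
          rw [approxConst, hC]
          refine mul_le_mul_of_nonneg_left ?_ hK
          rw [← hm]
          have : 0 ≤ (1 + T ^ ((p : ℝ) + 1 - σ)) * 2 ^ (r * (p + 1 - σ)) := by positivity
          linarith
  exact ⟨q, q', h1, h2, h3, fun t ht => (h4 t ht).trans hle, h5.trans hle⟩

theorem HasSingularGrowth.exists_approx (h : HasSingularGrowth T σ K p D) (hσ0 : 0 < σ)
    (hσp : σ ≤ p + 1) (hK : 0 ≤ K) {a b : ℝ} (ha : 0 < a) (hab : a < b) (hbT : b ≤ T)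
    (hba : b ≤ 2 ^ r * a) :
    ∃ q q' : ℝ → H, IsPolyOn p (Ioc a b) q ∧ (∀ t, HasDerivAt q (q' t) t) ∧ Continuous q' ∧
      (∀ t ∈ Ioc a b, ‖D 0 t - q t‖
        ≤ approxConst T σ r K p * ((b - a) ^ (p + 1) * b ^ (σ - p - 1))) ∧
      ∫ t in Ioc a b, ‖D 1 t - q' t‖
        ≤ approxConst T σ r K p * ((b - a) ^ (p + 1) * b ^ (σ - p - 1)) := by
  have hb : 0 < b := ha.trans hab
  have hT : 0 < T := hb.trans_le hbT
  have hk : 0 < b - a := sub_pos.2 hab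
  set e := σ - p - 1 with he
  have he0 : e ≤ 0 := by linarith
  set c := (1 + T ^ ((p : ℝ) + 1 - σ)) * 2 ^ (r * (p + 1 - σ)) with hc
  have hbd : ∀ t ∈ Ioc a b, ‖D (p + 1) t‖ ≤ K * c * b ^ e := by
    intro t ht
    have ht' : t ∈ Ioc 0 T := ⟨ha.trans ht.1, ht.2.trans hbT⟩
    have e1 := h.bound (p + 1) le_rfl t ht'
    have e2 := one_add_rpow_le he0 ht'
    have e3 : σ - ((p + 1 : ℕ) : ℝ) = e := by rw [he]; push_cast; ring
    have e4 : -e = (p : ℝ) + 1 - σ := by rw [he]; ring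
    have e5 : t ^ e ≤ 2 ^ (r * (p + 1 - σ)) * b ^ e := by
      have e6 : b ^ e = (2 ^ r * (b / 2 ^ r)) ^ e := by
        congr 1; field_simp
      have e7 : (2 : ℝ) ^ (r * (p + 1 - σ)) * (2 ^ r) ^ e = 1 := by
        rw [← Real.rpow_mul zero_le_two, ← Real.rpow_add zero_lt_two, he]
        ring_nf
        exact Real.rpow_zero 2
      have e8 : b / 2 ^ r ≤ a := by
        rw [div_le_iff₀ (by positivity)]; linarith
      rw [e6, Real.mul_rpow (by positivity) (by positivity), ← mul_assoc, e7, one_mul]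
      exact Real.rpow_le_rpow_of_nonpos (by positivity) (e8.trans ht.1.le) he0
    rw [e3] at e1
    rw [e4] at e2
    calc ‖D (p + 1) t‖ ≤ K * ((1 + T ^ ((p : ℝ) + 1 - σ)) * t ^ e) :=
          e1.trans (mul_le_mul_of_nonneg_left e2 hK)
      _ ≤ K * ((1 + T ^ ((p : ℝ) + 1 - σ)) * (2 ^ (r * (p + 1 - σ)) * b ^ e)) := by gcongr
      _ = K * c * b ^ e := by rw [hc]; ring
  have hsub : Ioc a b ⊆ Ioc 0 T := Ioc_subset_Ioc ha.le hbT
  have hi : IntegrableOn (D (p + 1)) (Ioc a b) :=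
    Integrable.of_bound ((h.aestronglyMeasurable le_rfl).mono_measure
      (Measure.restrict_mono hsub le_rfl)) (K * c * b ^ e) ((ae_restrict_mem measurableSet_Ioc).mono hbd)
  have hI : ∫ t in Ioc a b, ‖D (p + 1) t‖ ≤ K * c * b ^ e * (b - a) := by
    have h1 := norm_setIntegral_le_of_norm_le_const (μ := volume) (s := Ioc a b)
      (f := fun t => ‖D (p + 1) t‖) (by simp) (fun t ht => by rw [norm_norm]; exact hbd t ht)
    rw [Real.volume_real_Ioc_of_le hab.le] at h1
    exact (le_abs_self _).trans h1
  obtain ⟨q, q', h1, h2, h3, h4, h5⟩ := exists_poly_approx (p := p) hab p le_rfl D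
    (h.mono ha.le hbT) hi hI
  have hle : (b - a) ^ p * (K * c * b ^ e * (b - a))
      ≤ approxConst T σ r K p * ((b - a) ^ (p + 1) * b ^ e) := by
    have e1 : K * c ≤ approxConst T σ r K p := by
      rw [approxConst]
      refine mul_le_mul_of_nonneg_left ?_ hK
      have := ceil_sub_one_lt hσ0
      have : 0 < σ - (⌈σ⌉₊ - 1 : ℕ) := by linarith
      have : 0 ≤ (1 + T ^ (((⌈σ⌉₊ - 1 : ℕ) : ℝ) + 1 - σ)) / (σ - (⌈σ⌉₊ - 1 : ℕ)) := by positivity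
      linarith
    calc _ = K * c * ((b - a) ^ (p + 1) * b ^ e) := by ring
      _ ≤ _ := mul_le_mul_of_nonneg_right e1 (by positivity)
  exact ⟨q, q', h1, h2, h3, fun t ht => (h4 t ht).trans hle, h5.trans hle⟩

/-- The two cases combined on a graded mesh. -/
theorem HasSingularGrowth.exists_approx_grid (h : HasSingularGrowth T σ K p D) (hT : 0 < T)
    (hr : 1 ≤ r) (hσ0 : 0 < σ) (hσp : σ ≤ p + 1) (hK : 0 ≤ K) {N j : ℕ} (hj : j < N) :
    ∃ q q' : ℝ → H, IsPolyOn p (Ioc (gridPoint T r N j) (gridPoint T r N (j + 1))) q ∧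
      (∀ t, HasDerivAt q (q' t) t) ∧ Continuous q' ∧
      (∀ t ∈ Ioc (gridPoint T r N j) (gridPoint T r N (j + 1)), ‖D 0 t - q t‖
        ≤ approxConst T σ r K p * ((gridPoint T r N (j + 1) - gridPoint T r N j) ^ (p + 1)
          * gridPoint T r N (j + 1) ^ (σ - p - 1))) ∧
      ∫ t in Ioc (gridPoint T r N j) (gridPoint T r N (j + 1)), ‖D 1 t - q' t‖
        ≤ approxConst T σ r K p * ((gridPoint T r N (j + 1) - gridPoint T r N j) ^ (p + 1)
          * gridPoint T r N (j + 1) ^ (σ - p - 1)) := by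
  have hN : 1 ≤ N := by omega
  have hle := gridPoint_le hT hr hN (show j + 1 ≤ N from hj)
  rcases Nat.eq_zero_or_pos j with hj0 | hj0
  · subst hj0
    have hb : 0 < gridPoint T r N (0 + 1) := by
      simpa [gridPoint_zero hr] using gridPoint_lt hT hr hN zero_lt_one
    have e : (gridPoint T r N (0 + 1) - gridPoint T r N 0) ^ (p + 1)
        * gridPoint T r N (0 + 1) ^ (σ - p - 1) = gridPoint T r N (0 + 1) ^ σ := by
      rw [gridPoint_zero hr, sub_zero, ← Real.rpow_natCast, ← Real.rpow_add hb]
      congr 1; push_cast; ring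
    rw [e, gridPoint_zero hr]
    exact h.exists_approx_first hσ0 hσp hK hb hle
  · have ha : 0 < gridPoint T r N j := by
      simpa [gridPoint_zero hr] using gridPoint_lt hT hr hN hj0
    exact h.exists_approx hσ0 hσp hK ha (gridPoint_lt hT hr hN j.lt_succ_self) hle
      (gridPoint_succ_le hT hr hj0)

end Singular

/-! ### Summation over the graded mesh -/

section Summation

theorem exists_sum_rpow_le_of_neg {s : ℝ} (hs : s < 0) :
    ∃ C : ℝ, 0 < C ∧ ∀ n : ℕ, ∑ j ∈ Finset.range n, ((j : ℝ) + 1) ^ (s - 1) ≤ C := by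
  have h1 : Summable fun j : ℕ => ((j : ℝ) + 1) ^ (s - 1) := by
    have h2 := (summable_nat_add_iff 1).2 (Real.summable_nat_rpow.2 (show s - 1 < -1 by linarith))
    simpa using h2
  refine ⟨1 + ∑' j : ℕ, ((j : ℝ) + 1) ^ (s - 1), ?_, fun n => ?_⟩
  · have := tsum_nonneg (L := SummationFilter.unconditional ℕ)
      fun j : ℕ => Real.rpow_nonneg (show (0 : ℝ) ≤ (j : ℝ) + 1 by positivity) (s - 1)
    linarith
  · have := h1.sum_le_tsum (Finset.range n) fun j _ => by positivity
    linarith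

theorem sum_inv_le_one_add_log (n : ℕ) :
    ∑ j ∈ Finset.range n, ((j : ℝ) + 1) ^ (-1 : ℝ) ≤ 1 + Real.log n := by
  refine le_of_eq_of_le ?_ (harmonic_le_one_add_log n)
  simp [harmonic, Real.rpow_neg_one]

theorem exists_sum_rpow_le_of_pos {s : ℝ} (hs : 0 < s) :
    ∃ C : ℝ, 0 < C ∧ ∀ n : ℕ, ∑ j ∈ Finset.range n, ((j : ℝ) + 1) ^ (s - 1) ≤ C * (n : ℝ) ^ s := by
  rcases le_or_gt 1 s with h1 | h1
  · refine ⟨1, one_pos, fun n => ?_⟩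
    rcases Nat.eq_zero_or_pos n with rfl | hn
    · simp [Real.zero_rpow hs.ne']
    have hn' : (0 : ℝ) < n := by exact_mod_cast hn
    refine (Finset.sum_le_card_nsmul _ _ ((n : ℝ) ^ (s - 1)) fun j hj => ?_).trans_eq ?_
    · have : (j : ℝ) + 1 ≤ n := by exact_mod_cast Finset.mem_range.1 hj
      exact Real.rpow_le_rpow (by positivity) this (by linarith)
    · rw [Finset.card_range, nsmul_eq_mul, one_mul, Real.rpow_sub_one hn'.ne']
      field_simp
  · refine ⟨s⁻¹, inv_pos.2 hs, fun n => ?_⟩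
    -- `s x ^ (s - 1) ≤ x ^ s - (x - 1) ^ s` by concavity, and the right-hand sides telescope.
    induction n with
    | zero => simp [Real.zero_rpow hs.ne']
    | succ n ih =>
      rw [Finset.sum_range_succ]
      have hx : (0 : ℝ) < (n : ℝ) + 1 := by positivity
      have h2 := rpow_one_add_le_one_add_mul_self (s := -((n : ℝ) + 1)⁻¹)
        (by rw [neg_le_neg_iff]; exact inv_le_one_of_one_le₀ (by linarith [n.cast_nonneg (α := ℝ)]))
        hs.le h1.le
      have h3 : (n : ℝ) ^ s = ((n : ℝ) + 1) ^ s * (1 + -((n : ℝ) + 1)⁻¹) ^ s := by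
        have e : (1 : ℝ) + -((n : ℝ) + 1)⁻¹ = n / ((n : ℝ) + 1) := by field_simp; ring
        rw [e, ← Real.mul_rpow hx.le (by positivity), mul_div_cancel₀ _ hx.ne']
      have h4 := mul_le_mul_of_nonneg_left h2 (Real.rpow_nonneg hx.le s)
      rw [← h3] at h4
      have h5 : ((n : ℝ) + 1) ^ s * (1 + s * -((n : ℝ) + 1)⁻¹)
          = ((n : ℝ) + 1) ^ s - s * ((n : ℝ) + 1) ^ (s - 1) := by
        rw [Real.rpow_sub_one hx.ne']; field_simp; ring
      rw [h5] at h4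
      have h6 : ((n : ℝ) + 1) ^ (s - 1) ≤ s⁻¹ * (((n : ℝ) + 1) ^ s - (n : ℝ) ^ s) := by
        rw [inv_mul_eq_div, le_div_iff₀ hs]
        linarith
      push_cast
      linarith

variable {T r σ α : ℝ} {p : ℕ}

/-- The sum of the local errors is bounded by the error bound of the theorem; the three regimes are
those of a convergent, a logarithmically divergent and a power-like divergent sum. -/
theorem exists_sum_le_errorBound (hT : 0 < T) (hr : 1 ≤ r) (hσ0 : 0 < σ) (hα1 : α < 1) :
    ∃ C : ℝ, 0 < C ∧ ∀ N n : ℕ, 1 ≤ N → 1 ≤ n →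
      (N : ℝ) ^ (-r * (1 + 2 * σ - α) - α) * ∑ j ∈ Finset.range n,
        ((j : ℝ) + 1) ^ (r * (1 + 2 * σ - α) - (2 * p + 2 - α) - 1)
        ≤ C * errorBound T n N σ α r p := by
  set a := 1 + 2 * σ - α with ha
  set b := 2 * (p : ℝ) + 2 - α with hb
  have ha0 : 0 < a := by linarith
  have hr0 : 0 < r := by linarith
  rcases lt_trichotomy r (b / a) with h | h | h
  · obtain ⟨C, hC0, hC⟩ := exists_sum_rpow_le_of_neg (s := r * a - b)
      (by linarith [(lt_div_iff₀ ha0).1 h])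
    refine ⟨C, hC0, fun N n hN hn => ?_⟩
    rw [errorBound, if_pos h, mul_comm]
    exact mul_le_mul_of_nonneg_right (hC n) (by positivity)
  · refine ⟨1, one_pos, fun N n hN hn => ?_⟩
    have h1 : r * a = b := by rw [h, div_mul_cancel₀ _ ha0.ne']
    rw [errorBound, if_neg h.not_lt, if_pos h, h1, one_mul, sub_self, zero_sub]
    have h2 : -r * a - α = -2 * (p : ℝ) - 2 := by rw [neg_mul, h1, hb]; ring
    rw [h2]
    exact mul_le_mul_of_nonneg_left (sum_inv_le_one_add_log n) (by positivity)
  · obtain ⟨C, hC0, hC⟩ := exists_sum_rpow_le_of_pos (s := r * a - b)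
      (by linarith [(div_lt_iff₀ ha0).1 h])
    refine ⟨C * T ^ (-(a - b / r)), by positivity, fun N n hN hn => ?_⟩
    have hN' : (0 : ℝ) < N := by exact_mod_cast hN
    have hn' : (0 : ℝ) < n := by exact_mod_cast hn
    rw [errorBound, if_neg h.not_gt, if_neg h.ne', gridPoint, ← ha, ← hb]
    have h1 : (((n : ℝ) / N) ^ r * T) ^ (a - b / r)
        = (n : ℝ) ^ (r * a - b) * (N : ℝ) ^ (-(r * a - b)) * T ^ (a - b / r) := by
      have e : r * (a - b / r) = r * a - b := by field_simp
      rw [Real.mul_rpow (by positivity) hT.le, ← Real.rpow_mul (by positivity), e,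
        Real.div_rpow hn'.le hN'.le, Real.rpow_neg hN'.le, div_eq_mul_inv]
    have h2 : (N : ℝ) ^ (-2 * (p : ℝ) - 2) * (N : ℝ) ^ (-(r * a - b)) = (N : ℝ) ^ (-r * a - α) := by
      rw [← Real.rpow_add hN', hb]; congr 1; ring
    have h3 : T ^ (-(a - b / r)) * T ^ (a - b / r) = 1 := by
      rw [← Real.rpow_add hT, neg_add_cancel, Real.rpow_zero]
    rw [h1]
    calc (N : ℝ) ^ (-r * a - α) * ∑ j ∈ Finset.range n, ((j : ℝ) + 1) ^ (r * a - b - 1)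
        ≤ (N : ℝ) ^ (-r * a - α) * (C * (n : ℝ) ^ (r * a - b)) := by
          gcongr
          exact hC n
      _ = C * (T ^ (-(a - b / r)) * T ^ (a - b / r)) * (((N : ℝ) ^ (-2 * (p : ℝ) - 2)
          * (N : ℝ) ^ (-(r * a - b))) * (n : ℝ) ^ (r * a - b)) := by
          rw [h2, h3]; ring
      _ = _ := by ring

theorem grid_term_le (hT : 0 < T) (hr : 1 ≤ r) (hα0 : 0 < α) (hα1 : α < 1) {N j : ℕ} (hN : 1 ≤ N) :
    (gridPoint T r N (j + 1) - gridPoint T r N j) ^ (1 - α)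
      * ((gridPoint T r N (j + 1) - gridPoint T r N j) ^ (p + 1)
        * gridPoint T r N (j + 1) ^ (σ - p - 1)) ^ 2
      ≤ (r * T) ^ (2 * p + 3 - α) * T ^ (2 * (σ - p - 1)) * ((N : ℝ) ^ (-r * (1 + 2 * σ - α))
        * ((j : ℝ) + 1) ^ (r * (1 + 2 * σ - α) - (2 * p + 2 - α) - 1)) := by
  set k := gridPoint T r N (j + 1) - gridPoint T r N j with hk
  set y := gridPoint T r N (j + 1) with hy
  have hk0 : 0 < k := sub_pos.2 (gridPoint_lt hT hr hN j.lt_succ_self)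
  have hN' : (0 : ℝ) < N := by exact_mod_cast hN
  have hi : (0 : ℝ) < (j : ℝ) + 1 := by positivity
  have hy0 : y = (N : ℝ) ^ (-r) * ((j : ℝ) + 1) ^ r * T := by
    rw [hy, gridPoint, Real.rpow_neg hN'.le]
    push_cast
    rw [Real.div_rpow hi.le hN'.le]
    ring
  have hypos : 0 < y := by rw [hy0]; positivity
  have h1 : k ^ (1 - α) * (k ^ (p + 1) * y ^ (σ - p - 1)) ^ 2
      = k ^ (2 * p + 3 - α) * y ^ (2 * (σ - p - 1)) := by
    have e1 : k ^ (1 - α) * (k ^ (p + 1)) ^ 2 = k ^ (2 * p + 3 - α) := by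
      rw [← pow_mul, ← Real.rpow_natCast, ← Real.rpow_add hk0]
      congr 1; push_cast; ring
    have e2 : (y ^ (σ - p - 1)) ^ 2 = y ^ (2 * (σ - p - 1)) := by
      rw [← Real.rpow_natCast, ← Real.rpow_mul hypos.le]
      congr 1; push_cast; ring
    rw [mul_pow, ← mul_assoc, e1, e2]
  have he : 0 ≤ 2 * (p : ℝ) + 3 - α := by
    have : (0 : ℝ) ≤ p := p.cast_nonneg
    linarith
  have h2 : k ^ (2 * p + 3 - α)
      ≤ (r * T * ((N : ℝ) ^ (-r) * ((j : ℝ) + 1) ^ (r - 1))) ^ (2 * p + 3 - α) :=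
    Real.rpow_le_rpow hk0.le (gridPoint_sub_le hT hr hN j) he
  rw [h1]
  refine (mul_le_mul_of_nonneg_right h2 (Real.rpow_nonneg hypos.le _)).trans_eq ?_
  have e1 : (N : ℝ) ^ (-r * (2 * p + 3 - α)) * (N : ℝ) ^ (-r * (2 * (σ - p - 1)))
      = (N : ℝ) ^ (-r * (1 + 2 * σ - α)) := by
    rw [← Real.rpow_add hN']; congr 1; ring
  have e2 : ((j : ℝ) + 1) ^ ((r - 1) * (2 * p + 3 - α)) * ((j : ℝ) + 1) ^ (r * (2 * (σ - p - 1)))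
      = ((j : ℝ) + 1) ^ (r * (1 + 2 * σ - α) - (2 * p + 2 - α) - 1) := by
    rw [← Real.rpow_add hi]; congr 1; ring
  have e3 : (r * T * ((N : ℝ) ^ (-r) * ((j : ℝ) + 1) ^ (r - 1))) ^ (2 * p + 3 - α)
      = (r * T) ^ (2 * p + 3 - α) * ((N : ℝ) ^ (-r * (2 * p + 3 - α))
        * ((j : ℝ) + 1) ^ ((r - 1) * (2 * p + 3 - α))) := by
    rw [Real.mul_rpow (x := r * T) (by positivity) (by positivity), Real.mul_rpow
      (x := (N : ℝ) ^ (-r)) (by positivity) (by positivity), ← Real.rpow_mul hN'.le,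
      ← Real.rpow_mul hi.le]
  have e4 : ((N : ℝ) ^ (-r) * ((j : ℝ) + 1) ^ r * T) ^ (2 * (σ - p - 1))
      = (N : ℝ) ^ (-r * (2 * (σ - p - 1))) * ((j : ℝ) + 1) ^ (r * (2 * (σ - p - 1)))
        * T ^ (2 * (σ - p - 1)) := by
    rw [Real.mul_rpow (by positivity) hT.le, Real.mul_rpow (by positivity)
      (by positivity), ← Real.rpow_mul hN'.le, ← Real.rpow_mul hi.le]
  rw [hy0, e3, e4, ← e1, ← e2]
  ring

end Summation

/-! ### The subdiffusion problem -/

section Problem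

section

variable {H : Type*} [NormedAddCommGroup H] [InnerProductSpace ℝ H] [CompleteSpace H]
variable {T σ K S α : ℝ} {p n : ℕ} {D : ℕ → ℝ → H} {τ : ℕ → ℝ} {x₀ : H}

theorem HasSingularGrowth.eq_add_integral (h : HasSingularGrowth T σ K p D) (hσ0 : 0 < σ)
    (h0 : Tendsto (D 0) (𝓝[>] 0) (𝓝 x₀)) {t : ℝ} (ht : t ∈ Ioc 0 T) :
    D 0 t = x₀ + ∫ s in Ioc 0 t, D 1 s := by
  have hi : IntegrableOn (D 1) (Ioc 0 T) := h.integrable p.zero_le (by simpa using hσ0)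
  have hiI : IntegrableOn (D 1) (uIcc t 0) := by
    rw [uIcc_comm, uIcc_of_le ht.1.le, integrableOn_Icc_iff_integrableOn_Ioc]
    exact hi.mono_set (Ioc_subset_Ioc_right ht.2)
  have h1 : Tendsto (fun s => ∫ x in t..s, D 1 x) (𝓝[>] 0) (𝓝 (∫ x in t..0, D 1 x)) := by
    have hc := intervalIntegral.continuousOn_primitive_interval hiI 0 right_mem_uIcc
    refine hc.tendsto.mono_left ?_
    rw [uIcc_comm, uIcc_of_le ht.1.le, ← nhdsWithin_Ioc_eq_nhdsGT ht.1]
    exact nhdsWithin_mono _ Ioc_subset_Icc_self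
  have h2 : (fun s => ∫ x in t..s, D 1 x) =ᶠ[𝓝[>] 0] fun s => D 0 s - D 0 t := by
    filter_upwards [Ioc_mem_nhdsGT ht.1] with s hs
    rw [intervalIntegral.integral_symm, intervalIntegral.integral_of_le hs.2,
      ← sub_eq_integral_of_hasDerivWithinAt (h.deriv 0 p.zero_le) hi hs.1 hs.2 ht.2, neg_sub]
  have h3 := tendsto_nhds_unique (h1.congr' h2) (h0.sub_const (D 0 t))
  rw [intervalIntegral.integral_symm, intervalIntegral.integral_of_le ht.1.le] at h3
  rw [← sub_eq_iff_eq_add', ← neg_sub, ← h3, neg_neg]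

/-- The Riemann–Liouville derivative exceeds the Caputo derivative by `ω_(1-α)` times the initial
value. -/
theorem rlDeriv_eq_caputoDeriv (hm : IsMesh τ n S) (hn : 0 < n) (hα1 : α < 1) {v v' : ℝ → H}
    (hv' : Integrable v' (timeMeasure S)) (hd : ∀ᵐ t ∂(timeMeasure S), deriv v t = v' t)
    (hv : ∀ t ∈ Ioc 0 S, v t = x₀ + ∫ s in Ioc 0 t, v' s) :
    IsPiecewiseAC τ n S v ∧ ∀ᵐ t ∂(timeMeasure S),
      rlDeriv α v t = caputoDeriv α v t + omega (1 - α) t • x₀ := by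
  set J : ℕ → H := fun i => if i = 0 then x₀ else 0 with hJ
  have hJv : ∀ j < n, ∀ t ∈ Ioc (τ j) (τ (j + 1)),
      v t = ∑ i ∈ Finset.range (j + 1), J i + ∫ s in Ioc 0 t, v' s := fun j hj t ht => by
    rw [hv t (hm.subset hj ht)]
    simp [hJ]
  refine ⟨.of_jumps hm J hv' hJv, ?_⟩
  have hom := integrable_omK (S := S) (b := 1 - α) (by linarith)
  filter_upwards [rlDeriv_eq_cv hα1 (integrable_jumpDensity J hv') (ae_jumpMeasure_nonneg hm)
    (eq_cv_jumpDensity hm J hv' hJv), ae_restrict_mem measurableSet_Ioc,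
    (integrable_cv_integrand hom hv' S).prod_right_ae] with t h1 ht h2
  have h3 : caputoDeriv α v t = cv (timeMeasure S) (omK S (1 - α)) v' t := by
    rw [← cv_congr_ae hd t, ← rlIntegral_eq_cv (deriv v) ht, caputoDeriv, rlIntegral,
      ← intervalIntegral.integral_smul]
    refine intervalIntegral.integral_congr fun s _ => ?_
    simp only [omega, smul_smul]
    congr 1
    rw [div_eq_inv_mul, show 1 - α - 1 = -α by ring]
  rw [h1, cv_jumpMeasure hm J h2, h3, Finset.sum_eq_single_of_mem 0 (Finset.mem_range.2 hn)]
  · rw [hm.zero, sub_zero, omK_of_mem ht]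
    simp [hJ]
  · intro j _ hj
    simp [hJ, hj]

end

variable {d : ℕ} {Ω : Set (EuclideanSpace ℝ (Fin d))}

/-- The embedding of `H¹₀(Ω)` into `L²(Ω)` as a continuous linear map. -/
def toL2L (Ω : Set (EuclideanSpace ℝ (Fin d))) : H10 Ω →L[ℝ] L2 Ω :=
  (WithLp.fstL 2 ℝ (L2 Ω) (L2Vec Ω)).comp (H10 Ω).subtypeL

/-- The weak gradient as a continuous linear map. -/
def gradL (Ω : Set (EuclideanSpace ℝ (Fin d))) : H10 Ω →L[ℝ] L2Vec Ω :=
  (WithLp.sndL 2 ℝ (L2 Ω) (L2Vec Ω)).comp (H10 Ω).subtypeL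

theorem toL2L_apply (v : H10 Ω) : toL2L Ω v = toL2 v := rfl

theorem gradL_apply (v : H10 Ω) : gradL Ω v = grad v := rfl

theorem norm_toL2L_le (v : H10 Ω) : ‖toL2L Ω v‖ ≤ ‖v‖ := by
  have h1 : ‖v‖ ^ 2 = ‖toL2 v‖ ^ 2 + ‖grad v‖ ^ 2 := WithLp.prod_norm_sq_eq_of_L2 (v : GraphSpace Ω)
  rw [toL2L_apply]
  exact le_of_sq_le_sq (by nlinarith [sq_nonneg ‖grad v‖]) (norm_nonneg _)

variable {T σ K α r : ℝ} {p N n : ℕ} {u₀ : L2 Ω} {f : ℝ → L2 Ω} {u U X : ℝ → H10 Ω}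

theorem HasRegularity.hasSingularGrowth (hu : HasRegularity T σ p K u) :
    HasSingularGrowth T σ |K| p fun l t => toL2L Ω (iteratedDerivWithin l u (Ioc 0 T) t) where
  deriv l hl t ht := by
    have h1 := (hu.differentiable l hl t ht).hasDerivWithinAt
    rw [← iteratedDerivWithin_succ] at h1
    exact (toL2L Ω).hasFDerivAt.comp_hasDerivWithinAt t h1
  bound l hl t ht := by
    have h2 := Real.rpow_nonneg ht.1.le (σ - l)
    exact (norm_toL2L_le _).trans ((hu.bound l hl t ht).trans (by gcongr; exact le_abs_self K))

theorem HasRegularity.memLp (hu : HasRegularity T σ p K u) (hσ0 : 0 < σ) {S : ℝ} (hST : S ≤ T) :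
    MemLp u ⊤ (timeMeasure S) := by
  have hsub : Ioc 0 S ⊆ Ioc 0 T := Ioc_subset_Ioc_right hST
  have hc : ContinuousOn u (Ioc 0 S) := by
    have := (hu.differentiable 0 p.zero_le).continuousOn
    rw [iteratedDerivWithin_zero] at this
    exact this.mono hsub
  have : SecondCountableTopologyEither ℝ (H10 Ω) := secondCountableTopologyEither_of_left ℝ _
  refine memLp_top_of_bound (hc.aestronglyMeasurable measurableSet_Ioc) (|K| * (1 + T ^ σ))
    ((ae_restrict_mem measurableSet_Ioc).mono fun t ht => ?_)
  have h1 := hu.bound 0 (Nat.zero_le _) t (hsub ht)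
  rw [iteratedDerivWithin_zero, Nat.cast_zero, sub_zero] at h1
  have h2 : t ^ σ ≤ T ^ σ := Real.rpow_le_rpow ht.1.le (hsub ht).2 hσ0.le
  have h3 := Real.rpow_nonneg ht.1.le σ
  exact h1.trans (mul_le_mul (le_abs_self K) (by linarith) (by linarith) (abs_nonneg K))

/-- Galerkin orthogonality of the error. Only the equation on each mesh interval is needed, since the
test functions may jump. -/
theorem IsDGSolution.galerkin_orthogonality (hU : IsDGSolution Ω T α r p N u₀ f U)
    (hu : IsSolution Ω T α u₀ f u) (hT : 0 < T) (hr : 1 ≤ r) (hN : 1 ≤ N) (hn : n ≤ N) (hα1 : α < 1)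
    (hum : MemLp u ⊤ (timeMeasure (gridPoint T r N n)))
    (hUm : MemLp U ⊤ (timeMeasure (gridPoint T r N n)))
    (hXm : MemLp X ⊤ (timeMeasure (gridPoint T r N n)))
    (hLu : IsPiecewiseAC (gridPoint T r N) n (gridPoint T r N n) fun t => toL2L Ω (u t))
    (hLU : IsPiecewiseAC (gridPoint T r N) n (gridPoint T r N n) fun t => toL2L Ω (U t))
    (hcap : ∀ᵐ t ∂(timeMeasure (gridPoint T r N n)), rlDeriv α (fun s => toL2L Ω (u s)) t
      = caputoDeriv α (fun s => toL2L Ω (u s)) t + omega (1 - α) t • u₀)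
    (hX : ∀ j < n, IsPolyOn p (Ioc (gridPoint T r N j) (gridPoint T r N (j + 1))) X) :
    rlForm α (gridPoint T r N n) (fun t => toL2L Ω (U t) - toL2L Ω (u t)) (fun t => toL2L Ω (X t))
      + ∫ t, inner ℝ (gradL Ω (U t) - gradL Ω (u t)) (gradL Ω (X t))
        ∂(timeMeasure (gridPoint T r N n)) = 0 := by
  have hm := isMesh_gridPoint hT hr hN n
  set τ := gridPoint T r N with hτ
  set S := τ n with hS
  have hLX : MemLp (fun t => toL2L Ω (X t)) ⊤ (timeMeasure S) := (toL2L Ω).comp_memLp' hXm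
  have hGX : MemLp (fun t => gradL Ω (X t)) ⊤ (timeMeasure S) := (gradL Ω).comp_memLp' hXm
  have hG : ∀ {v : ℝ → H10 Ω}, MemLp v ⊤ (timeMeasure S) →
      Integrable (fun t => inner ℝ (gradL Ω (v t)) (gradL Ω (X t))) (timeMeasure S) := fun hv =>
    integrable_inner_of_bounded (integrable_of_memLp_top ((gradL Ω).comp_memLp' hv)) hGX
  have hR : ∀ {v : ℝ → L2 Ω}, IsPiecewiseAC τ n S v →
      Integrable (fun t => inner ℝ (rlDeriv α v t) (toL2L Ω (X t))) (timeMeasure S) := fun hv =>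
    integrable_inner_of_bounded (hv.integrable_rlDeriv hm hα1) hLX
  have hf : ∀ᵐ t ∂(timeMeasure S), inner ℝ (rlDeriv α (fun s => toL2L Ω (u s)) t) (toL2L Ω (X t))
      + inner ℝ (gradL Ω (u t)) (gradL Ω (X t))
      = inner ℝ (f t + omega (1 - α) t • u₀) (toL2 (X t)) := by
    have h1 := ae_mono (Measure.restrict_mono (Ioc_subset_Ioc_right (gridPoint_le hT hr hN hn))
      le_rfl) hu.equation
    filter_upwards [h1, hcap] with t h1 h2
    have h3 := h1 (X t)
    rw [h2, inner_add_left, inner_add_left, ← h3]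
    simp only [toL2L_apply, gradL_apply]
    ring
  -- The right-hand side is integrable because the left-hand side of the equation for `u` is.
  have hfi := ((hR hLu).add (hG hum)).congr hf
  have hsum : ∫ t, (inner ℝ (rlDeriv α (fun s => toL2L Ω (U s)) t) (toL2L Ω (X t))
      + inner ℝ (gradL Ω (U t)) (gradL Ω (X t))) ∂(timeMeasure S)
      = ∫ t, inner ℝ (f t + omega (1 - α) t • u₀) (toL2 (X t)) ∂(timeMeasure S) := by
    rw [hm.integral_eq_sum (f := fun t => inner ℝ (rlDeriv α (fun s => toL2L Ω (U s)) t)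
      (toL2L Ω (X t)) + inner ℝ (gradL Ω (U t)) (gradL Ω (X t))) ((hR hLU).add (hG hUm)),
      hm.integral_eq_sum hfi]
    refine Finset.sum_congr rfl fun j hj => ?_
    have hj' := Finset.mem_range.1 hj
    exact hU.equation (j + 1) (by omega) (by omega) X (hX j hj')
  rw [rlForm_sub_left hm hα1 hLU hLu hLX, rlForm, rlForm]
  simp only [inner_sub_left]
  rw [integral_sub (hG hUm) (hG hum)]
  have h1 := integral_add (hR hLU) (hG hUm)
  have h2 := integral_add (hR hLu) (hG hum)
  have h3 := integral_congr_ae hf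
  linarith

end Problem

/-! ### The error estimate -/

section ErrorEstimate

open Polynomial

variable {d m p N n : ℕ} {Ω : Set (EuclideanSpace ℝ (Fin d))} {T σ K α r B : ℝ}
  {u₀ : L2 Ω} {f : ℝ → L2 Ω} {u U : ℝ → H10 Ω} {ψ : Fin m → ℝ[X]}

theorem exists_bound_eval_derivative (ψ : Fin m → ℝ[X]) : ∃ B : ℝ, 0 ≤ B ∧
    (∀ l, ∀ x ∈ Icc (0 : ℝ) 1, |(ψ l).eval x| ≤ B) ∧
    ∀ l, ∀ x ∈ Icc (0 : ℝ) 1, |(derivative (ψ l)).eval x| ≤ B := by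
  choose B₁ h₁ hB₁ using fun l => exists_bound_eval (ψ l)
  choose B₂ h₂ hB₂ using fun l => exists_bound_eval (derivative (ψ l))
  have e₁ : ∀ l, B₁ l ≤ ∑ l, B₁ l := fun l =>
    Finset.single_le_sum (fun i _ => h₁ i) (Finset.mem_univ l)
  have e₂ : ∀ l, B₂ l ≤ ∑ l, B₂ l := fun l =>
    Finset.single_le_sum (fun i _ => h₂ i) (Finset.mem_univ l)
  have n₁ : 0 ≤ ∑ l, B₁ l := Finset.sum_nonneg fun l _ => h₁ l
  have n₂ : 0 ≤ ∑ l, B₂ l := Finset.sum_nonneg fun l _ => h₂ l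
  refine ⟨∑ l, B₁ l + ∑ l, B₂ l, by linarith, fun l x hx => ?_, fun l x hx => ?_⟩
  · linarith [hB₁ l x hx, e₁ l]
  · linarith [hB₂ l x hx, e₂ l]

theorem dualConst_nonneg (hα0 : 0 < α) (hα1 : α < 1) : 0 ≤ dualConst α := by
  have := fracConst_nonneg hα0 hα1
  have : 0 < 1 - α := by linarith
  rw [dualConst]
  positivity

theorem IsPolyOn.sum {F ι : Type*} [NormedAddCommGroup F] [NormedSpace ℝ F] {A : Set ℝ}
    (s : Finset ι) {v : ι → ℝ → F} (hv : ∀ i ∈ s, IsPolyOn p A (v i)) :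
    IsPolyOn p A fun t => ∑ i ∈ s, v i t := by
  choose! c hc using hv
  refine ⟨fun l => ∑ i ∈ s, c i l, fun t ht => ?_⟩
  simp only [Finset.smul_sum]
  rw [Finset.sum_comm]
  exact Finset.sum_congr rfl fun i hi => hc i hi t ht

theorem isPolyOn_sum_meshFn {F : Type*} [NormedAddCommGroup F] [NormedSpace ℝ F] {τ : ℕ → ℝ} {S : ℝ}
    (h : IsMesh τ n S) (hdeg : ∀ i, (ψ i).natDegree ≤ p) (c : Fin n × Fin m → F) {j : ℕ}
    (hj : j < n) : IsPolyOn p (Ioc (τ j) (τ (j + 1))) fun t => ∑ x, meshFn τ ψ x t • c x := by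
  refine .sum _ fun x _ => isPolyOn_pieceFn (hdeg x.2) _ ?_ (c x)
  by_cases hx : j = x.1
  · exact Or.inl (by rw [hx])
  · exact Or.inr (Set.disjoint_left.2 fun t h1 h2 => hx (h.eq_of_mem hj x.1.2 h1 h2))

/-- The size of the error of local polynomial approximation on the mesh interval number `j`, up to a
constant factor. -/
def localError (T σ r : ℝ) (p N j : ℕ) : ℝ :=
  (gridPoint T r N (j + 1) - gridPoint T r N j) ^ (p + 1) * gridPoint T r N (j + 1) ^ (σ - p - 1)

/-- The sum of the squared local errors, with the weights of the fractional seminorm. -/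
def localErrorSum (T σ α r : ℝ) (p N n : ℕ) : ℝ :=
  ∑ j ∈ Finset.range n, (gridPoint T r N (j + 1) - gridPoint T r N j) ^ (1 - α)
    * localError T σ r p N j ^ 2

theorem gridPoint_sub_pos (hT : 0 < T) (hr : 1 ≤ r) (hN : 1 ≤ N) (j : ℕ) :
    0 < gridPoint T r N (j + 1) - gridPoint T r N j :=
  sub_pos.2 (gridPoint_lt hT hr hN j.lt_succ_self)

theorem localError_nonneg (hT : 0 < T) (hr : 1 ≤ r) (hN : 1 ≤ N) (j : ℕ) :
    0 ≤ localError T σ r p N j :=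
  mul_nonneg (pow_nonneg (gridPoint_sub_pos hT hr hN j).le _)
    (Real.rpow_nonneg (mul_nonneg (Real.rpow_nonneg (by positivity) _) hT.le) _)

theorem localErrorSum_nonneg (hT : 0 < T) (hr : 1 ≤ r) (hN : 1 ≤ N) (n : ℕ) :
    0 ≤ localErrorSum T σ α r p N n :=
  Finset.sum_nonneg fun j _ =>
    mul_nonneg (Real.rpow_nonneg (gridPoint_sub_pos hT hr hN j).le _) (sq_nonneg _)

theorem sum_sub_mul_localError_le (hT : 0 < T) (hr : 1 ≤ r) (hN : 1 ≤ N) (hα0 : 0 < α)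
    (hn : n ≤ N) : ∑ j ∈ Finset.range n, (gridPoint T r N (j + 1) - gridPoint T r N j)
      * localError T σ r p N j ^ 2 ≤ (r * T / N) ^ α * localErrorSum T σ α r p N n := by
  rw [localErrorSum, Finset.mul_sum]
  refine Finset.sum_le_sum fun j hj => ?_
  have h0 := gridPoint_sub_pos hT hr hN j
  have h1 := gridPoint_sub_le' hT hr hN ((Finset.mem_range.1 hj).trans_le hn)
  set y := gridPoint T r N (j + 1) - gridPoint T r N j
  have h2 : y = y ^ α * y ^ (1 - α) := by
    rw [← Real.rpow_add h0, add_sub_cancel, Real.rpow_one]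
  calc y * localError T σ r p N j ^ 2
      = y ^ α * (y ^ (1 - α) * localError T σ r p N j ^ 2) := by rw [← mul_assoc, ← h2]
    _ ≤ _ := mul_le_mul_of_nonneg_right (Real.rpow_le_rpow h0.le h1 hα0.le)
        (mul_nonneg (Real.rpow_nonneg h0.le _) (sq_nonneg _))

theorem localErrorSum_le (hT : 0 < T) (hr : 1 ≤ r) (hN : 1 ≤ N) (hα0 : 0 < α) (hα1 : α < 1)
    (n : ℕ) : (r * T / N) ^ α * localErrorSum T σ α r p N n
      ≤ (r * T) ^ α * ((r * T) ^ (2 * p + 3 - α) * T ^ (2 * (σ - p - 1)))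
        * ((N : ℝ) ^ (-r * (1 + 2 * σ - α) - α) * ∑ j ∈ Finset.range n,
          ((j : ℝ) + 1) ^ (r * (1 + 2 * σ - α) - (2 * p + 2 - α) - 1)) := by
  have hN' : (0 : ℝ) < N := by exact_mod_cast hN
  have hk : (r * T / N) ^ α * (N : ℝ) ^ (-r * (1 + 2 * σ - α))
      = (r * T) ^ α * (N : ℝ) ^ (-r * (1 + 2 * σ - α) - α) := by
    rw [Real.div_rpow (by positivity) hN'.le, Real.rpow_sub hN']
    ring
  set E := (r * T) ^ (2 * p + 3 - α) * T ^ (2 * (σ - p - 1))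
  calc (r * T / N) ^ α * localErrorSum T σ α r p N n
      ≤ (r * T / N) ^ α * ∑ j ∈ Finset.range n, E * ((N : ℝ) ^ (-r * (1 + 2 * σ - α))
        * ((j : ℝ) + 1) ^ (r * (1 + 2 * σ - α) - (2 * p + 2 - α) - 1)) :=
        mul_le_mul_of_nonneg_left (Finset.sum_le_sum fun j _ => grid_term_le hT hr hα0 hα1 hN)
          (by positivity)
    _ = ((r * T / N) ^ α * (N : ℝ) ^ (-r * (1 + 2 * σ - α))) * E * ∑ j ∈ Finset.range n,
          ((j : ℝ) + 1) ^ (r * (1 + 2 * σ - α) - (2 * p + 2 - α) - 1) := by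
        rw [← Finset.mul_sum, ← Finset.mul_sum]
        ring
    _ = _ := by rw [hk]; ring

/-- The solution is piecewise absolutely continuous, and its two fractional derivatives are
related. -/
theorem HasRegularity.rlDeriv_eq (hreg : HasRegularity T σ p K u) (hsol : IsSolution Ω T α u₀ f u)
    (hσ0 : 0 < σ) (hα1 : α < 1) {τ : ℕ → ℝ} {S : ℝ} (hm : IsMesh τ n S) (hn : 0 < n) (hST : S ≤ T) :
    IsPiecewiseAC τ n S (fun t => toL2L Ω (u t)) ∧
    ∀ᵐ t ∂(timeMeasure S), rlDeriv α (fun s => toL2L Ω (u s)) t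
      = caputoDeriv α (fun s => toL2L Ω (u s)) t + omega (1 - α) t • u₀ := by
  have hsub : Ioc 0 S ⊆ Ioc 0 T := Ioc_subset_Ioc_right hST
  have hgr := hreg.hasSingularGrowth
  set D : ℕ → ℝ → L2 Ω := fun l t => toL2L Ω (iteratedDerivWithin l u (Ioc 0 T) t) with hD
  have hD0 : D 0 = fun t => toL2L Ω (u t) := by
    simp only [hD, iteratedDerivWithin_zero]
  rw [← hD0]
  have hne : ∀ᵐ t : ℝ, t ≠ T := by simp [ae_iff, measure_singleton]
  refine rlDeriv_eq_caputoDeriv hm hn hα1 (v' := D 1)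
    ((hgr.integrable p.zero_le (by simpa using hσ0)).mono_set hsub) ?_
    fun t ht => hgr.eq_add_integral hσ0 (by rw [hD0]; exact hsol.initial) (hsub ht)
  filter_upwards [ae_restrict_mem measurableSet_Ioc, ae_restrict_of_ae hne] with t ht hne
  exact ((hgr.deriv 0 p.zero_le t (hsub ht)).hasDerivAt
    (Ioc_mem_nhds ht.1 (lt_of_le_of_ne (hsub ht).2 hne))).deriv

section

variable (hT : 0 < T) (hα0 : 0 < α) (hα1 : α < 1) (hσ0 : 0 < σ) (hσp : σ ≤ p + 1) (hr : 1 ≤ r)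
  (hon : ∀ i j, ∫ x in Ioc (0 : ℝ) 1, (ψ i).eval x * (ψ j).eval x = if i = j then 1 else 0)
  (hspan : ∀ q : ℝ[X], q.natDegree ≤ p → ∃ c : Fin m → ℝ, ∀ x, q.eval x = ∑ i, c i * (ψ i).eval x)
  (hB0 : 0 ≤ B) (hB : ∀ l, ∀ x ∈ Icc (0 : ℝ) 1, |(ψ l).eval x| ≤ B)
  (hB' : ∀ l, ∀ x ∈ Icc (0 : ℝ) 1, |(derivative (ψ l)).eval x| ≤ B)
  (hreg : HasRegularity T σ p K u) (hN : 1 ≤ N) (hnN : n ≤ N)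

include hT hα0 hα1 hσ0 hσp hr hon hspan hB0 hB hB' hreg hN hnN

/-- The error of the `L²` projection of the solution, in terms of the local errors. -/
theorem solution_projection_error_le {η : ℝ → L2 Ω}
    (hη : ∀ t, η t = toL2L Ω (u t) - ∑ x : Fin n × Fin m, meshFn (gridPoint T r N) ψ x t
      • ∫ s, meshFn (gridPoint T r N) ψ x s • toL2L Ω (u s) ∂(timeMeasure (gridPoint T r N n))) :
    fracSq α (gridPoint T r N n) η ≤ ENNReal.ofReal (fracConst α * ((1 + m * B ^ 2) ^ 2
      * (approxConst T σ r |K| p ^ 2 * localErrorSum T σ α r p N n))) ∧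
    normSq (gridPoint T r N n) η ≤ (1 + m * B ^ 2) ^ 2
      * (approxConst T σ r |K| p ^ 2 * ((r * T / N) ^ α * localErrorSum T σ α r p N n)) := by
  have hST := gridPoint_le hT hr hN hnN
  have hsub : Ioc 0 (gridPoint T r N n) ⊆ Ioc 0 T := Ioc_subset_Ioc_right hST
  have hgr := hreg.hasSingularGrowth
  set D : ℕ → ℝ → L2 Ω := fun l t => toL2L Ω (iteratedDerivWithin l u (Ioc 0 T) t) with hD
  have hD0 : D 0 = fun t => toL2L Ω (u t) := by
    simp only [hD, iteratedDerivWithin_zero]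
  have hvm : MemLp (D 0) ⊤ (timeMeasure (gridPoint T r N n)) := by
    rw [hD0]
    exact (toL2L Ω).comp_memLp' (hreg.memLp hσ0 hST)
  have hc0 : 0 ≤ approxConst T σ r |K| p := approxConst_nonneg hT hσ0 (abs_nonneg K)
  obtain ⟨h1, h2⟩ := mesh_projection_error_le (η := η) (B := B) hα0 hα1 (isMesh_gridPoint hT hr hN n)
    hon hspan hB0 hB hB' hvm ((hgr.integrable p.zero_le (by simpa using hσ0)).mono_set hsub)
    (fun t ht => (hgr.deriv 0 p.zero_le t (hsub ht)).mono hsub)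
    (M := fun j => approxConst T σ r |K| p * localError T σ r p N j)
    (fun j => mul_nonneg hc0 (localError_nonneg hT hr hN j))
    (fun j hj => hgr.exists_approx_grid hT hr hσ0 hσp (abs_nonneg K) (hj.trans_le hnN))
    (fun t => by rw [hη t, hD0])
  constructor
  · refine h1.trans_eq ?_
    rw [localErrorSum, Finset.mul_sum (a := approxConst T σ r |K| p ^ 2)]
    congr 3
    exact Finset.sum_congr rfl fun j _ => by ring
  · refine h2.trans (mul_le_mul_of_nonneg_left ?_ (sq_nonneg _))
    refine le_of_eq_of_le ?_ (mul_le_mul_of_nonneg_left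
      (sum_sub_mul_localError_le hT hr hN hα0 hnN) (sq_nonneg _))
    rw [Finset.mul_sum]
    exact Finset.sum_congr rfl fun j _ => by ring

/-- The error in terms of the local errors. -/
theorem normSq_error_le_localErrorSum (hdeg : ∀ i, (ψ i).natDegree ≤ p)
    (hsol : IsSolution Ω T α u₀ f u) (hdg : IsDGSolution Ω T α r p N u₀ f U) (hn : 1 ≤ n) :
    MemLp (fun t => toL2L Ω (U t) - toL2L Ω (u t)) ⊤ (timeMeasure (gridPoint T r N n)) ∧
    normSq (gridPoint T r N n) (fun t => toL2L Ω (U t) - toL2L Ω (u t))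
      ≤ (2 * (dualConst α * fracConst α) + 2) * (1 + m * B ^ 2) ^ 2 * approxConst T σ r |K| p ^ 2
        * ((r * T / N) ^ α * localErrorSum T σ α r p N n) := by
  have hm := isMesh_gridPoint hT hr hN n
  have hN' : (0 : ℝ) < N := by exact_mod_cast hN
  have hS0 : 0 < gridPoint T r N n := by
    have := gridPoint_lt hT hr hN hn
    rwa [gridPoint_zero hr] at this
  have hum := hreg.memLp hσ0 (gridPoint_le hT hr hN hnN)
  obtain ⟨hLu, hcap⟩ := hreg.rlDeriv_eq hsol hσ0 hα1 hm hn (gridPoint_le hT hr hN hnN)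
  have hφ : ∀ x, IsPiecewiseAC (gridPoint T r N) n (gridPoint T r N n)
      (meshFn (n := n) (gridPoint T r N) ψ x) := isPiecewiseAC_meshFn hm ψ
  have hφm := fun x => (hφ x).memLp
  obtain ⟨b, hb⟩ := exists_eq_sum_meshFn hm hspan (v := U) fun j hj =>
    hdg.poly (j + 1) (by omega) (by omega)
  have hbae : ∀ᵐ t ∂(timeMeasure (gridPoint T r N n)),
      ∑ x, meshFn (gridPoint T r N) ψ x t • b x = U t :=
    (ae_restrict_mem measurableSet_Ioc).mono fun t ht => (hb t ht).symm
  have hUm : MemLp U ⊤ (timeMeasure (gridPoint T r N n)) := (memLp_sum_smul hφm b).ae_eq hbae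
  have hLU : IsPiecewiseAC (gridPoint T r N) n (gridPoint T r N n) fun t => toL2L Ω (U t) :=
    (rlDeriv_sum_smul (α := α) hm hα1 Finset.univ (fun x _ => hφ x) fun x => toL2L Ω (b x)).1.congr
      (hbae.mono fun t ht => by simp only [← ht, map_sum, map_smul])
  have hstep : ∀ c : ℕ → L2 Ω, ∃ w : Fin n × Fin m → L2 Ω, ∀ t ∈ Ioc 0 (gridPoint T r N n),
      stepFun (gridPoint T r N) n c t = ∑ x, meshFn (gridPoint T r N) ψ x t • w x := fun c =>
    exists_eq_sum_meshFn hm hspan fun j hj => ⟨fun i => if i = 0 then c j else 0, fun t ht => by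
      rw [stepFun_of_mem hm c hj ht]
      simp⟩
  have hgal : ∀ x : Fin n × Fin m → H10 Ω, rlForm α (gridPoint T r N n)
      (fun t => toL2L Ω (U t) - toL2L Ω (u t))
        (fun t => ∑ i, meshFn (gridPoint T r N) ψ i t • toL2L Ω (x i))
      + ∫ t, inner ℝ (gradL Ω (U t) - gradL Ω (u t))
        (∑ i, meshFn (gridPoint T r N) ψ i t • gradL Ω (x i))
        ∂(timeMeasure (gridPoint T r N n)) = 0 := fun x => by
    have h1 := hdg.galerkin_orthogonality hsol hT hr hN hnN hα1 hum hUm (memLp_sum_smul hφm x) hLu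
      hLU hcap (fun j hj => isPolyOn_sum_meshFn hm hdeg x hj)
    simpa only [map_sum, map_smul] using h1
  have hcomm : ∀ x : Fin n × Fin m,
      toL2L Ω (∫ s, meshFn (gridPoint T r N) ψ x s • u s ∂(timeMeasure (gridPoint T r N n)))
      = ∫ s, meshFn (gridPoint T r N) ψ x s • toL2L Ω (u s) ∂(timeMeasure (gridPoint T r N n)) :=
    fun x => by
      obtain ⟨M, hM, hMb⟩ := exists_bound_of_memLp_top hum
      have hi : Integrable (fun s => meshFn (gridPoint T r N) ψ x s • u s)
          (timeMeasure (gridPoint T r N n)) :=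
        (integrable_of_memLp_top (hφm x)).smul_bdd M hum.1 hMb
      rw [← (toL2L Ω).integral_comp_comm hi]
      simp only [map_smul]
  obtain ⟨hfrac, hnorm⟩ := solution_projection_error_le (n := n) hT hα0 hα1 hσ0 hσp hr hon hspan hB0
    hB hB' hreg hN hnN fun t => rfl
  have hQ := localErrorSum_nonneg (σ := σ) (α := α) (p := p) hT hr hN n
  have hF := fracConst_nonneg hα0 hα1
  obtain ⟨hmemLp, hmain⟩ := normSq_galerkin_error_le (k := r * T / N) hα0 hα1 hm hS0 (by positivity)
    (fun j hj => gridPoint_sub_le' hT hr hN (hj.trans_le hnN)) (toL2L Ω) (gradL Ω) hφ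
    (integral_meshFn_mul hm hon) hstep hum hb hLu hgal (fun t _ => by simp only [hcomm])
    (by positivity) hfrac
  refine ⟨hmemLp, hmain.trans ?_⟩
  calc _ ≤ 2 * (dualConst α * (r * T / N) ^ α * (fracConst α * ((1 + m * B ^ 2) ^ 2
        * (approxConst T σ r |K| p ^ 2 * localErrorSum T σ α r p N n))))
        + 2 * ((1 + m * B ^ 2) ^ 2 * (approxConst T σ r |K| p ^ 2
          * ((r * T / N) ^ α * localErrorSum T σ α r p N n))) := by gcongr
    _ = _ := by ring

end

end ErrorEstimate

end Subdiffusion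

end

theorem theorem1 {d : ℕ} (Ω : Set (EuclideanSpace ℝ (Fin d))) (hΩ : IsOpen Ω)
    (hΩb : Bornology.IsBounded Ω) (T α σ r K : ℝ) (p : ℕ)
    (hT : 0 < T) (hα0 : 0 < α) (hα1 : α < 1) (hσ0 : 0 < σ) (hσp : σ ≤ p + 1) (hr : 1 ≤ r) :
    ∃ C : ℝ, 0 < C ∧
      ∀ (u₀ : Subdiffusion.L2 Ω) (f : ℝ → Subdiffusion.L2 Ω) (u : ℝ → Subdiffusion.H10 Ω),
        Subdiffusion.IsSolution Ω T α u₀ f u →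
        Subdiffusion.HasRegularity T σ p K u →
        ∀ N : ℕ, 1 ≤ N → ∀ U : ℝ → Subdiffusion.H10 Ω,
          Subdiffusion.IsDGSolution Ω T α r p N u₀ f U →
          ∀ n : ℕ, 1 ≤ n → n ≤ N →
            IntegrableOn (fun t => ‖Subdiffusion.toL2 (U t) - Subdiffusion.toL2 (u t)‖ ^ 2)
              (Ioc 0 (Subdiffusion.gridPoint T r N n)) ∧
            ∫ t in Ioc 0 (Subdiffusion.gridPoint T r N n), ‖Subdiffusion.toL2 (U t) - Subdiffusion.toL2 (u t)‖ ^ 2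
              ≤ C * Subdiffusion.errorBound T n N σ α r p := by
  obtain ⟨m, ψ, hdeg, hon, hspan⟩ := Subdiffusion.exists_orthonormal_polynomial p
  obtain ⟨B, hB0, hB, hB'⟩ := Subdiffusion.exists_bound_eval_derivative ψ
  obtain ⟨C, hC0, hC⟩ := Subdiffusion.exists_sum_le_errorBound (p := p) hT hr hσ0 hα1
  have hF := Subdiffusion.fracConst_nonneg hα0 hα1
  have hD := Subdiffusion.dualConst_nonneg hα0 hα1
  set A := (2 * (Subdiffusion.dualConst α * Subdiffusion.fracConst α) + 2) * (1 + m * B ^ 2) ^ 2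
    * Subdiffusion.approxConst T σ r |K| p ^ 2 with hA
  set E := (r * T) ^ α * ((r * T) ^ (2 * p + 3 - α) * T ^ (2 * (σ - p - 1))) with hE
  have hA0 : 0 ≤ A := by positivity
  have hE0 : 0 < E := by positivity
  -- `A` vanishes if `K = 0`, while the constant of the theorem has to be positive.
  refine ⟨(A + 1) * E * C, by positivity, ?_⟩
  intro u₀ f u hsol hreg N hN U hdg n hn hnN
  obtain ⟨h1, h2⟩ := Subdiffusion.normSq_error_le_localErrorSum hT hα0 hα1 hσ0 hσp hr hon hspan hB0
    hB hB' hreg hN hnN hdeg hsol hdg hn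
  have h3 := Subdiffusion.localErrorSum_le (σ := σ) (p := p) hT hr hN hα0 hα1 n
  have h4 := hC N n hN hn
  refine ⟨Subdiffusion.integrable_normSq h1, h2.trans ?_⟩
  set Z := (N : ℝ) ^ (-r * (1 + 2 * σ - α) - α) * ∑ j ∈ Finset.range n,
    ((j : ℝ) + 1) ^ (r * (1 + 2 * σ - α) - (2 * p + 2 - α) - 1)
  have hZ : 0 ≤ Z := by positivity
  calc A * ((r * T / N) ^ α * Subdiffusion.localErrorSum T σ α r p N n)
      ≤ A * (E * Z) := mul_le_mul_of_nonneg_left h3 hA0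
    _ ≤ (A + 1) * E * Z := by linarith [mul_nonneg hE0.le hZ]
    _ ≤ (A + 1) * E * (C * Subdiffusion.errorBound T n N σ α r p) :=
        mul_le_mul_of_nonneg_left h4 (by positivity)
    _ = _ := by ring
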